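/- Let $P\ge 0$ and let $C^{in},C^{out}\in\mathbb R^{P\times P}$ be correlation matrices (positive semidefinite with unit diagonal). For dimensions $N_s,N_x,N_y\ge 1$ draw random mixing matrices $A_\mu\in\mathbb R^{N_x\times N_s}$, $B_\mu\in\mathbb R^{N_y\times N_s}$ ($\mu=1,\dots,P$) such that all the vectors $a_{ij}=(A_{1,ij},\dots,A_{P,ij})$ and $b_{ij}=(B_{1,ij},\dots,B_{P,ij})$ are independent, with $a_{ij}\sim\mathcal N(0,\tfrac1{N_s}C^{in})$ and $b_{ij}\sim\mathcal N(0,\tfrac1{N_s}C^{out})$. In task $\mu$ the input is $x=A_\mu s$ and the target is $y^*=B_\mu s$ with latent factor $s\sim\mathcal N(0,I_{N_s})$; the linear network $y=Wx$, $W\in\mathbb R^{N_y\times N_x}$, has error $\epsilon_\mu[W]=\mathbb E_s\|y^*-y\|^2$. Put $W_0=0$ and, for $\mu=1,\dots,P$, let $W_\mu$ be the limit as $t\to\infty$ of the gradient flow $\frac{dW}{dt}=-\frac{\partial\epsilon_\mu}{\partial W}[W]$ started at $W(0)=W_{\mu-1}$. The final error is $\epsilon_f=\frac1{N_y}\sum_{\mu=1}^P\epsilon_\mu[W_P]$.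 1. For all matrices $A_\mu,B_\mu$ (and all dimensions) the sequence $W_0,\dots,W_P$ exists and is unique. 2. With $P,C^{in},C^{out}$ fixed, along every sequence of dimensions $N_s,N_x,N_y\ge1$ with $N_s/N_x\to0$, the expectation $\bar\epsilon_f=\mathbb E_{A,B}[\epsilon_f]$ is eventually finite and $$\bar\epsilon_f\;\longrightarrow\;\mathcal E(C^{in},C^{out}):=\Bigl\|(C^{out})^{1/2}\bigl(I-(I+C^{in,U})^{-1}C^{in}\bigr)\Bigr\|_F^2 ,$$ where $(C^{out})^{1/2}$ is the positive semidefinite square root, $\|\cdot\|_F$ is the Frobenius norm, and $C^{in,U}$ is the strictly upper-triangular part of $C^{in}$: $C^{in,U}_{\mu\nu}=C^{in}_{\mu\nu}$ if $\mu<\nu$ and $0$ otherwise. 3. The limit depends on the task order: for every $P\ge3$ there are correlation matrices $C^{in},C^{out}\in\mathbb R^{P\times P}$ and a permutation $\sigma$ of the tasks such that $\mathcal E\bigl((C^{in}_{\sigma(\mu)\sigma(\nu)}),(C^{out}_{\sigma(\mu)\sigma(\nu)})\bigr)\ne\mathcal E(C^{in},C^{out})$. -/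

import Mathlib

open MeasureTheory ProbabilityTheory Filter Topology

noncomputable section

namespace ContinualLearning

/-- A correlation matrix: real positive semidefinite (in particular symmetric), unit diagonal. -/
structure IsCorrelationMatrix {P : ℕ} (C : Matrix (Fin P) (Fin P) ℝ) : Prop where
  posSemidef : C.PosSemidef
  diag : ∀ μ, C μ μ = 1

/-- The error of the linear network `y = W x` on the task `x = A s`, `y* = B s`, namely the mean of
`‖y* - y‖²` over the standard Gaussian latent factor `s`. -/
def taskError {Ns Nx Ny : ℕ} (A : Matrix (Fin Nx) (Fin Ns) ℝ) (B : Matrix (Fin Ny) (Fin Ns) ℝ)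
    (W : Matrix (Fin Ny) (Fin Nx) ℝ) : ℝ :=
  ∫ s, ‖WithLp.toLp 2 (B.mulVec (WithLp.ofLp s) - W.mulVec (A.mulVec (WithLp.ofLp s)))‖ ^ 2
    ∂(stdGaussian (EuclideanSpace ℝ (Fin Ns)))

/-- The gradient `∂ε/∂W` of the task error, as the matrix of its partial derivatives. -/
def taskErrorGrad {Ns Nx Ny : ℕ} (A : Matrix (Fin Nx) (Fin Ns) ℝ)
    (B : Matrix (Fin Ny) (Fin Ns) ℝ) (W : Matrix (Fin Ny) (Fin Nx) ℝ) :
    Matrix (Fin Ny) (Fin Nx) ℝ :=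
  Matrix.of fun i j => deriv (fun h : ℝ => taskError A B (W + h • Matrix.single i j 1)) 0

/-- Gradient flow on the error of the task `(A, B)`, started at `W₀`, converges to `W₁`. -/
def TrainsTo {Ns Nx Ny : ℕ} (A : Matrix (Fin Nx) (Fin Ns) ℝ) (B : Matrix (Fin Ny) (Fin Ns) ℝ)
    (W₀ W₁ : Matrix (Fin Ny) (Fin Nx) ℝ) : Prop :=
  ∃ w : ℝ → Matrix (Fin Ny) (Fin Nx) ℝ,
    w 0 = W₀ ∧
    (∀ t, 0 ≤ t → ∀ i j,
      HasDerivWithinAt (fun τ => w τ i j) (-(taskErrorGrad A B (w t) i j)) (Set.Ici 0) t) ∧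
    Tendsto w atTop (𝓝 W₁)

/-- `W 0, W 1, …, W P` are the weights met when the tasks `(A 0, B 0), …, (A (P-1), B (P-1))` are
learned in this order, each to convergence, from zero initialization; `W (Fin.last P)` is the
weight at the end. -/
structure IsTrainedSequence {P Ns Nx Ny : ℕ} (A : Fin P → Matrix (Fin Nx) (Fin Ns) ℝ)
    (B : Fin P → Matrix (Fin Ny) (Fin Ns) ℝ) (W : Fin (P + 1) → Matrix (Fin Ny) (Fin Nx) ℝ) :
    Prop where
  init : W 0 = 0
  step : ∀ μ : Fin P, TrainsTo (A μ) (B μ) (W μ.castSucc) (W μ.succ)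

/-- The total error over all tasks of the network with weight `W`, per output unit. -/
def totalError {P Ns Nx Ny : ℕ} (A : Fin P → Matrix (Fin Nx) (Fin Ns) ℝ)
    (B : Fin P → Matrix (Fin Ny) (Fin Ns) ℝ) (W : Matrix (Fin Ny) (Fin Nx) ℝ) : ℝ :=
  (1 / (Ny : ℝ)) * ∑ μ, taskError (A μ) (B μ) W

/-- The vector of the `(i, j)` entries of the matrices `M 0, …, M (P-1)`. -/
def entryVec {P m n : ℕ} (M : Fin P → Matrix (Fin m) (Fin n) ℝ) (i : Fin m) (j : Fin n) :
    EuclideanSpace ℝ (Fin P) :=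
  WithLp.toLp 2 fun μ => M μ i j

/-- The random mixing matrices: the vectors `a_ij`, `b_ij` of the `(i, j)` entries across the tasks
are centred Gaussian with covariance `Cin / Ns`, respectively `Cout / Ns`, and all these vectors
are independent. -/
structure IsMixingModel {P Ns Nx Ny : ℕ} (Cin Cout : Matrix (Fin P) (Fin P) ℝ)
    {Ω : Type*} [MeasurableSpace Ω] (prob : Measure Ω)
    (A : Ω → Fin P → Matrix (Fin Nx) (Fin Ns) ℝ)
    (B : Ω → Fin P → Matrix (Fin Ny) (Fin Ns) ℝ) : Prop where
  law_in : ∀ i j,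
    HasLaw (fun ω => entryVec (A ω) i j) (multivariateGaussian 0 ((1 / (Ns : ℝ)) • Cin)) prob
  law_out : ∀ i j,
    HasLaw (fun ω => entryVec (B ω) i j) (multivariateGaussian 0 ((1 / (Ns : ℝ)) • Cout)) prob
  indep : iIndepFun
    (Sum.elim (fun (ij : Fin Nx × Fin Ns) ω => entryVec (A ω) ij.1 ij.2)
      (fun (ij : Fin Ny × Fin Ns) ω => entryVec (B ω) ij.1 ij.2)) prob

/-- The strictly upper-triangular part of a matrix. -/
def strictUpper {P : ℕ} (C : Matrix (Fin P) (Fin P) ℝ) : Matrix (Fin P) (Fin P) ℝ :=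
  Matrix.of fun μ ν => if μ < ν then C μ ν else 0

open scoped MatrixOrder Matrix.Norms.Frobenius in
/-- `‖Cout^{1/2} (I - (I + U)⁻¹ Cin)‖²` in Frobenius norm, `U` the strictly upper-triangular part
of `Cin` and `Cout^{1/2}` the positive semidefinite square root. -/
def limitError {P : ℕ} (Cin Cout : Matrix (Fin P) (Fin P) ℝ) : ℝ :=
  ‖CFC.sqrt Cout * (1 - (1 + strictUpper Cin)⁻¹ * Cin)‖ ^ 2

end ContinualLearning

end

namespace ContinualLearning

/-! ### Gradient flow on one task: existence, uniqueness and description of its limit. -/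

section Training

open scoped RealInnerProductSpace

variable {Ns Nx Ny : ℕ}

/-! Averaging over the latent factor turns the error into the squared Frobenius norm of B - WA, with
gradient 2(WA - B)Aᵀ. The flow thus never changes the action of W on the complement of the column
space of A, and its limit is a critical point. The two facts determine the limit
(`TrainsTo.unique`); diagonalizing AAᵀ shows that it exists (`exists_trainsTo`).

If A has independent columns and left inverse A⁺ = (AᵀA)⁻¹Aᵀ, learning a task is the map W ↦ W + (B
- WA)A⁺. Hence the final weight is a sum of terms B_ν R_ν with R depending on the input matrices
only, and averaging over the independent targets leaves a quadratic form in the residuals δ_νμ I -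
R_ν A_μ (`integral_mixError`).

When Ns/Nx is small, (Ns/Nx) A_κᵀA_l is close to C_κl I in operator norm, outside an event of
probability exponentially small in Nx: chi-square tails on a net (`measureReal_badSet_le`). Then
A_κ⁺A_l is close to C_κl I, the recursion for R_ν A_l becomes one between scalars, and its solution
is (I + U)⁻¹C, with U the strict upper triangle (`limitResponse_last`). This gives the limit on the
good event (`exists_meanError_close`).

Expectations also need control of the bad event, where A⁺ may be huge. Each step multiplies the old
response by an orthogonal projector, so the averaged error is at most a constant times 1 + Σ
‖A_ν⁺‖²‖A_μ‖² (`exists_abs_meanError_le`). The fourth moments of both factors are polynomial in Nx;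
for A⁺ this holds because the squared distance of a column to the span of the others is at least a
scaled chi-square variable with 16 degrees of freedom. Polynomial growth loses against the
exponentially small probability (`exists_abs_integral_meanError_sub_le`).

Order dependence shows up for inputs equal up to sign and identical targets: the final weight then
solves the last task only, and the error counts the tasks of opposite sign. -/

lemma integral_inner_sq_stdGaussian {E : Type*} [NormedAddCommGroup E] [InnerProductSpace ℝ E]
    [FiniteDimensional ℝ E] [MeasurableSpace E] [BorelSpace E] (v : E) :
    ∫ s, ⟪v, s⟫ ^ 2 ∂(stdGaussian E) = ‖v‖ ^ 2 := by
  have h := variance_dual_stdGaussian (innerSL ℝ v)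
  rw [variance_of_integral_eq_zero (by fun_prop) (integral_strongDual_stdGaussian _)] at h
  simpa using h

lemma integrable_inner_sq_stdGaussian {E : Type*} [NormedAddCommGroup E] [InnerProductSpace ℝ E]
    [FiniteDimensional ℝ E] [MeasurableSpace E] [BorelSpace E] (v : E) :
    Integrable (fun s => ⟪v, s⟫ ^ 2) (stdGaussian E) := by
  have h : MemLp (fun s => innerSL ℝ v s) 2 (stdGaussian E) :=
    (innerSL ℝ v).comp_memLp' (IsGaussian.memLp_two_id)
  simpa using h.integrable_sq

lemma taskError_eq_sum_sq (A : Matrix (Fin Nx) (Fin Ns) ℝ) (B : Matrix (Fin Ny) (Fin Ns) ℝ)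
    (W : Matrix (Fin Ny) (Fin Nx) ℝ) :
    taskError A B W = ∑ i, ∑ k, ((B - W * A) i k) ^ 2 := by
  have h : ∀ s : EuclideanSpace ℝ (Fin Ns),
      ‖WithLp.toLp 2 (B.mulVec (WithLp.ofLp s) - W.mulVec (A.mulVec (WithLp.ofLp s)))‖ ^ 2
        = ∑ i, ⟪WithLp.toLp 2 ((B - W * A) i), s⟫ ^ 2 := by
    intro s
    rw [EuclideanSpace.real_norm_sq_eq]
    refine Finset.sum_congr rfl fun i _ => ?_
    rw [Matrix.mulVec_mulVec, ← Matrix.sub_mulVec]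
    simp [PiLp.inner_apply, Matrix.mulVec, dotProduct, mul_comm]
  simp only [taskError, h]
  rw [integral_finsetSum _ fun i _ => integrable_inner_sq_stdGaussian _]
  refine Finset.sum_congr rfl fun i _ => ?_
  rw [integral_inner_sq_stdGaussian, EuclideanSpace.real_norm_sq_eq]

lemma taskErrorGrad_eq (A : Matrix (Fin Nx) (Fin Ns) ℝ) (B : Matrix (Fin Ny) (Fin Ns) ℝ)
    (W : Matrix (Fin Ny) (Fin Nx) ℝ) :
    taskErrorGrad A B W = (2 : ℝ) • ((W * A - B) * A.transpose) := by
  ext i j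
  have key : HasDerivAt (fun h : ℝ => taskError A B (W + h • Matrix.single i j 1))
      (∑ i', ∑ k, 2 * (B - W * A) i' k * (-(if i' = i then A j k else 0))) 0 := by
    have h1 : ∀ h : ℝ, taskError A B (W + h • Matrix.single i j 1)
        = ∑ i', ∑ k, ((B - W * A) i' k - h * (if i' = i then A j k else 0)) ^ 2 := by
      intro h
      rw [taskError_eq_sum_sq]
      refine Finset.sum_congr rfl fun i' _ => Finset.sum_congr rfl fun k _ => ?_
      have : (Matrix.single i j (1 : ℝ) * A) i' k = if i' = i then A j k else 0 := by
        split_ifs with hi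
        · subst hi; simp
        · rw [Matrix.single_mul_apply_of_ne]; exact hi
      simp only [Matrix.add_mul, Matrix.smul_mul, Matrix.sub_apply, Matrix.add_apply,
        Matrix.smul_apply, this, smul_eq_mul]
      ring
    simp only [h1]
    refine HasDerivAt.fun_sum fun i' _ => HasDerivAt.fun_sum fun k _ => ?_
    have := (((hasDerivAt_id (0 : ℝ)).mul_const (if i' = i then A j k else 0)).const_sub
      ((B - W * A) i' k)).fun_pow 2
    simpa using this
  simp only [taskErrorGrad, Matrix.of_apply, key.deriv]
  rw [Finset.sum_eq_single i (by intro b _ hb; simp [hb]) (by simp)]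
  simp only [if_true, Matrix.smul_apply, Matrix.mul_apply (M := W * A - B), Matrix.transpose_apply,
    smul_eq_mul, Finset.mul_sum]
  refine Finset.sum_congr rfl fun k _ => ?_
  simp only [Matrix.sub_apply]
  ring

/-- A function on `[0, ∞)` which converges and whose derivative converges has derivative tending
to zero. -/
lemma eq_zero_of_tendsto_of_tendsto_deriv {f f' : ℝ → ℝ} {a b : ℝ}
    (hf : ∀ t, 0 ≤ t → HasDerivWithinAt f (f' t) (Set.Ici 0) t)
    (ha : Tendsto f atTop (𝓝 a)) (hb : Tendsto f' atTop (𝓝 b)) : b = 0 := by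
  have h1 : Tendsto (fun t => f (t + 1) - f t) atTop (𝓝 (a - a)) :=
    (ha.comp (tendsto_atTop_add_const_right _ 1 tendsto_id)).sub ha
  have h2 : ∀ t : ℝ, ∃ c, 0 ≤ t → t < c ∧ f' c = f (t + 1) - f t := by
    intro t
    by_cases ht : 0 ≤ t
    · obtain ⟨c, hc, hc'⟩ := exists_hasDerivAt_eq_slope f f' (show t < t + 1 by linarith)
        (fun s hs => ((hf s (ht.trans hs.1)).continuousWithinAt).mono
          (fun u hu => ht.trans hu.1))
        (fun s hs => (hf s (ht.trans hs.1.le)).hasDerivAt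
          (Ici_mem_nhds (lt_of_le_of_lt ht hs.1)))
      exact ⟨c, fun _ => ⟨hc.1, by simpa using hc'⟩⟩
    · exact ⟨0, fun h => absurd h ht⟩
  choose c hc using h2
  have h3 : Tendsto c atTop atTop :=
    tendsto_atTop_mono' _ ((eventually_ge_atTop 0).mono fun t ht => (hc t ht).1.le) tendsto_id
  have h4 : Tendsto (fun t => f (t + 1) - f t) atTop (𝓝 b) :=
    (hb.comp h3).congr' ((eventually_ge_atTop 0).mono fun t ht => (hc t ht).2)
  simpa using tendsto_nhds_unique h4 h1

/-- The gradient is continuous, so along a convergent flow the derivative converges as well, and it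
can only converge to zero. -/
lemma TrainsTo.normal_equation {A : Matrix (Fin Nx) (Fin Ns) ℝ} {B : Matrix (Fin Ny) (Fin Ns) ℝ}
    {W₀ W₁ : Matrix (Fin Ny) (Fin Nx) ℝ} (h : TrainsTo A B W₀ W₁) :
    (W₁ * A - B) * A.transpose = 0 := by
  obtain ⟨w, -, hw, hlim⟩ := h
  ext i j
  have h1 : Tendsto (fun t => w t i j) atTop (𝓝 (W₁ i j)) :=
    ((continuous_id.matrix_elem i j).tendsto W₁).comp hlim
  have hc : Continuous fun W : Matrix (Fin Ny) (Fin Nx) ℝ => -(taskErrorGrad A B W i j) := by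
    simp only [taskErrorGrad_eq]
    have : Continuous fun W : Matrix (Fin Ny) (Fin Nx) ℝ =>
        (2 : ℝ) • ((W * A - B) * A.transpose) := by fun_prop
    exact (this.matrix_elem i j).neg
  have h2 := eq_zero_of_tendsto_of_tendsto_deriv (fun t ht => hw t ht i j) h1
    ((hc.tendsto W₁).comp hlim)
  simpa [taskErrorGrad_eq] using h2

/-- The velocity has the form Y Aᵀ, which U annihilates, so the product with U is conserved and the
conservation passes to the limit. -/
lemma TrainsTo.mul_eq_mul {A : Matrix (Fin Nx) (Fin Ns) ℝ} {B : Matrix (Fin Ny) (Fin Ns) ℝ}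
    {W₀ W₁ : Matrix (Fin Ny) (Fin Nx) ℝ} (h : TrainsTo A B W₀ W₁) {n : ℕ}
    {U : Matrix (Fin Nx) (Fin n) ℝ} (hU : A.transpose * U = 0) : W₁ * U = W₀ * U := by
  obtain ⟨w, h0, hw, hlim⟩ := h
  ext i k
  have hd : ∀ t, 0 ≤ t → HasDerivWithinAt (fun τ => (w τ * U) i k) 0 (Set.Ici 0) t := by
    intro t ht
    have h1 : HasDerivWithinAt (fun τ => ∑ j, w τ i j * U j k)
        (∑ j, -(taskErrorGrad A B (w t) i j) * U j k) (Set.Ici 0) t :=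
      HasDerivWithinAt.fun_sum fun j _ => (hw t ht i j).mul_const _
    have h2 : ∑ j, -(taskErrorGrad A B (w t) i j) * U j k = 0 := by
      have : (-(taskErrorGrad A B (w t)) * U) i k = 0 := by
        rw [taskErrorGrad_eq, Matrix.neg_mul, Matrix.smul_mul, Matrix.mul_assoc, hU]
        simp
      simpa [Matrix.mul_apply] using this
    rw [h2] at h1
    simpa [Matrix.mul_apply] using h1
  have hconst : ∀ t, 0 ≤ t → (w t * U) i k = (w 0 * U) i k := by
    intro t ht
    have := (convex_Ici (0 : ℝ)).norm_image_sub_le_of_norm_hasDerivWithin_le (C := 0)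
      (fun x hx => hd x hx) (by simp) (Set.self_mem_Ici) (show t ∈ Set.Ici (0 : ℝ) from ht)
    simpa [sub_eq_zero] using this
  have hl : Tendsto (fun t => (w t * U) i k) atTop (𝓝 ((W₁ * U) i k)) :=
    (((continuous_id.matrix_mul continuous_const).matrix_elem i k).tendsto W₁).comp hlim
  have hl' : Tendsto (fun t => (w t * U) i k) atTop (𝓝 ((W₀ * U) i k)) :=
    tendsto_const_nhds.congr' ((eventually_ge_atTop 0).mono fun t ht => by
      simp only [hconst t ht, h0])
  exact tendsto_nhds_unique hl hl'

/-- The difference D of two limits satisfies DAAᵀ = 0, hence DA = 0. So Dᵀ is itself a direction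
along which the flow is constant, which gives DDᵀ = 0. -/
lemma TrainsTo.unique {A : Matrix (Fin Nx) (Fin Ns) ℝ} {B : Matrix (Fin Ny) (Fin Ns) ℝ}
    {W₀ W₁ W₂ : Matrix (Fin Ny) (Fin Nx) ℝ} (h₁ : TrainsTo A B W₀ W₁) (h₂ : TrainsTo A B W₀ W₂) :
    W₁ = W₂ := by
  have h3 : (W₁ - W₂) * (A * A.transpose) = 0 := by
    have := h₁.normal_equation
    have h' := h₂.normal_equation
    rw [Matrix.sub_mul, sub_eq_zero] at this h'
    rw [Matrix.sub_mul, ← Matrix.mul_assoc, ← Matrix.mul_assoc, this, h', sub_self]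
  have h4 : (W₁ - W₂) * A = 0 := by
    have := Matrix.mul_self_mul_conjTranspose_eq_zero A (W₁ - W₂)
    simp only [Matrix.conjTranspose_eq_transpose_of_trivial] at this
    exact this.1 h3
  have h5 : A.transpose * (W₁ - W₂).transpose = 0 := by
    rw [← Matrix.transpose_mul, h4, Matrix.transpose_zero]
  have h6 : (W₁ - W₂) * (W₁ - W₂).transpose = 0 := by
    rw [Matrix.sub_mul, h₁.mul_eq_mul h5, h₂.mul_eq_mul h5, sub_self]
  have := Matrix.self_mul_conjTranspose_eq_zero (A := W₁ - W₂)
  simp only [Matrix.conjTranspose_eq_transpose_of_trivial] at this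
  exact sub_eq_zero.1 (this.1 h6)

/-- The scalar relaxation equation has a solution that converges. -/
lemma exists_scalar_flow (d c v : ℝ) (hd : 0 ≤ d) (hc : d = 0 → c = 0) :
    ∃ (f : ℝ → ℝ) (l : ℝ), f 0 = v ∧ (∀ t, HasDerivAt f (c - d * f t) t) ∧
      Tendsto f atTop (𝓝 l) := by
  rcases hd.eq_or_lt with h | h
  · refine ⟨fun _ => v, v, rfl, fun t => ?_, tendsto_const_nhds⟩
    simpa [← h, hc h.symm] using hasDerivAt_const t v
  · refine ⟨fun t => c / d + (v - c / d) * Real.exp (-(d * t)), c / d, by simp, fun t => ?_, ?_⟩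
    · have h1 : HasDerivAt (fun t => Real.exp (-(d * t))) (Real.exp (-(d * t)) * -(d * 1)) t :=
        (((hasDerivAt_id t).const_mul d).neg).exp
      have h2 := (h1.const_mul (v - c / d)).const_add (c / d)
      have h3 : d * (c / d) = c := by field_simp
      refine h2.congr_deriv ?_
      linear_combination h3
    · have h1 : Tendsto (fun t => Real.exp (-(d * t))) atTop (𝓝 0) :=
        Real.tendsto_exp_neg_atTop_nhds_zero.comp (tendsto_id.const_mul_atTop h)
      simpa using (h1.const_mul (v - c / d)).const_add (c / d)

/-- In an eigenbasis U of AAᵀ the entries of WU obey independent scalar linear equations with rates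
2 d_j. -/
lemma exists_trainsTo (A : Matrix (Fin Nx) (Fin Ns) ℝ) (B : Matrix (Fin Ny) (Fin Ns) ℝ)
    (W₀ : Matrix (Fin Ny) (Fin Nx) ℝ) : ∃ W₁, TrainsTo A B W₀ W₁ := by
  have hS : (A * A.transpose).IsHermitian := by
    simpa using Matrix.isHermitian_mul_conjTranspose_self A
  obtain ⟨U, d, hUU, hUU', hd⟩ : ∃ (U : Matrix (Fin Nx) (Fin Nx) ℝ) (d : Fin Nx → ℝ),
      U.transpose * U = 1 ∧ U * U.transpose = 1 ∧
        A * A.transpose * U = U * Matrix.diagonal d := by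
    refine ⟨hS.eigenvectorUnitary, hS.eigenvalues, ?_, ?_, ?_⟩
    · simpa [Matrix.star_eq_conjTranspose] using Unitary.coe_star_mul_self hS.eigenvectorUnitary
    · simpa [Matrix.star_eq_conjTranspose] using Unitary.coe_mul_star_self hS.eigenvectorUnitary
    · have := hS.spectral_theorem
      have h2 := congrArg (· * (hS.eigenvectorUnitary : Matrix (Fin Nx) (Fin Nx) ℝ)) this
      simpa [Unitary.conjStarAlgAut_apply, Matrix.mul_assoc, Function.comp_def] using h2
  set V : Matrix (Fin Ns) (Fin Nx) ℝ := A.transpose * U with hV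
  have hVd : V.transpose * V = Matrix.diagonal d := by
    rw [hV, Matrix.transpose_mul, Matrix.transpose_transpose, Matrix.mul_assoc,
      ← Matrix.mul_assoc A, hd, ← Matrix.mul_assoc, hUU, Matrix.one_mul]
  have hdj : ∀ j, d j = ∑ k, V k j ^ 2 := by
    intro j
    have := congrFun (congrFun hVd j) j
    simp only [Matrix.diagonal_apply_eq, Matrix.mul_apply, Matrix.transpose_apply] at this
    rw [← this]
    exact Finset.sum_congr rfl fun k _ => (sq _).symm
  have hd0 : ∀ j, 0 ≤ d j := fun j => by rw [hdj]; positivity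
  -- Where the rate vanishes so does the forcing: d_j is the squared norm of column j of AᵀU.
  -- Without this the flow would drift to infinity when AAᵀ is singular.
  have hc : ∀ i j, 2 * d j = 0 → 2 * (B * V) i j = 0 := by
    intro i j h
    have h' : ∑ k, V k j ^ 2 = 0 := by rw [← hdj]; linarith
    rw [Finset.sum_eq_zero_iff_of_nonneg (fun k _ => sq_nonneg _)] at h'
    rw [Matrix.mul_apply, Finset.sum_eq_zero, mul_zero]
    intro k hk
    rw [pow_eq_zero_iff two_ne_zero |>.1 (h' k hk), mul_zero]
  choose f l hf0 hf hfl using fun i j => exists_scalar_flow (2 * d j) (2 * (B * V) i j)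
    ((W₀ * U) i j) (by linarith [hd0 j]) (hc i j)
  refine ⟨Matrix.of l * U.transpose, fun t => Matrix.of (fun i j => f i j t) * U.transpose,
    ?_, ?_, ?_⟩
  · have : (Matrix.of fun i j => f i j 0) = W₀ * U := by ext i j; simp [hf0]
    simp only [this, Matrix.mul_assoc, hUU', Matrix.mul_one]
  · intro t _ i j
    set F : Matrix (Fin Ny) (Fin Nx) ℝ := Matrix.of fun i j => f i j t with hF
    have h1 : HasDerivAt (fun τ => ∑ k, f i k τ * U.transpose k j)
        (∑ k, (2 * (B * V) i k - 2 * d k * f i k t) * U.transpose k j) t :=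
      HasDerivAt.fun_sum fun k _ => (hf i k t).mul_const _
    have h2 : -(taskErrorGrad A B (F * U.transpose) i j)
        = ∑ k, (2 * (B * V) i k - 2 * d k * f i k t) * U.transpose k j := by
      have h3 : -(taskErrorGrad A B (F * U.transpose))
          = ((2 : ℝ) • (B * V) - (2 : ℝ) • (F * Matrix.diagonal d)) * U.transpose := by
        have e1 : B * V * U.transpose = B * A.transpose := by
          rw [hV, Matrix.mul_assoc, Matrix.mul_assoc A.transpose, hUU', Matrix.mul_one]
        have e2 : F * Matrix.diagonal d * U.transpose = F * U.transpose * A * A.transpose := by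
          have : Matrix.diagonal d = U.transpose * (A * A.transpose * U) := by
            rw [hd, ← Matrix.mul_assoc, hUU, Matrix.one_mul]
          rw [this]
          simp only [Matrix.mul_assoc, hUU', Matrix.mul_one]
        rw [taskErrorGrad_eq, Matrix.sub_mul, Matrix.sub_mul, Matrix.smul_mul, Matrix.smul_mul,
          e1, e2, smul_sub, neg_sub]
      rw [← Matrix.neg_apply, h3, Matrix.mul_apply]
      refine Finset.sum_congr rfl fun k _ => ?_
      simp only [Matrix.sub_apply, Matrix.smul_apply, smul_eq_mul, Matrix.mul_diagonal, hF,
        Matrix.of_apply]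
      ring
    rw [h2]
    simpa [Matrix.mul_apply] using h1.hasDerivWithinAt
  · have : Tendsto (fun t => (Matrix.of fun i j => f i j t : Matrix (Fin Ny) (Fin Nx) ℝ)) atTop
        (𝓝 (Matrix.of l)) :=
      tendsto_pi_nhds.2 fun i => tendsto_pi_nhds.2 fun j => hfl i j
    exact ((continuous_id.matrix_mul continuous_const).tendsto (Matrix.of l)).comp this

lemma existsUnique_isTrainedSequence {P : ℕ} (A : Fin P → Matrix (Fin Nx) (Fin Ns) ℝ)
    (B : Fin P → Matrix (Fin Ny) (Fin Ns) ℝ) : ∃! W, IsTrainedSequence A B W := by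
  choose next hnext using fun (μ : Fin P) W₀ => exists_trainsTo (A μ) (B μ) W₀
  refine ⟨fun k => Fin.induction (motive := fun _ => Matrix (Fin Ny) (Fin Nx) ℝ) 0 next k,
    ⟨rfl, fun μ => ?_⟩, ?_⟩
  · simpa using hnext μ _
  · intro W hW
    funext k
    induction k using Fin.induction with
    | zero => simpa using hW.init
    | succ μ ih =>
      have h1 := hW.step μ
      rw [ih] at h1
      exact h1.unique (by simpa using hnext μ _)

end Training

/-! ### Linear dependence of the weights on the targets, and its scalar limit. -/

section Response

variable {P Ns Nx Ny : ℕ}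

/-- The left inverse `(Aᵀ A)⁻¹ Aᵀ` of a matrix with linearly independent columns. -/
noncomputable def leftInv (A : Matrix (Fin Nx) (Fin Ns) ℝ) : Matrix (Fin Ns) (Fin Nx) ℝ :=
  (A.transpose * A)⁻¹ * A.transpose

lemma leftInv_mul {A : Matrix (Fin Nx) (Fin Ns) ℝ} (hA : IsUnit (A.transpose * A).det) :
    leftInv A * A = 1 := by
  rw [leftInv, Matrix.mul_assoc, Matrix.nonsing_inv_mul _ hA]

/-- Independent columns turn the normal equation into W₁A = B, while on the range of the
complementary projector 1 - AA⁺ the weight is unchanged; adding the two parts gives W₁. -/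
lemma TrainsTo.eq_add_mul_leftInv {A : Matrix (Fin Nx) (Fin Ns) ℝ}
    {B : Matrix (Fin Ny) (Fin Ns) ℝ} {W₀ W₁ : Matrix (Fin Ny) (Fin Nx) ℝ}
    (h : TrainsTo A B W₀ W₁) (hA : IsUnit (A.transpose * A).det) :
    W₁ = W₀ + (B - W₀ * A) * leftInv A := by
  have h1 : W₁ * A = B := by
    have h2 := congrArg (· * (A * (A.transpose * A)⁻¹)) h.normal_equation
    simp only [Matrix.zero_mul] at h2
    rw [Matrix.mul_assoc, ← Matrix.mul_assoc A.transpose, Matrix.mul_nonsing_inv _ hA,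
      Matrix.mul_one] at h2
    exact sub_eq_zero.1 h2
  have h2 : A.transpose * (1 - A * leftInv A) = 0 := by
    rw [Matrix.mul_sub, leftInv, ← Matrix.mul_assoc, ← Matrix.mul_assoc,
      Matrix.mul_nonsing_inv _ hA, Matrix.one_mul, Matrix.mul_one, sub_self]
  have h3 := h.mul_eq_mul h2
  rw [Matrix.mul_sub, Matrix.mul_sub, Matrix.mul_one, Matrix.mul_one, ← Matrix.mul_assoc,
    ← Matrix.mul_assoc, h1] at h3
  rw [Matrix.sub_mul, ← sub_eq_iff_eq_add'.2 (sub_eq_iff_eq_add.1 h3)]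
  abel

/-- The dependence of the weight on the target matrices: after the tasks before `k` have been
learned, the weight is `∑ ν, B ν * response A k ν`. -/
noncomputable def response (A : Fin P → Matrix (Fin Nx) (Fin Ns) ℝ) :
    Fin (P + 1) → Fin P → Matrix (Fin Ns) (Fin Nx) ℝ :=
  Fin.induction (motive := fun _ => Fin P → Matrix (Fin Ns) (Fin Nx) ℝ) (fun _ => 0)
    fun μ R ν => R ν + ((if ν = μ then 1 else 0) - R ν * A μ) * leftInv (A μ)

@[simp] lemma response_zero (A : Fin P → Matrix (Fin Nx) (Fin Ns) ℝ) (ν : Fin P) :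
    response A 0 ν = 0 := rfl

lemma response_succ (A : Fin P → Matrix (Fin Nx) (Fin Ns) ℝ) (μ ν : Fin P) :
    response A μ.succ ν = response A μ.castSucc ν
      + ((if ν = μ then 1 else 0) - response A μ.castSucc ν * A μ) * leftInv (A μ) := by
  simp [response]

lemma IsTrainedSequence.eq_sum_response {A : Fin P → Matrix (Fin Nx) (Fin Ns) ℝ}
    {B : Fin P → Matrix (Fin Ny) (Fin Ns) ℝ} {W : Fin (P + 1) → Matrix (Fin Ny) (Fin Nx) ℝ}
    (hW : IsTrainedSequence A B W) (hA : ∀ μ, IsUnit ((A μ).transpose * A μ).det)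
    (k : Fin (P + 1)) : W k = ∑ ν, B ν * response A k ν := by
  induction k using Fin.induction with
  | zero => simp [hW.init]
  | succ μ ih =>
    rw [(hW.step μ).eq_add_mul_leftInv (hA μ), ih]
    simp only [response_succ, Matrix.mul_add, Finset.sum_add_distrib]
    simp only [← Matrix.mul_assoc, ← Matrix.sum_mul, Matrix.mul_sub, Finset.sum_sub_distrib]
    have h1 : ∀ ν, B ν * (if ν = μ then 1 else 0 : Matrix (Fin Ns) (Fin Ns) ℝ)
        = if ν = μ then B ν else 0 := fun ν => by split_ifs <;> simp
    simp [h1]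

/-- The scalar recursion that the products `response A k ν * A l` follow in the limit. -/
noncomputable def limitResponse (C : Matrix (Fin P) (Fin P) ℝ) :
    Fin (P + 1) → Fin P → Fin P → ℝ :=
  Fin.induction (motive := fun _ => Fin P → Fin P → ℝ) (fun _ _ => 0)
    fun μ t ν l => t ν l + ((if ν = μ then 1 else 0) - t ν μ) * C μ l

@[simp] lemma limitResponse_zero (C : Matrix (Fin P) (Fin P) ℝ) (ν l : Fin P) :
    limitResponse C 0 ν l = 0 := rfl

lemma limitResponse_succ (C : Matrix (Fin P) (Fin P) ℝ) (μ ν l : Fin P) :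
    limitResponse C μ.succ ν l = limitResponse C μ.castSucc ν l
      + ((if ν = μ then 1 else 0) - limitResponse C μ.castSucc ν μ) * C μ l := by
  simp [limitResponse]

/-- Unrolled form of the recursion, in which the strict inequality between task indices is what
later produces the strictly upper-triangular matrix. -/
lemma limitResponse_eq_sum (C : Matrix (Fin P) (Fin P) ℝ) (k : Fin (P + 1)) (ν l : Fin P) :
    limitResponse C k ν l = ∑ μ : Fin P, if μ.castSucc < k then
      ((if ν = μ then 1 else 0) - limitResponse C μ.castSucc ν μ) * C μ l else 0 := by
  induction k using Fin.induction with
  | zero => simp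
  | succ κ ih =>
    rw [limitResponse_succ, ih, ← Finset.sum_erase_add _ _ (Finset.mem_univ κ),
      ← Finset.sum_erase_add Finset.univ (fun μ : Fin P => ite (μ.castSucc < κ.succ) _ _)
        (Finset.mem_univ κ)]
    simp only [lt_self_iff_false, if_false, add_zero, Fin.castSucc_lt_succ_iff, le_refl, if_true]
    congr 1
    refine Finset.sum_congr rfl fun μ hμ => ?_
    have : μ.castSucc < κ.castSucc ↔ μ ≤ κ := by
      rw [Fin.castSucc_lt_castSucc_iff]
      exact ⟨le_of_lt, fun h => lt_of_le_of_ne h (Finset.ne_of_mem_erase hμ)⟩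
    simp only [this]

/-- Let d_νμ be the part of target ν still missing when task μ begins to be learned. The unrolled
recursion, read at time l in column l, says 1 - d = dU, so d is the inverse of 1 + U; read at the
end it gives dC. -/
lemma limitResponse_last (C : Matrix (Fin P) (Fin P) ℝ) :
    Matrix.of (limitResponse C (Fin.last P)) = (1 + strictUpper C)⁻¹ * C := by
  set d : Matrix (Fin P) (Fin P) ℝ := Matrix.of fun ν μ =>
    (if ν = μ then 1 else 0) - limitResponse C μ.castSucc ν μ with hd
  have h1 : Matrix.of (limitResponse C (Fin.last P)) = d * C := by
    ext ν l
    simp only [Matrix.of_apply, Matrix.mul_apply, hd]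
    rw [limitResponse_eq_sum]
    simp [Fin.castSucc_lt_last]
  have h2 : d * (1 + strictUpper C) = 1 := by
    rw [Matrix.mul_add, Matrix.mul_one]
    ext ν l
    have : (d * strictUpper C) ν l = limitResponse C l.castSucc ν l := by
      rw [limitResponse_eq_sum, Matrix.mul_apply]
      refine Finset.sum_congr rfl fun μ _ => ?_
      simp [strictUpper, hd]
    rw [Matrix.add_apply, this, hd, Matrix.of_apply, Matrix.one_apply]
    ring
  rw [h1, Matrix.inv_eq_left_inv h2]

open scoped MatrixOrder Matrix.Norms.Frobenius in
-- The squared Frobenius norm of Cout^{1/2} m is the trace of mᵀ Cout m, so the square root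
-- disappears.
lemma limitError_eq_sum (Cin Cout : Matrix (Fin P) (Fin P) ℝ) (hCout : Cout.PosSemidef) :
    limitError Cin Cout = ∑ μ, ∑ ν, ∑ ν', Cout ν ν' *
      (((if ν = μ then 1 else 0) - limitResponse Cin (Fin.last P) ν μ) *
        ((if ν' = μ then 1 else 0) - limitResponse Cin (Fin.last P) ν' μ)) := by
  have hfrob : ∀ X : Matrix (Fin P) (Fin P) ℝ, ‖X‖ ^ 2 = (X.transpose * X).trace := by
    intro X
    rw [Matrix.frobenius_norm_def, ← Real.sqrt_eq_rpow, Real.sq_sqrt (by positivity),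
      Matrix.trace, Finset.sum_comm]
    simp [Matrix.mul_apply, sq]
  set m : Matrix (Fin P) (Fin P) ℝ := 1 - (1 + strictUpper Cin)⁻¹ * Cin with hm
  have hs : (CFC.sqrt Cout).transpose = CFC.sqrt Cout := by
    have := (CFC.sqrt_nonneg Cout).isSelfAdjoint
    rwa [isSelfAdjoint_iff, Matrix.star_eq_conjTranspose,
      Matrix.conjTranspose_eq_transpose_of_trivial] at this
  have h1 : limitError Cin Cout = (m.transpose * (Cout * m)).trace := by
    rw [limitError, hfrob, Matrix.transpose_mul, hs, Matrix.mul_assoc,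
      ← Matrix.mul_assoc (CFC.sqrt Cout), CFC.sqrt_mul_sqrt_self _ hCout.nonneg]
  have hmν : ∀ ν μ, m ν μ = (if ν = μ then 1 else 0) - limitResponse Cin (Fin.last P) ν μ := by
    intro ν μ
    rw [hm, ← limitResponse_last, Matrix.sub_apply, Matrix.one_apply, Matrix.of_apply]
  rw [h1, Matrix.trace]
  refine Finset.sum_congr rfl fun μ _ => ?_
  simp only [Matrix.diag_apply, Matrix.mul_apply, Matrix.transpose_apply, Finset.mul_sum, ← hmν]
  refine Finset.sum_congr rfl fun ν _ => Finset.sum_congr rfl fun ν' _ => ?_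
  ring

/-- The error on task `μ` depends on the targets through `∑ ν, B ν * residual A ν μ`. -/
noncomputable def residual (A : Fin P → Matrix (Fin Nx) (Fin Ns) ℝ) (ν μ : Fin P) :
    Matrix (Fin Ns) (Fin Ns) ℝ :=
  (if ν = μ then 1 else 0) - response A (Fin.last P) ν * A μ

/-- The final error averaged over the target matrices, for given input matrices. -/
noncomputable def meanError (Cout : Matrix (Fin P) (Fin P) ℝ)
    (A : Fin P → Matrix (Fin Nx) (Fin Ns) ℝ) : ℝ :=
  ∑ μ, ∑ ν, ∑ ν', Cout ν ν' *
    ((1 / (Ns : ℝ)) * ∑ j, ∑ k, residual A ν μ j k * residual A ν' μ j k)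

/-! ### Stability of the response under operator-norm perturbations of the Gram products. -/

section OperatorNorm

open scoped Matrix.Norms.L2Operator

lemma norm_one_matrix_le (n : ℕ) : ‖(1 : Matrix (Fin n) (Fin n) ℝ)‖ ≤ 1 := by
  rcases subsingleton_or_nontrivial (Matrix (Fin n) (Fin n) ℝ) with h | h
  · rw [Subsingleton.elim (1 : Matrix (Fin n) (Fin n) ℝ) 0, norm_zero]
    exact zero_le_one
  · exact CStarRing.norm_one.le

lemma norm_smul_one_le {n : ℕ} (c : ℝ) : ‖c • (1 : Matrix (Fin n) (Fin n) ℝ)‖ ≤ |c| := by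
  rw [norm_smul, Real.norm_eq_abs]
  exact mul_le_of_le_one_right (abs_nonneg c) (norm_one_matrix_le n)

lemma abs_apply_le_norm {n : ℕ} (Z : Matrix (Fin n) (Fin n) ℝ) (i j : Fin n) :
    |Z i j| ≤ ‖Z‖ := by
  have h1 := Matrix.l2_opNorm_mulVec Z (EuclideanSpace.single j (1 : ℝ))
  have h2 := PiLp.norm_apply_le (WithLp.toLp 2 (Z.mulVec (EuclideanSpace.single j (1 : ℝ)).ofLp)) i
  simp only [PiLp.norm_single, norm_one, mul_one] at h1
  refine le_trans (le_of_eq ?_) (h2.trans h1)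
  simp

/-- The scale r cancels in A⁺A'. With G = rAᵀA within 1/2 of the identity, GX is explicitly of order
δ, and the term (G - 1)X is absorbed at the price of the factor 2. -/
lemma norm_leftInv_mul_sub_le {A A' : Matrix (Fin Nx) (Fin Ns) ℝ} {r c δ : ℝ}
    (hA : IsUnit (A.transpose * A).det) (hδ : δ ≤ 1 / 2)
    (h₁ : ‖r • (A.transpose * A) - 1‖ ≤ δ) (h₂ : ‖r • (A.transpose * A') - c • 1‖ ≤ δ) :
    ‖leftInv A * A' - c • 1‖ ≤ 2 * (1 + |c|) * δ := by
  set X := leftInv A * A' - c • 1 with hX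
  have e1 : (r • (A.transpose * A)) * X
      = (r • (A.transpose * A') - c • 1) - c • (r • (A.transpose * A) - 1) := by
    have e0 : (A.transpose * A) * (leftInv A * A') = A.transpose * A' := by
      rw [leftInv, ← Matrix.mul_assoc, ← Matrix.mul_assoc, Matrix.mul_nonsing_inv _ hA,
        Matrix.one_mul]
    rw [hX, Matrix.mul_sub, Matrix.smul_mul, e0, Matrix.mul_smul, Matrix.mul_one, smul_sub]
    abel
  have e2 : X = (r • (A.transpose * A)) * X - (r • (A.transpose * A) - 1) * X := by
    rw [Matrix.sub_mul, Matrix.one_mul]; abel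
  have h3 : ‖(r • (A.transpose * A)) * X‖ ≤ δ + |c| * δ := by
    rw [e1]
    refine (norm_sub_le _ _).trans (add_le_add h₂ ?_)
    rw [norm_smul, Real.norm_eq_abs]
    exact mul_le_mul_of_nonneg_left h₁ (abs_nonneg c)
  have h4 : ‖(r • (A.transpose * A) - 1) * X‖ ≤ 1 / 2 * ‖X‖ :=
    (norm_mul_le _ _).trans (mul_le_mul_of_nonneg_right (h₁.trans hδ) (norm_nonneg X))
  have h5 : ‖X‖ ≤ ‖(r • (A.transpose * A)) * X‖ + ‖(r • (A.transpose * A) - 1) * X‖ := by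
    conv_lhs => rw [e2]
    exact norm_sub_le _ _
  linarith

/-- If all products `leftInv (A κ) * A l` are close to scalar matrices, then so are the products
`response A k ν * A l`. -/
lemma exists_response_close (C : Matrix (Fin P) (Fin P) ℝ) (k : Fin (P + 1)) :
    ∃ K : ℝ, 0 ≤ K ∧ ∀ (Ns Nx : ℕ) (A : Fin P → Matrix (Fin Nx) (Fin Ns) ℝ) (δ : ℝ),
      0 ≤ δ → δ ≤ 1 → (∀ κ l, ‖leftInv (A κ) * A l - C κ l • 1‖ ≤ δ) →
      ∀ ν l, ‖response A k ν * A l - limitResponse C k ν l • 1‖ ≤ K * δ := by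
  induction k using Fin.induction with
  | zero =>
    exact ⟨0, le_rfl, fun Ns Nx A δ _ _ _ ν l => by simp⟩
  | succ μ ih =>
    obtain ⟨K, hK0, hK⟩ := ih
    set s : ℝ := ∑ ν, |(if ν = μ then 1 else 0) - limitResponse C μ.castSucc ν μ| with hs
    set c : ℝ := ∑ l, |C μ l| with hc
    have hs0 : 0 ≤ s := Finset.sum_nonneg fun _ _ => abs_nonneg _
    have hc0 : 0 ≤ c := Finset.sum_nonneg fun _ _ => abs_nonneg _
    refine ⟨K + K * (c + 1) + s, by positivity, fun Ns Nx A δ hδ0 hδ1 hA ν l => ?_⟩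
    set T := fun l => response A μ.castSucc ν * A l with hT
    set t := fun l => limitResponse C μ.castSucc ν l with ht
    set G := leftInv (A μ) * A l with hG
    set e : ℝ := if ν = μ then 1 else 0 with he
    have he' : (if ν = μ then 1 else 0 : Matrix (Fin Ns) (Fin Ns) ℝ) = e • 1 := by
      rw [he]; split_ifs <;> simp
    -- The new error is the old one, plus the old error at column μ carried through G, plus a
    -- bounded scalar times the error of G; their bounds add up to the constant K + K(c + 1) + s.
    have key : response A μ.succ ν * A l - limitResponse C μ.succ ν l • 1
        = (T l - t l • 1) - (T μ - t μ • 1) * G + (e - t μ) • (G - C μ l • 1) := by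
      rw [response_succ, limitResponse_succ, he', Matrix.add_mul, Matrix.mul_assoc _ _ (A l), ← hG]
      simp only [hT, ht, smul_sub, sub_smul, Matrix.smul_mul, Matrix.one_mul,
        add_smul, smul_smul, sub_mul]
      abel
    have hcl : |C μ l| ≤ c := Finset.single_le_sum (f := fun l => |C μ l|)
      (fun _ _ => abs_nonneg _) (Finset.mem_univ l)
    have hsν : |e - t μ| ≤ s := Finset.single_le_sum
      (f := fun ν => |(if ν = μ then 1 else 0) - limitResponse C μ.castSucc ν μ|)
      (fun _ _ => abs_nonneg _) (Finset.mem_univ ν)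
    have hGn : ‖G‖ ≤ c + 1 := by
      have h1 : G = C μ l • 1 + (G - C μ l • 1) := by abel
      rw [h1]
      exact (norm_add_le _ _).trans (add_le_add ((norm_smul_one_le _).trans hcl)
        ((hA μ l).trans hδ1))
    have h1 : ‖T l - t l • 1‖ ≤ K * δ := hK Ns Nx A δ hδ0 hδ1 hA ν l
    have h2 : ‖(T μ - t μ • 1) * G‖ ≤ K * δ * (c + 1) :=
      (norm_mul_le _ _).trans (mul_le_mul (hK Ns Nx A δ hδ0 hδ1 hA ν μ) hGn (norm_nonneg _)
        (by positivity))
    have h3 : ‖(e - t μ) • (G - C μ l • 1)‖ ≤ s * δ := by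
      rw [norm_smul, Real.norm_eq_abs]
      exact mul_le_mul hsν (hA μ l) (norm_nonneg _) hs0
    rw [key]
    refine (norm_add_le _ _).trans ?_
    refine (add_le_add ((norm_sub_le _ _).trans (add_le_add h1 h2)) h3).trans (le_of_eq ?_)
    ring

/-- The sum is the normalized trace of XYᵀ, and a normalized trace is bounded by the operator norm,
so no dimension enters the estimate. -/
lemma abs_inner_sub_le {n : ℕ} (hn : 0 < n) (X Y : Matrix (Fin n) (Fin n) ℝ) (x y ε : ℝ)
    (hX : ‖X - x • 1‖ ≤ ε) (hY : ‖Y - y • 1‖ ≤ ε) :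
    |(1 / (n : ℝ)) * ∑ j, ∑ k, X j k * Y j k - x * y| ≤ ε * (ε + |x| + |y|) := by
  set Z := X * Y.transpose - (x * y) • (1 : Matrix (Fin n) (Fin n) ℝ) with hZ
  have hYt : ‖Y.transpose - y • 1‖ ≤ ε := by
    have : Y.transpose - y • 1 = (Y - y • 1).conjTranspose := by
      simp [Matrix.conjTranspose_eq_transpose_of_trivial]
    rw [this, Matrix.l2_opNorm_conjTranspose]
    exact hY
  have hε : 0 ≤ ε := (norm_nonneg _).trans hX
  have h1 : ‖Z‖ ≤ ε * (ε + |x| + |y|) := by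
    have : Z = (X - x • 1) * (Y.transpose - y • 1) + x • (Y.transpose - y • 1)
        + y • (X - x • 1) := by
      rw [hZ]
      simp only [Matrix.sub_mul, Matrix.mul_sub, Matrix.smul_mul, Matrix.mul_smul, Matrix.one_mul,
        Matrix.mul_one, smul_sub, smul_smul, mul_comm y x]
      abel
    rw [this]
    have a1 : ‖(X - x • 1) * (Y.transpose - y • 1)‖ ≤ ε * ε :=
      (norm_mul_le _ _).trans (mul_le_mul hX hYt (norm_nonneg _) hε)
    have a2 : ‖x • (Y.transpose - y • 1)‖ ≤ |x| * ε := by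
      rw [norm_smul, Real.norm_eq_abs]; gcongr
    have a3 : ‖y • (X - x • 1)‖ ≤ |y| * ε := by
      rw [norm_smul, Real.norm_eq_abs]; gcongr
    refine (norm_add₃_le).trans ?_
    linarith
  have hn' : (n : ℝ) ≠ 0 := by positivity
  have h2 : (1 / (n : ℝ)) * ∑ j, ∑ k, X j k * Y j k - x * y = (1 / (n : ℝ)) * ∑ j, Z j j := by
    have : ∑ j, Z j j = ∑ j, ∑ k, X j k * Y j k - n * (x * y) := by
      simp [hZ, Matrix.mul_apply]
    rw [this]
    field_simp
  rw [h2, abs_mul, abs_of_nonneg (by positivity)]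
  have h3 : |∑ j, Z j j| ≤ n * ‖Z‖ := by
    refine (Finset.abs_sum_le_sum_abs _ _).trans ?_
    refine (Finset.sum_le_sum fun j _ => abs_apply_le_norm Z j j).trans ?_
    simp
  calc 1 / (n : ℝ) * |∑ j, Z j j| ≤ 1 / (n : ℝ) * (n * ‖Z‖) := by gcongr
    _ = ‖Z‖ := by field_simp
    _ ≤ _ := h1

/-- If the rescaled products `(A κ)ᵀ * A l` are close to scalar matrices in operator norm, then
`meanError` is close to `limitError`. -/
lemma exists_meanError_close (Cin Cout : Matrix (Fin P) (Fin P) ℝ)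
    (hCin : ∀ μ, Cin μ μ = 1) (hCout : Cout.PosSemidef) {ε : ℝ} (hε : 0 < ε) :
    ∃ δ : ℝ, 0 < δ ∧ ∀ (Ns Nx : ℕ) (r : ℝ) (A : Fin P → Matrix (Fin Nx) (Fin Ns) ℝ),
      0 < Ns → (∀ μ, IsUnit ((A μ).transpose * A μ).det) →
      (∀ κ l, ‖r • ((A κ).transpose * A l) - Cin κ l • 1‖ ≤ δ) →
      |meanError Cout A - limitError Cin Cout| ≤ ε := by
  obtain ⟨K, hK0, hK⟩ := exists_response_close Cin (Fin.last P)
  set m : Fin P → Fin P → ℝ := fun ν μ =>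
    (if ν = μ then 1 else 0) - limitResponse Cin (Fin.last P) ν μ with hm
  set c : ℝ := 2 * (1 + ∑ κ, ∑ l, |Cin κ l|) with hc
  have hc1 : 0 < c := by
    have : 0 ≤ ∑ κ, ∑ l, |Cin κ l| := by positivity
    linarith
  -- The total error bound as a function of δ: it is continuous and vanishes at 0, so a small δ
  -- makes it less than ε.
  set H : ℝ → ℝ := fun δ => ∑ μ, ∑ ν, ∑ ν', |Cout ν ν'| *
    ((K * (c * δ)) * (K * (c * δ) + |m ν μ| + |m ν' μ|)) with hH
  have hHlim : Tendsto H (𝓝[>] 0) (𝓝 0) := by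
    have : Continuous H := by fun_prop
    have h0 := this.tendsto 0
    have h00 : H 0 = 0 := by simp [hH]
    rw [h00] at h0
    exact h0.mono_left nhdsWithin_le_nhds
  have hev : ∀ᶠ δ in 𝓝[>] (0 : ℝ), H δ < ε := hHlim.eventually_lt_const hε
  -- The bound 1/2 permits the absorption argument; 1/c keeps the error of A⁺A' below 1, as the
  -- response estimate requires.
  have hev2 : ∀ᶠ δ in 𝓝[>] (0 : ℝ), δ < min (1 / 2) (1 / c) :=
    eventually_nhdsWithin_of_eventually_nhds (eventually_lt_nhds (by positivity))
  obtain ⟨δ, ⟨hδH, hδm⟩, hδ0⟩ := ((hev.and hev2).and self_mem_nhdsWithin).exists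
  have hδ0 : 0 < δ := hδ0
  have hδ2 : δ ≤ 1 / 2 := (hδm.trans_le (min_le_left _ _)).le
  have hδc : c * δ ≤ 1 := by
    have := (hδm.trans_le (min_le_right _ _)).le
    rwa [le_div_iff₀ hc1, mul_comm] at this
  refine ⟨δ, hδ0, fun Ns Nx r A hNs hA hclose => ?_⟩
  have h1 : ∀ κ l, ‖leftInv (A κ) * A l - Cin κ l • 1‖ ≤ c * δ := by
    intro κ l
    refine (norm_leftInv_mul_sub_le (hA κ) hδ2 ?_ (hclose κ l)).trans ?_
    · simpa [hCin] using hclose κ κ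
    · rw [hc]
      have : |Cin κ l| ≤ ∑ κ, ∑ l, |Cin κ l| :=
        (Finset.single_le_sum (f := fun l => |Cin κ l|) (fun _ _ => abs_nonneg _)
          (Finset.mem_univ l)).trans (Finset.single_le_sum (f := fun κ => ∑ l, |Cin κ l|)
          (fun _ _ => by positivity) (Finset.mem_univ κ))
      gcongr
  have h2 : ∀ ν μ, ‖residual A ν μ - m ν μ • 1‖ ≤ K * (c * δ) := by
    intro ν μ
    have h3 := hK Ns Nx A (c * δ) (by positivity) hδc h1 ν μ
    have h4 : residual A ν μ - m ν μ • 1 = -(response A (Fin.last P) ν * A μ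
        - limitResponse Cin (Fin.last P) ν μ • 1) := by
      have he : (if ν = μ then 1 else 0 : Matrix (Fin Ns) (Fin Ns) ℝ)
          = (if ν = μ then (1 : ℝ) else 0) • 1 := by split_ifs <;> simp
      rw [residual, he, hm, sub_smul]
      abel
    rwa [h4, norm_neg]
  refine le_trans ?_ hδH.le
  rw [limitError_eq_sum Cin Cout hCout, meanError, ← Finset.sum_sub_distrib]
  refine (Finset.abs_sum_le_sum_abs _ _).trans (Finset.sum_le_sum fun μ _ => ?_)
  rw [← Finset.sum_sub_distrib]
  refine (Finset.abs_sum_le_sum_abs _ _).trans (Finset.sum_le_sum fun ν _ => ?_)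
  rw [← Finset.sum_sub_distrib]
  refine (Finset.abs_sum_le_sum_abs _ _).trans (Finset.sum_le_sum fun ν' _ => ?_)
  rw [← mul_sub, abs_mul]
  exact mul_le_mul_of_nonneg_left
    (abs_inner_sub_le hNs _ _ _ _ _ (h2 ν μ) (h2 ν' μ)) (abs_nonneg _)

end OperatorNorm

end Response

/-! ### A crude bound on the averaged error that needs only independent columns. -/

section Frobenius

variable {P Ns Nx Ny : ℕ}

/-- The sum of the squares of the entries of a matrix. -/
noncomputable def sqSum {m n : ℕ} (X : Matrix (Fin m) (Fin n) ℝ) : ℝ := ∑ i, ∑ j, X i j ^ 2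

lemma sqSum_nonneg {m n : ℕ} (X : Matrix (Fin m) (Fin n) ℝ) : 0 ≤ sqSum X := by
  unfold sqSum; positivity

section

open scoped Matrix.Norms.Frobenius

lemma sqSum_eq_norm_sq {m n : ℕ} (X : Matrix (Fin m) (Fin n) ℝ) : sqSum X = ‖X‖ ^ 2 := by
  rw [Matrix.frobenius_norm_def, ← Real.sqrt_eq_rpow, Real.sq_sqrt (by positivity), sqSum]
  simp

lemma sqSum_mul_le {m n p : ℕ} (X : Matrix (Fin m) (Fin n) ℝ) (Y : Matrix (Fin n) (Fin p) ℝ) :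
    sqSum (X * Y) ≤ sqSum X * sqSum Y := by
  simp only [sqSum_eq_norm_sq, ← mul_pow]
  exact pow_le_pow_left₀ (norm_nonneg _) (Matrix.frobenius_norm_mul X Y) 2

lemma sqSum_add_le {m n : ℕ} (X Y : Matrix (Fin m) (Fin n) ℝ) :
    sqSum (X + Y) ≤ 2 * (sqSum X + sqSum Y) := by
  simp only [sqSum_eq_norm_sq]
  refine (pow_le_pow_left₀ (norm_nonneg _) (norm_add_le X Y) 2).trans add_sq_le

lemma sqSum_eq_trace {m n : ℕ} (X : Matrix (Fin m) (Fin n) ℝ) :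
    sqSum X = (X * X.transpose).trace := by
  simp [sqSum, Matrix.trace, Matrix.mul_apply, sq]

/-- AA⁺ is symmetric and idempotent, so this is Pythagoras for an orthogonal projector. -/
lemma sqSum_mul_one_sub_le (X : Matrix (Fin Ny) (Fin Nx) ℝ) {A : Matrix (Fin Nx) (Fin Ns) ℝ}
    (hA : IsUnit (A.transpose * A).det) : sqSum (X * (1 - A * leftInv A)) ≤ sqSum X := by
  set Q := A * leftInv A with hQ
  have hQt : Q.transpose = Q := by
    simp [hQ, leftInv, Matrix.transpose_mul, Matrix.mul_assoc, Matrix.transpose_nonsing_inv]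
  have hQQ : Q * Q = Q := by
    rw [hQ, Matrix.mul_assoc, ← Matrix.mul_assoc (leftInv A), leftInv_mul hA, Matrix.one_mul]
  have h1 : sqSum (X * (1 - Q)) + sqSum (X * Q) = sqSum X := by
    simp only [sqSum_eq_trace, ← Matrix.trace_add]
    congr 1
    simp only [Matrix.transpose_mul, Matrix.transpose_sub, hQt, Matrix.transpose_one]
    have e1 : X * (1 - Q) * ((1 - Q) * X.transpose) = X * ((1 - Q) * (1 - Q)) * X.transpose := by
      simp only [Matrix.mul_assoc]
    have e2 : X * Q * (Q * X.transpose) = X * (Q * Q) * X.transpose := by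
      simp only [Matrix.mul_assoc]
    have e3 : (1 - Q) * (1 - Q) = 1 - Q := by
      rw [Matrix.mul_sub, Matrix.sub_mul, Matrix.sub_mul, hQQ]
      simp
    rw [e1, e2, e3, hQQ, ← Matrix.add_mul, ← Matrix.mul_add, sub_add_cancel, Matrix.mul_one]
  linarith [sqSum_nonneg (X * Q)]

/-- A step replaces R by R(1 - AA⁺), which does not increase the norm, and adds at most one left
inverse. Thus products of several left inverses, whose moments would be out of control, never
appear. -/
lemma sqSum_response_le {A : Fin P → Matrix (Fin Nx) (Fin Ns) ℝ}
    (hA : ∀ μ, IsUnit ((A μ).transpose * A μ).det) (k : Fin (P + 1)) (ν : Fin P) :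
    sqSum (response A k ν) ≤ (P : ℝ) ^ 2 * sqSum (leftInv (A ν)) := by
  have h : ‖response A k ν‖ ≤ (k : ℕ) * ‖leftInv (A ν)‖ := by
    induction k using Fin.induction with
    | zero => simp
    | succ μ ih =>
      have e1 : response A μ.succ ν = response A μ.castSucc ν * (1 - A μ * leftInv (A μ))
          + (if ν = μ then leftInv (A ν) else 0) := by
        rw [response_succ, Matrix.sub_mul, Matrix.mul_sub, Matrix.mul_one, Matrix.mul_assoc]
        split_ifs with h
        · subst h; rw [Matrix.one_mul]; abel
        · rw [Matrix.zero_mul]; abel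
      have h1 : ‖response A μ.castSucc ν * (1 - A μ * leftInv (A μ))‖ ≤
          ‖response A μ.castSucc ν‖ := by
        have := sqSum_mul_one_sub_le (response A μ.castSucc ν) (hA μ)
        rw [sqSum_eq_norm_sq, sqSum_eq_norm_sq] at this
        exact le_of_sq_le_sq this (norm_nonneg _)
      have h2 : ‖(if ν = μ then leftInv (A ν) else 0)‖ ≤ ‖leftInv (A ν)‖ := by
        split_ifs
        · exact le_rfl
        · rw [norm_zero]; exact norm_nonneg _
      rw [e1]
      refine (norm_add_le _ _).trans ((add_le_add (h1.trans ih) h2).trans (le_of_eq ?_))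
      simp
      ring
  rw [sqSum_eq_norm_sq, sqSum_eq_norm_sq, ← mul_pow]
  refine pow_le_pow_left₀ (norm_nonneg _) (h.trans ?_) 2
  have : ((k : ℕ) : ℝ) ≤ P := by exact_mod_cast Nat.lt_succ_iff.1 k.2
  gcongr

end

lemma sqSum_residual_le {A : Fin P → Matrix (Fin Nx) (Fin Ns) ℝ}
    (hA : ∀ μ, IsUnit ((A μ).transpose * A μ).det) (ν μ : Fin P) :
    sqSum (residual A ν μ)
      ≤ 2 * (Ns + (P : ℝ) ^ 2 * (sqSum (leftInv (A ν)) * sqSum (A μ))) := by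
  rw [residual, sub_eq_add_neg]
  refine (sqSum_add_le _ _).trans ?_
  have h1 : sqSum (if ν = μ then 1 else 0 : Matrix (Fin Ns) (Fin Ns) ℝ) ≤ Ns := by
    split_ifs
    · simp [sqSum, Matrix.one_apply]
    · simp [sqSum]
  have h2 : sqSum (-(response A (Fin.last P) ν * A μ))
      ≤ (P : ℝ) ^ 2 * (sqSum (leftInv (A ν)) * sqSum (A μ)) := by
    have : sqSum (-(response A (Fin.last P) ν * A μ)) = sqSum (response A (Fin.last P) ν * A μ) := by
      simp [sqSum]
    rw [this, ← mul_assoc]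
    exact (sqSum_mul_le _ _).trans
      (mul_le_mul_of_nonneg_right (sqSum_response_le hA _ _) (sqSum_nonneg _))
  gcongr

/-- The estimate used on the bad event; what matters is that the constant depends on the number of
tasks and on Cout, not on the dimensions. -/
lemma exists_abs_meanError_le (Cout : Matrix (Fin P) (Fin P) ℝ) :
    ∃ K : ℝ, 0 ≤ K ∧ ∀ (Ns Nx : ℕ) (A : Fin P → Matrix (Fin Nx) (Fin Ns) ℝ), 0 < Ns →
      (∀ μ, IsUnit ((A μ).transpose * A μ).det) →
      |meanError Cout A| ≤ K * (1 + ∑ ν, ∑ μ, sqSum (leftInv (A ν)) * sqSum (A μ)) := by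
  refine ⟨∑ _μ : Fin P, ∑ ν, ∑ ν', |Cout ν ν'| * (2 * (1 + (P : ℝ) ^ 2)), by positivity,
    fun Ns Nx A hNs hA => ?_⟩
  set S := ∑ ν, ∑ μ, sqSum (leftInv (A ν)) * sqSum (A μ) with hS
  have hNs' : (1 : ℝ) ≤ Ns := by exact_mod_cast hNs
  have hpq : ∀ ν μ, sqSum (leftInv (A ν)) * sqSum (A μ) ≤ S := fun ν μ =>
    (Finset.single_le_sum (f := fun μ => sqSum (leftInv (A ν)) * sqSum (A μ))
      (fun _ _ => mul_nonneg (sqSum_nonneg _) (sqSum_nonneg _)) (Finset.mem_univ μ)).trans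
    (Finset.single_le_sum (f := fun ν => ∑ μ, sqSum (leftInv (A ν)) * sqSum (A μ))
      (fun _ _ => Finset.sum_nonneg fun _ _ => mul_nonneg (sqSum_nonneg _) (sqSum_nonneg _))
      (Finset.mem_univ ν))
  have hS0 : 0 ≤ S := Finset.sum_nonneg fun _ _ => Finset.sum_nonneg fun _ _ =>
    mul_nonneg (sqSum_nonneg _) (sqSum_nonneg _)
  have hres : ∀ ν μ, (1 / (Ns : ℝ)) * sqSum (residual A ν μ) ≤ 2 * (1 + (P : ℝ) ^ 2) * (1 + S) := by
    intro ν μ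
    have h1 := sqSum_residual_le hA ν μ
    have h2 := hpq ν μ
    rw [one_div, inv_mul_le_iff₀ (by positivity)]
    have h3 : (P : ℝ) ^ 2 * (sqSum (leftInv (A ν)) * sqSum (A μ)) ≤ (P : ℝ) ^ 2 * S := by gcongr
    have h4 : (P : ℝ) ^ 2 * S ≤ Ns * ((P : ℝ) ^ 2 * S) := le_mul_of_one_le_left (by positivity) hNs'
    have h5 : (0 : ℝ) ≤ Ns * S := by positivity
    have h6 : (0 : ℝ) ≤ Ns * (P : ℝ) ^ 2 := by positivity
    nlinarith
  have hin : ∀ μ ν ν', |(1 / (Ns : ℝ)) * ∑ j, ∑ k, residual A ν μ j k * residual A ν' μ j k|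
      ≤ 2 * (1 + (P : ℝ) ^ 2) * (1 + S) := by
    intro μ ν ν'
    have h1 : |∑ j, ∑ k, residual A ν μ j k * residual A ν' μ j k|
        ≤ (sqSum (residual A ν μ) + sqSum (residual A ν' μ)) / 2 := by
      rw [sqSum, sqSum, ← Finset.sum_add_distrib, Finset.sum_div]
      refine (Finset.abs_sum_le_sum_abs _ _).trans (Finset.sum_le_sum fun j _ => ?_)
      rw [← Finset.sum_add_distrib, Finset.sum_div]
      refine (Finset.abs_sum_le_sum_abs _ _).trans (Finset.sum_le_sum fun k _ => ?_)
      rw [abs_mul, ← sq_abs (residual A ν μ j k), ← sq_abs (residual A ν' μ j k)]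
      linarith [two_mul_le_add_sq |residual A ν μ j k| |residual A ν' μ j k|]
    rw [abs_mul, abs_of_nonneg (by positivity : (0 : ℝ) ≤ 1 / Ns)]
    have h2 : 1 / (Ns : ℝ) * |∑ j, ∑ k, residual A ν μ j k * residual A ν' μ j k|
        ≤ 1 / (Ns : ℝ) * ((sqSum (residual A ν μ) + sqSum (residual A ν' μ)) / 2) := by gcongr
    linarith [hres ν μ, hres ν' μ]
  simp only [meanError, Finset.sum_mul]
  refine (Finset.abs_sum_le_sum_abs _ _).trans (Finset.sum_le_sum fun μ _ => ?_)
  refine (Finset.abs_sum_le_sum_abs _ _).trans (Finset.sum_le_sum fun ν _ => ?_)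
  refine (Finset.abs_sum_le_sum_abs _ _).trans (Finset.sum_le_sum fun ν' _ => ?_)
  rw [abs_mul, mul_assoc]
  exact mul_le_mul_of_nonneg_left (hin μ ν ν') (abs_nonneg _)

end Frobenius

/-! ### Dependence of the limit on the task order. -/

section Order

variable {P : ℕ}

lemma isCorrelationMatrix_vecMulVec {v : Fin P → ℝ} (hv : ∀ μ, v μ * v μ = 1) :
    IsCorrelationMatrix (Matrix.vecMulVec v v) where
  posSemidef := by simpa using Matrix.posSemidef_vecMulVec_self_star v
  diag μ := by simp [Matrix.vecMulVec_apply, hv]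

/-- With perfectly correlated or anticorrelated inputs and identical targets, the final weight is
the one that solves the last task. -/
lemma limitError_vecMulVec {n : ℕ} {v : Fin (n + 1) → ℝ} (hv : ∀ μ, v μ * v μ = 1) :
    limitError (Matrix.vecMulVec v v) (Matrix.vecMulVec 1 1)
      = ∑ μ, (1 - v (Fin.last n) * v μ) ^ 2 := by
  set C := Matrix.vecMulVec v v with hC
  -- With identical targets only the sums over ν matter. They satisfy a closed recursion, and
  -- because v_k² = 1 each task overwrites what was learned before.
  have hsum : ∀ (k : Fin (n + 1)) (l : Fin (n + 1)),
      ∑ ν, limitResponse C k.succ ν l = v k * v l := by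
    have hstep : ∀ k l : Fin (n + 1), ∑ ν, limitResponse C k.succ ν l
        = ∑ ν, limitResponse C k.castSucc ν l
          + (1 - ∑ ν, limitResponse C k.castSucc ν k) * (v k * v l) := by
      intro k l
      simp only [limitResponse_succ, Finset.sum_add_distrib, ← Finset.sum_mul,
        Finset.sum_sub_distrib, Finset.sum_ite_eq', Finset.mem_univ, if_true, hC,
        Matrix.vecMulVec_apply]
    intro k
    induction k using Fin.induction with
    | zero => intro l; rw [hstep]; simp
    | succ k ih =>
      intro l
      rw [hstep, ← Fin.succ_castSucc, ih, ih]
      linear_combination (-(v k.castSucc * v l)) * hv k.succ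
  rw [limitError_eq_sum _ _ (isCorrelationMatrix_vecMulVec (by simp)).posSemidef]
  refine Finset.sum_congr rfl fun μ _ => ?_
  have h1 := hsum (Fin.last n) μ
  rw [Fin.succ_last] at h1
  have h2 : ∑ ν, ((if ν = μ then 1 else 0) - limitResponse C (Fin.last (n + 1)) ν μ)
      = 1 - v (Fin.last n) * v μ := by
    rw [Finset.sum_sub_distrib, h1]; simp
  rw [← h2, sq, Finset.sum_mul_sum]
  simp [Matrix.vecMulVec_apply]

/-- One task has the sign -1. Placed first it contributes an error 4; placed last it makes all n = P
- 1 other tasks wrong, with error 4n. The two differ exactly because P is at least 3. -/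
lemma exists_limitError_submatrix_ne (hP : 3 ≤ P) :
    ∃ (Cin Cout : Matrix (Fin P) (Fin P) ℝ) (σ : Equiv.Perm (Fin P)),
      IsCorrelationMatrix Cin ∧ IsCorrelationMatrix Cout ∧
      limitError (Cin.submatrix σ σ) (Cout.submatrix σ σ) ≠ limitError Cin Cout := by
  obtain ⟨n, rfl⟩ : ∃ n, P = n + 1 := ⟨P - 1, by omega⟩
  set v : Fin (n + 1) → ℝ := fun μ => if μ = 0 then -1 else 1 with hv
  set σ : Equiv.Perm (Fin (n + 1)) := Equiv.swap 0 (Fin.last n) with hσ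
  have hvv : ∀ μ, v μ * v μ = 1 := fun μ => by simp only [hv]; split_ifs <;> norm_num
  have h0 : Fin.last n ≠ 0 := by
    rw [Ne, Fin.ext_iff]; simp; omega
  refine ⟨Matrix.vecMulVec v v, Matrix.vecMulVec 1 1, σ, isCorrelationMatrix_vecMulVec hvv,
    isCorrelationMatrix_vecMulVec (by simp), ?_⟩
  have e1 : (Matrix.vecMulVec v v).submatrix σ σ = Matrix.vecMulVec (v ∘ σ) (v ∘ σ) := by
    ext i j; simp [Matrix.vecMulVec_apply]
  have e2 : (Matrix.vecMulVec (1 : Fin (n + 1) → ℝ) 1).submatrix σ σ = Matrix.vecMulVec 1 1 := by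
    ext i j; simp [Matrix.vecMulVec_apply]
  rw [e1, e2, limitError_vecMulVec hvv, limitError_vecMulVec (v := v ∘ σ) (fun μ => hvv _)]
  have hl : v (σ (Fin.last n)) = -1 := by simp [hσ, hv]
  have hl' : v (Fin.last n) = 1 := by simp [hv, h0]
  have s1 : ∑ μ, (1 - (v ∘ σ) (Fin.last n) * (v ∘ σ) μ) ^ 2 = ∑ μ, (1 + v μ) ^ 2 := by
    rw [← Equiv.sum_comp σ (fun μ => (1 + v μ) ^ 2)]
    refine Finset.sum_congr rfl fun μ _ => ?_
    simp only [Function.comp_apply, hl]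
    ring
  rw [s1, hl']
  simp only [hv, Fin.sum_univ_succ, Fin.succ_ne_zero, if_true, if_false]
  have hn : (2 : ℝ) ≤ n := by exact_mod_cast (by omega : 2 ≤ n)
  simp only [Finset.sum_const, Finset.card_univ, Fintype.card_fin, nsmul_eq_mul]
  intro h
  norm_num at h
  linarith

end Order

/-! ### Chernoff bounds for sums of squares of independent Gaussians. -/

section ChiSquare

open scoped NNReal

lemma integral_exp_mul_sq_gaussianReal (v : ℝ≥0) (θ : ℝ) (h : 2 * θ * v < 1) :
    ∫ x, Real.exp (θ * x ^ 2) ∂(gaussianReal 0 v) = (√(1 - 2 * θ * v))⁻¹ := by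
  rcases eq_or_ne v 0 with rfl | hv
  · simp
  have hv0 : (0 : ℝ) < v := by positivity
  rw [integral_gaussianReal_eq_integral_smul hv]
  have h1 : ∀ x : ℝ, gaussianPDFReal 0 v x • Real.exp (θ * x ^ 2)
      = (√(2 * Real.pi * v))⁻¹ * Real.exp (-((1 - 2 * θ * v) / (2 * v)) * x ^ 2) := by
    intro x
    rw [gaussianPDFReal, smul_eq_mul, mul_assoc, ← Real.exp_add]
    congr 2
    field_simp
    ring
  simp only [h1]
  rw [integral_const_mul, integral_gaussian, ← Real.sqrt_inv, ← Real.sqrt_inv,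
    ← Real.sqrt_mul (by positivity)]
  have : 1 - 2 * θ * v ≠ 0 := by linarith
  congr 1
  field_simp

/-- A nonintegrable function has Bochner integral 0, while the value computed for this integral is
positive. -/
lemma integrable_exp_mul_sq_gaussianReal (v : ℝ≥0) (θ : ℝ) (h : 2 * θ * v < 1) :
    Integrable (fun x => Real.exp (θ * x ^ 2)) (gaussianReal 0 v) := by
  by_contra hn
  have h1 := integral_exp_mul_sq_gaussianReal v θ h
  rw [integral_undef hn] at h1
  have : 0 < (√(1 - 2 * θ * v))⁻¹ := inv_pos.2 (Real.sqrt_pos.2 (by linarith))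
  linarith

/-- The inequality -log(1 - u) ≤ u + u², which makes centred squares of Gaussians subexponential. -/
lemma exp_neg_sub_sq_le {u : ℝ} (hu : |u| ≤ 1 / 2) : Real.exp (-u - u ^ 2) ≤ 1 - u := by
  obtain ⟨h1, h2⟩ := abs_le.1 hu
  have h3 : 1 ≤ Real.exp (u + u ^ 2) * (1 - u) := by
    rcases le_total 0 u with h | h
    · have h4 := Real.quadratic_le_exp_of_nonneg (by positivity : 0 ≤ u + u ^ 2)
      have h5 : (1 + (u + u ^ 2) + (u + u ^ 2) ^ 2 / 2) * (1 - u)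
          ≤ Real.exp (u + u ^ 2) * (1 - u) := mul_le_mul_of_nonneg_right h4 (by linarith)
      have h6 : (1 + (u + u ^ 2) + (u + u ^ 2) ^ 2 / 2) * (1 - u)
          = 1 + u ^ 2 / 2 * ((1 + u) ^ 2 * (1 - u) - 2 * u) := by ring
      have h7 : 0 ≤ (1 + u) ^ 2 * (1 - u) - 2 * u := by nlinarith [mul_nonneg h h]
      nlinarith [mul_nonneg (by positivity : 0 ≤ u ^ 2 / 2) h7]
    · have h4 := Real.add_one_le_exp (u + u ^ 2)
      have h5 : (u + u ^ 2 + 1) * (1 - u) ≤ Real.exp (u + u ^ 2) * (1 - u) :=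
        mul_le_mul_of_nonneg_right h4 (by linarith)
      have h6 : (u + u ^ 2 + 1) * (1 - u) = 1 + u ^ 2 * (-u) := by ring
      nlinarith [mul_nonneg (sq_nonneg u) (by linarith : 0 ≤ -u)]
  have h8 : Real.exp (-u - u ^ 2) = (Real.exp (u + u ^ 2))⁻¹ := by
    rw [← Real.exp_neg]; congr 1; ring
  rw [h8, inv_le_iff_one_le_mul₀' (Real.exp_pos _)]
  exact h3

lemma integral_exp_mul_sq_sub_le (v : ℝ≥0) {θ : ℝ} (h : |θ| * v ≤ 1 / 4) :
    ∫ x, Real.exp (θ * (x ^ 2 - v)) ∂(gaussianReal 0 v) ≤ Real.exp (2 * θ ^ 2 * v ^ 2) := by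
  have hu : |2 * θ * v| ≤ 1 / 2 := by
    rw [abs_mul, abs_mul, abs_two, NNReal.abs_eq]; linarith
  have h1 : 2 * θ * v < 1 := by linarith [(abs_le.1 hu).2]
  have h2 : ∀ x : ℝ, Real.exp (θ * (x ^ 2 - v)) = Real.exp (-(θ * v)) * Real.exp (θ * x ^ 2) := by
    intro x; rw [← Real.exp_add]; congr 1; ring
  simp only [h2]
  rw [integral_const_mul, integral_exp_mul_sq_gaussianReal v θ h1]
  have h3 := exp_neg_sub_sq_le hu
  have h4 : Real.exp (-(θ * v) - 2 * θ ^ 2 * v ^ 2) ≤ √(1 - 2 * θ * v) := by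
    apply Real.le_sqrt_of_sq_le
    rw [← Real.exp_nat_mul]
    refine le_trans (le_of_eq ?_) h3
    congr 1; push_cast; ring
  have h5 : 0 < √(1 - 2 * θ * v) := Real.sqrt_pos.2 (by linarith)
  rw [← div_eq_mul_inv, div_le_iff₀ h5]
  have h6 : Real.exp (-(θ * v)) = Real.exp (2 * θ ^ 2 * v ^ 2)
      * Real.exp (-(θ * v) - 2 * θ ^ 2 * v ^ 2) := by
    rw [← Real.exp_add]; congr 1; ring
  rw [h6]
  gcongr

variable {Ω : Type*} [MeasurableSpace Ω] {prob : Measure Ω} {N : ℕ} {Y : Fin N → Ω → ℝ} {v : ℝ≥0}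

lemma measureReal_sum_sq_ge_le (hY : ∀ i, Measurable (Y i)) (hind : iIndepFun Y prob)
    (hlaw : ∀ i, HasLaw (Y i) (gaussianReal 0 v) prob) {V τ s : ℝ} (hv : v ≤ V) (hτ : 0 < τ)
    (hτV : τ ≤ V) (hs : s ^ 2 = 1) :
    prob.real {ω | N * τ ≤ s * (∑ i, Y i ω ^ 2 - N * v)}
      ≤ Real.exp (-(N * (τ ^ 2 / (8 * V ^ 2)))) := by
  have := hind.isProbabilityMeasure
  have hV : 0 < V := hτ.trans_le hτV
  -- The minimizer of -tτ + 2t²V², with minimum -τ²/(8V²). The assumption τ ≤ V gives tV ≤ 1/4, the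
  -- range of the moment bound; the sign s selects the tail.
  set t : ℝ := τ / (4 * V ^ 2) with ht
  have ht0 : 0 < t := by positivity
  have hs' : |s| = 1 := by
    rw [← Real.sqrt_sq_eq_abs, hs, Real.sqrt_one]
  have htv : |t * s| * v ≤ 1 / 4 := by
    rw [abs_mul, hs', mul_one, abs_of_pos ht0]
    calc t * v ≤ t * V := by gcongr
      _ = (τ / V) / 4 := by rw [ht]; field_simp
      _ ≤ 1 / 4 := by
        have : τ / V ≤ 1 := (div_le_one hV).2 hτV
        linarith
  set X : Fin N → Ω → ℝ := fun i ω => s * (Y i ω ^ 2 - v) with hX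
  have hXm : ∀ i, Measurable (X i) := fun i => by fun_prop
  have hXind : iIndepFun X prob :=
    hind.comp (fun _ x => s * (x ^ 2 - v)) (fun _ => by fun_prop)
  have h2v : 2 * (t * s) * v < 1 := by
    have := le_abs_self (t * s)
    have hv0 : (0 : ℝ) ≤ v := v.2
    nlinarith
  have hexp : ∀ x : ℝ, Real.exp (t * (s * (x ^ 2 - v)))
      = Real.exp (t * s * (x ^ 2 - v)) := fun x => by rw [mul_assoc]
  have hintegral : ∀ i, Integrable (fun ω => Real.exp (t * X i ω)) prob := by
    intro i
    have h1 : Integrable (fun x : ℝ => Real.exp (t * (s * (x ^ 2 - v)))) (gaussianReal 0 v) := by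
      refine ((integrable_exp_mul_sq_gaussianReal v (t * s) h2v).const_mul
        (Real.exp (-(t * s * v)))).congr (ae_of_all _ fun x => ?_)
      simp only [← Real.exp_add]
      congr 1; ring
    rw [← (hlaw i).map_eq] at h1
    exact h1.comp_aemeasurable (hY i).aemeasurable
  have hmgf : ∀ i, mgf (X i) prob t ≤ Real.exp (2 * t ^ 2 * V ^ 2) := by
    intro i
    have h1 : mgf (X i) prob t = ∫ x, Real.exp (t * s * (x ^ 2 - v)) ∂(gaussianReal 0 v) := by
      rw [← (hlaw i).integral_comp (by fun_prop)]
      simp only [mgf, hX, Function.comp_def, hexp]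
    rw [h1]
    refine (integral_exp_mul_sq_sub_le v htv).trans (Real.exp_le_exp.2 ?_)
    have hv0 : (0 : ℝ) ≤ v := v.2
    rw [mul_pow, hs, mul_one]
    gcongr
  have h1 := measure_ge_le_exp_mul_mgf (μ := prob) (X := ∑ i, X i) (N * τ) ht0.le
    (hXind.integrable_exp_mul_sum hXm (fun i _ => hintegral i))
  rw [hXind.mgf_sum hXm] at h1
  have h2 : ∏ i, mgf (X i) prob t ≤ Real.exp (2 * t ^ 2 * V ^ 2) ^ N := by
    refine (Finset.prod_le_prod (fun i _ => mgf_nonneg) fun i _ => hmgf i).trans (le_of_eq ?_)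
    simp
  have hset : {ω | N * τ ≤ s * (∑ i, Y i ω ^ 2 - N * v)} = {ω | N * τ ≤ (∑ i, X i) ω} := by
    ext ω
    simp [hX, ← Finset.mul_sum, Finset.sum_sub_distrib]
  rw [hset]
  refine h1.trans ((mul_le_mul_of_nonneg_left h2 (Real.exp_pos _).le).trans (le_of_eq ?_))
  rw [← Real.exp_nat_mul, ← Real.exp_add]
  congr 1
  rw [ht]
  field_simp
  ring

lemma measureReal_abs_sum_sq_ge_le (hY : ∀ i, Measurable (Y i)) (hind : iIndepFun Y prob)
    (hlaw : ∀ i, HasLaw (Y i) (gaussianReal 0 v) prob) {V τ : ℝ} (hv : v ≤ V) (hτ : 0 < τ)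
    (hτV : τ ≤ V) :
    prob.real {ω | N * τ ≤ |∑ i, Y i ω ^ 2 - N * v|}
      ≤ 2 * Real.exp (-(N * (τ ^ 2 / (8 * V ^ 2)))) := by
  have := hind.isProbabilityMeasure
  have h1 := measureReal_sum_sq_ge_le hY hind hlaw hv hτ hτV (s := 1) (by norm_num)
  have h2 := measureReal_sum_sq_ge_le hY hind hlaw hv hτ hτV (s := -1) (by norm_num)
  have h3 : {ω | N * τ ≤ |∑ i, Y i ω ^ 2 - N * v|} ⊆
      {ω | N * τ ≤ 1 * (∑ i, Y i ω ^ 2 - N * v)} ∪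
        {ω | N * τ ≤ -1 * (∑ i, Y i ω ^ 2 - N * v)} := by
    intro ω hω
    rcases le_abs.1 (show N * τ ≤ |∑ i, Y i ω ^ 2 - N * v| from hω) with h | h
    · left; simpa using h
    · right; simpa using h
  refine (measureReal_mono h3).trans ((measureReal_union_le _ _).trans ?_)
  linarith

end ChiSquare

/-! ### Finite nets of the unit ball and operator norms. -/

section Net

open scoped RealInnerProductSpace

/-- A 1-separated subset of the ball of radius 2 with the most points leaves no point at distance
more than 1 from all of it; shrinking by 1/2 gives the net. The packing bound for separated points
gives 5^n and ensures that a largest set exists. -/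
lemma exists_finset_half_net (n : ℕ) : ∃ s : Finset (EuclideanSpace ℝ (Fin n)),
    s.card ≤ 5 ^ n ∧ (∀ x ∈ s, ‖x‖ ≤ 1) ∧
      ∀ u : EuclideanSpace ℝ (Fin n), ‖u‖ ≤ 1 → ∃ x ∈ s, ‖u - x‖ ≤ 1 / 2 := by
  classical
  let p : ℕ → Prop := fun k => ∃ s : Finset (EuclideanSpace ℝ (Fin n)), s.card = k ∧
    (∀ c ∈ s, ‖c‖ ≤ 2) ∧ ∀ c ∈ s, ∀ d ∈ s, c ≠ d → 1 ≤ ‖c - d‖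
  have hp0 : p 0 := ⟨∅, by simp⟩
  have hb : ∀ k, p k → k ≤ 5 ^ n := by
    rintro k ⟨s, rfl, h1, h2⟩
    simpa using Besicovitch.card_le_of_separated s h1 h2
  obtain ⟨s, hs, h1, h2⟩ : p (Nat.findGreatest p (5 ^ n)) :=
    Nat.findGreatest_spec (Nat.zero_le _) hp0
  refine ⟨s.image fun x => (1 / 2 : ℝ) • x, Finset.card_image_le.trans ?_, ?_, ?_⟩
  · rw [hs]; exact Nat.findGreatest_le _
  · intro x hx
    obtain ⟨c, hc, rfl⟩ := Finset.mem_image.1 hx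
    rw [norm_smul]
    have := h1 c hc
    norm_num
    linarith
  · intro u hu
    by_contra hcon
    push Not at hcon
    have hfar : ∀ c ∈ s, 1 < ‖(2 : ℝ) • u - c‖ := by
      intro c hc
      have h3 := hcon _ (Finset.mem_image_of_mem _ hc)
      have h4 : (2 : ℝ) • u - c = (2 : ℝ) • (u - (1 / 2 : ℝ) • c) := by
        rw [smul_sub, smul_smul]; norm_num
      rw [h4, norm_smul, Real.norm_two]
      linarith
    have hnot : (2 : ℝ) • u ∉ s := fun h => by
      have := hfar _ h
      simp at this
      linarith
    have hp : p (Nat.findGreatest p (5 ^ n) + 1) := by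
      refine ⟨insert ((2 : ℝ) • u) s, by rw [Finset.card_insert_of_notMem hnot, hs], ?_, ?_⟩
      · intro c hc
        rcases Finset.mem_insert.1 hc with rfl | hc
        · rw [norm_smul, Real.norm_two]; linarith
        · exact h1 c hc
      · intro c hc d hd hcd
        rcases Finset.mem_insert.1 hc with rfl | hc <;> rcases Finset.mem_insert.1 hd with rfl | hd
        · exact absurd rfl hcd
        · exact (hfar d hd).le
        · rw [norm_sub_rev]; exact (hfar c hc).le
        · exact h2 c hc d hd hcd
    have := Nat.le_findGreatest (hb _ hp) hp
    omega

lemma norm_le_two_mul_of_net {n : ℕ} {s : Finset (EuclideanSpace ℝ (Fin n))}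
    (hs : ∀ u : EuclideanSpace ℝ (Fin n), ‖u‖ ≤ 1 → ∃ x ∈ s, ‖u - x‖ ≤ 1 / 2)
    {F : Type*} [NormedAddCommGroup F] [NormedSpace ℝ F] (T : EuclideanSpace ℝ (Fin n) →L[ℝ] F)
    {M : ℝ} (hM : ∀ x ∈ s, ‖T x‖ ≤ M) : ‖T‖ ≤ 2 * M := by
  have hM0 : 0 ≤ M := by
    obtain ⟨x, hx, -⟩ := hs 0 (by simp)
    exact (norm_nonneg _).trans (hM x hx)
  have h1 : ‖T‖ ≤ M + ‖T‖ * (1 / 2) := by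
    refine T.opNorm_le_of_unit_norm (by positivity) fun u hu => ?_
    obtain ⟨x, hx, hux⟩ := hs u hu.le
    have h2 : T u = T x + T (u - x) := by rw [← map_add]; congr 1; abel
    rw [h2]
    refine (norm_add_le _ _).trans (add_le_add (hM x hx) ((T.le_opNorm _).trans ?_))
    gcongr
  linarith

open scoped Matrix.Norms.L2Operator in
-- The net is used once for the argument and once for the dual vector, each time with the factor 2.
lemma norm_matrix_le_of_net {n : ℕ} {s : Finset (EuclideanSpace ℝ (Fin n))}
    (hs : ∀ u : EuclideanSpace ℝ (Fin n), ‖u‖ ≤ 1 → ∃ x ∈ s, ‖u - x‖ ≤ 1 / 2)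
    (Z : Matrix (Fin n) (Fin n) ℝ) {M : ℝ}
    (hM : ∀ x ∈ s, ∀ y ∈ s, |dotProduct y.ofLp (Z.mulVec x.ofLp)| ≤ M) : ‖Z‖ ≤ 4 * M := by
  rw [← Matrix.l2_opNorm_toEuclideanCLM]
  have h1 : ∀ x ∈ s, ‖Matrix.toEuclideanCLM (𝕜 := ℝ) Z x‖ ≤ 2 * M := by
    intro x hx
    rw [← innerSL_apply_norm ℝ]
    refine norm_le_two_mul_of_net hs _ fun y hy => ?_
    have h2 := hM x hx y hy
    rw [innerSL_apply_apply, Real.norm_eq_abs, real_inner_comm]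
    convert h2 using 2
    rw [EuclideanSpace.inner_eq_star_dotProduct]
    simp [dotProduct_comm]
  have h3 := norm_le_two_mul_of_net hs _ h1
  linarith

end Net

/-! ### Concentration of the Gram products of the mixing matrices. -/

section Concentration

open scoped RealInnerProductSpace NNReal

variable {P m n : ℕ}

/-- The joint law of the entry vectors of `m × n` mixing matrices with task correlations `C`. -/
noncomputable def mixMeasure (C : Matrix (Fin P) (Fin P) ℝ) (m n : ℕ) :
    Measure (Fin m × Fin n → EuclideanSpace ℝ (Fin P)) :=
  Measure.pi fun _ => multivariateGaussian 0 ((1 / (n : ℝ)) • C)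

instance (C : Matrix (Fin P) (Fin P) ℝ) : IsProbabilityMeasure (mixMeasure C m n) := by
  unfold mixMeasure; infer_instance

/-- The mixing matrix of task `μ` with given entry vectors. -/
def mixMatrix (a : Fin m × Fin n → EuclideanSpace ℝ (Fin P)) (μ : Fin P) :
    Matrix (Fin m) (Fin n) ℝ :=
  Matrix.of fun i j => a (i, j) μ

@[simp] lemma mixMatrix_apply (a : Fin m × Fin n → EuclideanSpace ℝ (Fin P)) (μ : Fin P)
    (i : Fin m) (j : Fin n) : mixMatrix a μ i j = a (i, j) μ := rfl

lemma posSemidef_scale {C : Matrix (Fin P) (Fin P) ℝ} (hC : C.PosSemidef) (n : ℕ) :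
    ((1 / (n : ℝ)) • C).PosSemidef :=
  hC.smul (by positivity)

lemma iIndepFun_eval_mixMeasure (C : Matrix (Fin P) (Fin P) ℝ) :
    iIndepFun (fun (ij : Fin m × Fin n) (a : Fin m × Fin n → EuclideanSpace ℝ (Fin P)) => a ij)
      (mixMeasure C m n) :=
  iIndepFun_pi (X := fun _ x => x) (fun _ => aemeasurable_id)

lemma hasLaw_eval_mixMeasure (C : Matrix (Fin P) (Fin P) ℝ) (ij : Fin m × Fin n) :
    HasLaw (fun a : Fin m × Fin n → EuclideanSpace ℝ (Fin P) => a ij)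
      (multivariateGaussian 0 ((1 / (n : ℝ)) • C)) (mixMeasure C m n) :=
  (measurePreserving_eval (fun _ : Fin m × Fin n =>
    multivariateGaussian 0 ((1 / (n : ℝ)) • C)) ij).hasLaw

/-- A combination of the entry vectors in row `i`. -/
noncomputable def rowSum (z : Fin n → EuclideanSpace ℝ (Fin P)) (i : Fin m)
    (a : Fin m × Fin n → EuclideanSpace ℝ (Fin P)) : ℝ :=
  ∑ j, ⟪z j, a (i, j)⟫

lemma measurable_rowSum (z : Fin n → EuclideanSpace ℝ (Fin P)) (i : Fin m) :
    Measurable (rowSum z i) := by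
  unfold rowSum; fun_prop

lemma iIndepFun_inner_mixMeasure (C : Matrix (Fin P) (Fin P) ℝ)
    (z : Fin n → EuclideanSpace ℝ (Fin P)) :
    iIndepFun (fun (ij : Fin m × Fin n) (a : Fin m × Fin n → EuclideanSpace ℝ (Fin P)) =>
      ⟪z ij.2, a ij⟫) (mixMeasure C m n) :=
  (iIndepFun_eval_mixMeasure C).comp (fun ij x => ⟪z ij.2, x⟫) (fun _ => by fun_prop)

lemma hasGaussianLaw_inner_mixMeasure (C : Matrix (Fin P) (Fin P) ℝ)
    (z : EuclideanSpace ℝ (Fin P)) (ij : Fin m × Fin n) :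
    HasGaussianLaw (fun a : Fin m × Fin n → EuclideanSpace ℝ (Fin P) => ⟪z, a ij⟫)
      (mixMeasure C m n) :=
  (hasLaw_eval_mixMeasure C ij).hasGaussianLaw.map_fun (innerSL ℝ z)

lemma integral_inner_mixMeasure (C : Matrix (Fin P) (Fin P) ℝ)
    (z : EuclideanSpace ℝ (Fin P)) (ij : Fin m × Fin n) :
    ∫ a, ⟪z, a ij⟫ ∂(mixMeasure C m n) = 0 := by
  have h1 := (hasLaw_eval_mixMeasure C ij).integral_comp (f := fun x => ⟪z, x⟫) (by fun_prop)
  simp only [Function.comp_def] at h1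
  rw [h1]
  have h2 := (innerSL ℝ z).integral_comp_comm
    (IsGaussian.integrable_id (μ := multivariateGaussian (0 : EuclideanSpace ℝ (Fin P))
      ((1 / (n : ℝ)) • C)))
  simpa using h2

lemma variance_inner_mixMeasure {C : Matrix (Fin P) (Fin P) ℝ} (hC : C.PosSemidef)
    (z : EuclideanSpace ℝ (Fin P)) (ij : Fin m × Fin n) :
    Var[fun a : Fin m × Fin n → EuclideanSpace ℝ (Fin P) => ⟪z, a ij⟫; mixMeasure C m n]
      = (1 / (n : ℝ)) * dotProduct z.ofLp (C.mulVec z.ofLp) := by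
  have h1 := (hasLaw_eval_mixMeasure C ij (m := m)).covariance_fun_comp
    (f := fun x => ⟪z, x⟫) (g := fun x => ⟪z, x⟫) (by fun_prop) (by fun_prop)
  rw [covariance_self (Measurable.aemeasurable (by fun_prop))] at h1
  rw [h1, ← covarianceBilin_apply_eq_cov IsGaussian.memLp_two_id,
    covarianceBilin_multivariateGaussian (posSemidef_scale hC n)]
  simp [Matrix.smul_mulVec]

/-- The row sums are jointly Gaussian and distinct rows share no entry, so vanishing covariance
yields independence. -/
lemma iIndepFun_rowSum (C : Matrix (Fin P) (Fin P) ℝ) (z : Fin n → EuclideanSpace ℝ (Fin P)) :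
    iIndepFun (fun i : Fin m => rowSum z i) (mixMeasure C m n) := by
  have hJ := iIndepFun.hasGaussianLaw (E := fun _ : Fin m × Fin n => ℝ)
    (X := fun ij (a : Fin m × Fin n → EuclideanSpace ℝ (Fin P)) => ⟪z ij.2, a ij⟫)
    (fun ij => hasGaussianLaw_inner_mixMeasure C (z ij.2) ij) (iIndepFun_inner_mixMeasure C z)
  have hG : HasGaussianLaw (fun (a : Fin m × Fin n → EuclideanSpace ℝ (Fin P)) (i : Fin m) =>
      rowSum z i a) (mixMeasure C m n) := by
    have := hJ.map_fun (ContinuousLinearMap.pi fun i : Fin m =>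
      ∑ j : Fin n, ContinuousLinearMap.proj (R := ℝ) (φ := fun _ : Fin m × Fin n => ℝ) (i, j))
    refine this.congr (ae_of_all _ fun a => ?_)
    funext i
    simp [rowSum]
  refine hG.iIndepFun_of_covariance_eq_zero fun i i' hii' => ?_
  unfold rowSum
  rw [covariance_fun_sum_fun_sum
    (fun j => (hasGaussianLaw_inner_mixMeasure C (z j) (i, j)).memLp_two)
    (fun j => (hasGaussianLaw_inner_mixMeasure C (z j) (i', j)).memLp_two)]
  refine Finset.sum_eq_zero fun j _ => Finset.sum_eq_zero fun j' _ => ?_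
  exact ((iIndepFun_inner_mixMeasure (m := m) C z).indepFun (i := (i, j)) (j := (i', j'))
    (by simp [hii'])).covariance_eq_zero
    (hasGaussianLaw_inner_mixMeasure C (z j) (i, j)).memLp_two
    (hasGaussianLaw_inner_mixMeasure C (z j') (i', j')).memLp_two

lemma hasLaw_rowSum {C : Matrix (Fin P) (Fin P) ℝ} (hC : C.PosSemidef)
    (z : Fin n → EuclideanSpace ℝ (Fin P)) (i : Fin m) :
    HasLaw (rowSum z i) (gaussianReal 0
      ((1 / (n : ℝ)) * ∑ j, dotProduct (z j).ofLp (C.mulVec (z j).ofLp)).toNNReal)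
      (mixMeasure C m n) where
  aemeasurable := (measurable_rowSum z i).aemeasurable
  map_eq := by
    have hind : iIndepFun (fun (j : Fin n) (a : Fin m × Fin n → EuclideanSpace ℝ (Fin P)) =>
        ⟪z j, a (i, j)⟫) (mixMeasure C m n) :=
      (iIndepFun_inner_mixMeasure (m := m) C z).precomp (g := fun j : Fin n => (i, j))
        (fun j j' h => by simpa using h)
    have hG : HasGaussianLaw (rowSum z i) (mixMeasure C m n) :=
      hind.hasGaussianLaw_fun_sum fun j => hasGaussianLaw_inner_mixMeasure C (z j) (i, j)
    rw [hG.map_eq_gaussianReal]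
    congr 2
    · unfold rowSum
      rw [integral_finsetSum _ fun j _ =>
        (hasGaussianLaw_inner_mixMeasure C (z j) (i, j)).integrable]
      exact Finset.sum_eq_zero fun j _ => integral_inner_mixMeasure C _ _
    · have h1 := IndepFun.variance_sum (s := Finset.univ)
        (fun j _ => (hasGaussianLaw_inner_mixMeasure C (z j) (i, j)).memLp_two)
        (fun j _ j' _ hjj' => hind.indepFun hjj')
      have h2 : rowSum z i = ∑ j, fun a : Fin m × Fin n → EuclideanSpace ℝ (Fin P) =>
          ⟪z j, a (i, j)⟫ := by
        ext a; simp [rowSum]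
      rw [h2, h1, Finset.mul_sum]
      exact Finset.sum_congr rfl fun j _ => variance_inner_mixMeasure hC _ _

/-- The coefficients of the combination `A κ y + s A l x` of the mixing matrices. -/
noncomputable def pairCoeff (κ l : Fin P) (s : ℝ) (x y : EuclideanSpace ℝ (Fin n)) (j : Fin n) :
    EuclideanSpace ℝ (Fin P) :=
  y j • EuclideanSpace.single κ 1 + (s * x j) • EuclideanSpace.single l 1

lemma rowSum_pairCoeff (κ l : Fin P) (s : ℝ) (x y : EuclideanSpace ℝ (Fin n)) (i : Fin m)
    (a : Fin m × Fin n → EuclideanSpace ℝ (Fin P)) :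
    rowSum (pairCoeff κ l s x y) i a
      = (mixMatrix a κ).mulVec y.ofLp i + s * (mixMatrix a l).mulVec x.ofLp i := by
  simp only [rowSum, pairCoeff, inner_add_left, real_inner_smul_left,
    EuclideanSpace.inner_single_left, Matrix.mulVec, dotProduct, mixMatrix_apply,
    Finset.sum_add_distrib, Finset.mul_sum]
  congr 1
  · exact Finset.sum_congr rfl fun j _ => by simp [mul_comm]
  · exact Finset.sum_congr rfl fun j _ => by simp; ring

lemma dotProduct_pairCoeff {C : Matrix (Fin P) (Fin P) ℝ} (hC : C.IsSymm) (κ l : Fin P) {s : ℝ}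
    (x y : EuclideanSpace ℝ (Fin n)) (hκ : C κ κ = 1) (hl : C l l = 1) (hs : s ^ 2 = 1) :
    ∑ j, dotProduct (pairCoeff κ l s x y j).ofLp (C.mulVec (pairCoeff κ l s x y j).ofLp)
      = ‖y‖ ^ 2 + 2 * s * C κ l * dotProduct y.ofLp x.ofLp + ‖x‖ ^ 2 := by
  rw [EuclideanSpace.real_norm_sq_eq, EuclideanSpace.real_norm_sq_eq, dotProduct, Finset.mul_sum,
    ← Finset.sum_add_distrib, ← Finset.sum_add_distrib]
  refine Finset.sum_congr rfl fun j _ => ?_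
  have hsym : C l κ = C κ l := hC.apply κ l
  have h1 : (pairCoeff κ l s x y j).ofLp = y j • Pi.single κ 1 + (s * x j) • Pi.single l 1 := by
    simp [pairCoeff]
  rw [h1]
  simp only [Matrix.mulVec_add, Matrix.mulVec_smul, Matrix.mulVec_single_one, add_dotProduct,
    dotProduct_add, smul_dotProduct, dotProduct_smul, single_one_dotProduct, Matrix.col_apply,
    smul_eq_mul, hκ, hl, hsym]
  linear_combination (x j) ^ 2 * hs

lemma measureReal_pair_le {C : Matrix (Fin P) (Fin P) ℝ} (hC : IsCorrelationMatrix C)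
    (hn : 0 < n) (κ l : Fin P) {s δ : ℝ} (hs : s ^ 2 = 1) (hδ : 0 < δ) (hδ4 : δ ≤ 4)
    {x y : EuclideanSpace ℝ (Fin n)} (hx : ‖x‖ ≤ 1) (hy : ‖y‖ ≤ 1) :
    (mixMeasure C m n).real {a | m * (δ / n) ≤
      |∑ i, ((mixMatrix a κ).mulVec y.ofLp i + s * (mixMatrix a l).mulVec x.ofLp i) ^ 2
        - m * ((1 / (n : ℝ)) * (‖y‖ ^ 2 + 2 * s * C κ l * dotProduct y.ofLp x.ofLp + ‖x‖ ^ 2))|}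
      ≤ 2 * Real.exp (-(m * (δ ^ 2 / 128))) := by
  have hn' : (0 : ℝ) < n := by exact_mod_cast hn
  have hsym : C.IsSymm := by
    have := hC.posSemidef.isHermitian
    rwa [Matrix.IsHermitian, Matrix.conjTranspose_eq_transpose_of_trivial] at this
  have hvar : ∀ s : ℝ, s ^ 2 = 1 →
      0 ≤ ‖y‖ ^ 2 + 2 * s * C κ l * dotProduct y.ofLp x.ofLp + ‖x‖ ^ 2 := by
    intro s hs
    rw [← dotProduct_pairCoeff hsym κ l x y (hC.diag κ) (hC.diag l) hs]
    refine Finset.sum_nonneg fun j _ => ?_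
    simpa using hC.posSemidef.dotProduct_mulVec_nonneg (pairCoeff κ l s x y j).ofLp
  set w := ‖y‖ ^ 2 + 2 * s * C κ l * dotProduct y.ofLp x.ofLp + ‖x‖ ^ 2 with hw
  have hw0 : 0 ≤ w := hvar s hs
  -- The expressions for s and -s are both nonnegative and sum to 2(‖x‖² + ‖y‖²), at most 4; no
  -- bound on the entries of C is needed.
  have hw4 : w ≤ 4 := by
    have h1 := hvar (-s) (by rw [neg_sq]; exact hs)
    have h2 : ‖y‖ ^ 2 ≤ 1 := pow_le_one₀ (norm_nonneg _) hy
    have h3 : ‖x‖ ^ 2 ≤ 1 := pow_le_one₀ (norm_nonneg _) hx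
    rw [hw]
    nlinarith
  have hlaw : ∀ i : Fin m, HasLaw (rowSum (pairCoeff κ l s x y) i)
      (gaussianReal 0 ((1 / (n : ℝ)) * w).toNNReal) (mixMeasure C m n) := by
    intro i
    rw [hw, ← dotProduct_pairCoeff hsym κ l x y (hC.diag κ) (hC.diag l) hs]
    exact hasLaw_rowSum hC.posSemidef _ i
  have hcoe : ((((1 / (n : ℝ)) * w).toNNReal : ℝ≥0) : ℝ) = (1 / (n : ℝ)) * w :=
    Real.coe_toNNReal _ (by positivity)
  -- With V = 4/n and τ = δ/n the exponent τ²/(8V²) equals δ²/128, free of n.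
  have h1 := measureReal_abs_sum_sq_ge_le (fun i => measurable_rowSum _ i)
    (iIndepFun_rowSum C (pairCoeff κ l s x y)) hlaw (V := 4 / n) (τ := δ / n)
    (by rw [hcoe, one_div, inv_mul_eq_div]; gcongr) (by positivity) (by gcongr)
  simp only [rowSum_pairCoeff, hcoe] at h1
  refine h1.trans (le_of_eq ?_)
  congr 3
  field_simp
  ring

open scoped Matrix.Norms.L2Operator

/-- The event that some product `(A κ)ᵀ * A l`, rescaled by `n / m`, is not close to a scalar. -/
def badSet (C : Matrix (Fin P) (Fin P) ℝ) (m n : ℕ) (δ : ℝ) :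
    Set (Fin m × Fin n → EuclideanSpace ℝ (Fin P)) :=
  {a | ∃ κ l, δ < ‖((n : ℝ) / m) • ((mixMatrix a κ).transpose * mixMatrix a l) - C κ l • 1‖}

set_option maxHeartbeats 400000 in
-- Polarization expresses each bilinear form through sums of squares for the signs ±1. The union
-- bound runs over P² pairs of tasks, 25^n pairs of net points, two signs and two tails. Each sum of
-- squares is controlled at level δ/2, whence (δ/2)²/128 = δ²/512.
lemma measureReal_badSet_le {C : Matrix (Fin P) (Fin P) ℝ} (hC : IsCorrelationMatrix C)
    (hm : 0 < m) (hn : 0 < n) {δ : ℝ} (hδ : 0 < δ) (hδ8 : δ ≤ 8) :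
    (mixMeasure C m n).real (badSet C m n δ)
      ≤ 4 * (P : ℝ) ^ 2 * 25 ^ n * Real.exp (-(m * (δ ^ 2 / 512))) := by
  obtain ⟨N, hN, hN1, hNnet⟩ := exists_finset_half_net n
  have hn' : (0 : ℝ) < n := by exact_mod_cast hn
  have hm' : (0 : ℝ) < m := by exact_mod_cast hm
  set F : Fin P → Fin P → EuclideanSpace ℝ (Fin n) → EuclideanSpace ℝ (Fin n) → ℝ →
      Set (Fin m × Fin n → EuclideanSpace ℝ (Fin P)) := fun κ l x y s => {a | m * (δ / 2 / n) ≤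
      |∑ i, ((mixMatrix a κ).mulVec y.ofLp i + s * (mixMatrix a l).mulVec x.ofLp i) ^ 2
        - m * ((1 / (n : ℝ)) * (‖y‖ ^ 2 + 2 * s * C κ l * dotProduct y.ofLp x.ofLp + ‖x‖ ^ 2))|}
    with hF
  have hsub : badSet C m n δ ⊆
      ⋃ κ : Fin P, ⋃ l : Fin P, ⋃ x ∈ N, ⋃ y ∈ N, F κ l x y 1 ∪ F κ l x y (-1) := by
    rintro a ⟨κ, l, ha⟩
    by_contra hcon
    simp only [Set.mem_iUnion, not_exists, Set.mem_union, not_or] at hcon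
    refine absurd ha (not_lt.2 ?_)
    have h1 : ‖((n : ℝ) / m) • ((mixMatrix a κ).transpose * mixMatrix a l) - C κ l • 1‖
        ≤ 4 * (δ / 4) := by
      refine norm_matrix_le_of_net hNnet _ fun x hx y hy => ?_
      obtain ⟨h1, h2⟩ := hcon κ l x hx y hy
      simp only [hF, Set.mem_ofPred_eq, not_le] at h1 h2
      set p := (mixMatrix a κ).mulVec y.ofLp with hp
      set q := (mixMatrix a l).mulVec x.ofLp with hq
      have e1 : dotProduct y.ofLp ((((n : ℝ) / m) • ((mixMatrix a κ).transpose * mixMatrix a l)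
          - C κ l • (1 : Matrix (Fin n) (Fin n) ℝ)).mulVec x.ofLp)
          = (n : ℝ) / m * dotProduct p q - C κ l * dotProduct y.ofLp x.ofLp := by
        rw [Matrix.sub_mulVec, Matrix.smul_mulVec, Matrix.smul_mulVec, Matrix.one_mulVec,
          dotProduct_sub, dotProduct_smul, dotProduct_smul, ← Matrix.mulVec_mulVec, ← hq,
          Matrix.dotProduct_mulVec, Matrix.vecMul_transpose, ← hp, smul_eq_mul, smul_eq_mul]
      have e2 : ∑ i, (p i + 1 * q i) ^ 2 - ∑ i, (p i + -1 * q i) ^ 2 = 4 * dotProduct p q := by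
        rw [← Finset.sum_sub_distrib, dotProduct, Finset.mul_sum]
        exact Finset.sum_congr rfl fun i _ => by ring
      have e3 : (n : ℝ) / m * dotProduct p q - C κ l * dotProduct y.ofLp x.ofLp
          = (n : ℝ) / m * (((∑ i, (p i + 1 * q i) ^ 2 - m * ((1 / (n : ℝ)) * (‖y‖ ^ 2
            + 2 * 1 * C κ l * dotProduct y.ofLp x.ofLp + ‖x‖ ^ 2)))
            - (∑ i, (p i + -1 * q i) ^ 2 - m * ((1 / (n : ℝ)) * (‖y‖ ^ 2
            + 2 * -1 * C κ l * dotProduct y.ofLp x.ofLp + ‖x‖ ^ 2)))) / 4) := by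
        rw [sub_sub_sub_comm, e2]
        field_simp
        ring
      rw [e1, e3, abs_mul, abs_of_pos (by positivity : (0 : ℝ) < n / m), abs_div,
        abs_of_pos (by norm_num : (0 : ℝ) < 4)]
      have h3 := (abs_sub _ _).trans (add_le_add h1.le h2.le)
      calc _ ≤ (n : ℝ) / m * ((m * (δ / 2 / n) + m * (δ / 2 / n)) / 4) := by gcongr
        _ = δ / 4 := by field_simp; norm_num
    linarith
  have hFm : ∀ κ l, ∀ x ∈ N, ∀ y ∈ N,
      (mixMeasure C m n).real (F κ l x y 1 ∪ F κ l x y (-1))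
        ≤ 4 * Real.exp (-(m * (δ ^ 2 / 512))) := by
    intro κ l x hx y hy
    have e : (δ / 2) ^ 2 / 128 = δ ^ 2 / 512 := by ring
    have h1 := measureReal_pair_le (m := m) hC hn κ l (s := 1) (by norm_num) (half_pos hδ)
      (by linarith) (hN1 x hx) (hN1 y hy)
    have h2 := measureReal_pair_le (m := m) hC hn κ l (s := -1) (by norm_num) (half_pos hδ)
      (by linarith) (hN1 x hx) (hN1 y hy)
    rw [e] at h1 h2
    exact (measureReal_union_le _ _).trans ((add_le_add h1 h2).trans (by linarith))
  have h25 : (5 : ℝ) ^ n * 5 ^ n = 25 ^ n := by rw [← mul_pow]; norm_num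
  have hcard : (N.card : ℝ) ≤ 5 ^ n := by exact_mod_cast hN
  refine (measureReal_mono hsub).trans ?_
  calc _ ≤ ∑ κ : Fin P, ∑ l : Fin P, ∑ x ∈ N, ∑ y ∈ N, 4 * Real.exp (-(m * (δ ^ 2 / 512))) := by
        refine (measureReal_iUnion_fintype_le _).trans (Finset.sum_le_sum fun κ _ => ?_)
        refine (measureReal_iUnion_fintype_le _).trans (Finset.sum_le_sum fun l _ => ?_)
        refine (measureReal_biUnion_finset_le _ _).trans (Finset.sum_le_sum fun x hx => ?_)
        refine (measureReal_biUnion_finset_le _ _).trans (Finset.sum_le_sum fun y hy => ?_)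
        exact hFm κ l x hx y hy
    _ = 4 * (P : ℝ) ^ 2 * ((N.card : ℝ) * N.card) * Real.exp (-(m * (δ ^ 2 / 512))) := by
        simp only [Finset.sum_const, Finset.card_univ, Fintype.card_fin, nsmul_eq_mul]
        ring
    _ ≤ 4 * (P : ℝ) ^ 2 * ((5 : ℝ) ^ n * 5 ^ n) * Real.exp (-(m * (δ ^ 2 / 512))) :=
        mul_le_mul_of_nonneg_right (mul_le_mul_of_nonneg_left
          (mul_le_mul hcard hcard (Nat.cast_nonneg _) (by positivity)) (by positivity))
          (Real.exp_pos _).le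
    _ = _ := by rw [h25]

end Concentration

/-! ### Inverse moments of the distance of a column to the span of the others. -/

section InverseMoment

open scoped RealInnerProductSpace NNReal ENNReal

/-- The function `|x| ^ (-1/2)`, infinite at zero. -/
noncomputable def invSqrt (x : ℝ) : ℝ≥0∞ := (ENNReal.ofReal |x| ^ (1 / 2 : ℝ))⁻¹

lemma measurable_invSqrt : Measurable invSqrt := by
  unfold invSqrt; fun_prop

lemma gaussianReal_zero_one_le_volume : gaussianReal 0 1 ≤ (volume : Measure ℝ) := by
  rw [gaussianReal_of_var_ne_zero 0 one_ne_zero]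
  conv_rhs => rw [← withDensity_one (μ := (volume : Measure ℝ))]
  refine withDensity_mono (ae_of_all _ fun x => ?_)
  rw [gaussianPDF, Pi.one_apply, ENNReal.ofReal_le_one, gaussianPDFReal]
  have h1 : (√(2 * Real.pi * (1 : ℝ≥0)))⁻¹ ≤ 1 := by
    refine inv_le_one_of_one_le₀ (Real.one_le_sqrt.2 ?_)
    have := Real.pi_gt_three
    push_cast
    linarith
  have h2 : Real.exp (-(x - 0) ^ 2 / (2 * (1 : ℝ≥0))) ≤ 1 := by
    rw [Real.exp_le_one_iff]
    refine div_nonpos_of_nonpos_of_nonneg ?_ (by positivity)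
    have := sq_nonneg (x - 0)
    linarith
  exact mul_le_one₀ h1 (Real.exp_pos _).le h2

lemma integrableOn_abs_rpow_neg_half :
    IntegrableOn (fun x : ℝ => |x| ^ (-(1 / 2) : ℝ)) (Set.Ioc (-1) 1) := by
  have h1 : IntervalIntegrable (fun x : ℝ => |x| ^ (-(1 / 2) : ℝ)) volume 0 1 := by
    refine (intervalIntegral.intervalIntegrable_rpow' (r := -(1 / 2)) (by norm_num)).congr ?_
    intro x hx
    rw [Set.uIoc_of_le zero_le_one] at hx
    simp only [abs_of_pos hx.1]
  have h2 : IntervalIntegrable (fun x : ℝ => |x| ^ (-(1 / 2) : ℝ)) volume (-1) 0 := by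
    rw [IntervalIntegrable.iff_comp_neg]
    simpa using h1.symm
  exact (intervalIntegrable_iff_integrableOn_Ioc_of_le (by norm_num)).1 (h2.trans h1)

lemma lintegral_invSqrt_lt_top : ∫⁻ x, invSqrt x ∂(gaussianReal 0 1) < ∞ := by
  have h1 : ∀ x, invSqrt x ≤ 1 + (Set.Ioc (-1) 1).indicator invSqrt x := by
    intro x
    by_cases hx : x ∈ Set.Ioc (-1 : ℝ) 1
    · rw [Set.indicator_of_mem hx]; exact le_add_self
    · rw [Set.indicator_of_notMem hx, add_zero, invSqrt, ENNReal.inv_le_one]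
      refine ENNReal.one_le_rpow ?_ (by norm_num)
      rw [ENNReal.one_le_ofReal]
      by_contra h
      have := abs_lt.1 (not_le.1 h)
      exact hx ⟨this.1, this.2.le⟩
  refine (lintegral_mono h1).trans_lt ?_
  rw [lintegral_add_left measurable_const, lintegral_indicator measurableSet_Ioc]
  refine ENNReal.add_lt_top.2 ⟨by simp, ?_⟩
  have h2 : ∫⁻ x in Set.Ioc (-1) 1, invSqrt x ∂(gaussianReal 0 1)
      ≤ ∫⁻ x in Set.Ioc (-1 : ℝ) 1, invSqrt x :=
    lintegral_mono' (Measure.restrict_mono le_rfl gaussianReal_zero_one_le_volume) le_rfl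
  refine h2.trans_lt ?_
  have h3 := integrableOn_abs_rpow_neg_half.hasFiniteIntegral
  rw [hasFiniteIntegral_iff_ofReal (ae_of_all _ fun x => by positivity)] at h3
  refine lt_of_le_of_lt (lintegral_mono_ae ?_) h3
  have h0 : ∀ᵐ x ∂(volume.restrict (Set.Ioc (-1 : ℝ) 1)), x ≠ 0 :=
    ae_restrict_of_ae (Measure.ae_ne volume 0)
  filter_upwards [h0] with x hx
  have hx' : 0 < |x| := abs_pos.2 hx
  rw [invSqrt, ENNReal.ofReal_rpow_of_pos hx', ← ENNReal.ofReal_inv_of_pos (by positivity),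
    Real.rpow_neg hx'.le]

/-- A bound on the fourth inverse moment of a chi-square variable. -/
noncomputable def invMomentBound : ℝ≥0∞ := (∫⁻ x, invSqrt x ∂(gaussianReal 0 1)) ^ 16

lemma invMomentBound_lt_top : invMomentBound < ∞ :=
  ENNReal.pow_lt_top lintegral_invSqrt_lt_top

/-- With S the sum, each |t_l|^(-1/2) is at least S^(-1/4), and sixteen such factors make S^(-4).
The point is that |x|^(-1/2) is integrable near 0 and that the product factors under independence.
-/
lemma inv_sum_sq_pow_le (t : Fin 16 → ℝ) :
    (ENNReal.ofReal (∑ l, t l ^ 2))⁻¹ ^ 4 ≤ ∏ l, invSqrt (t l) := by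
  set S := ENNReal.ofReal (∑ l, t l ^ 2) with hS
  have h1 : ∀ l, (S ^ (1 / 4 : ℝ))⁻¹ ≤ invSqrt (t l) := by
    intro l
    rw [invSqrt, ENNReal.inv_le_inv]
    have h2 : ENNReal.ofReal |t l| ≤ S ^ (1 / 2 : ℝ) := by
      rw [hS, ENNReal.ofReal_rpow_of_nonneg (by positivity) (by norm_num)]
      refine ENNReal.ofReal_le_ofReal ?_
      rw [← Real.sqrt_eq_rpow]
      exact Real.abs_le_sqrt (Finset.single_le_sum (f := fun l => t l ^ 2)
        (fun _ _ => sq_nonneg _) (Finset.mem_univ l))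
    calc ENNReal.ofReal |t l| ^ (1 / 2 : ℝ) ≤ (S ^ (1 / 2 : ℝ)) ^ (1 / 2 : ℝ) :=
          ENNReal.rpow_le_rpow h2 (by norm_num)
      _ = S ^ (1 / 4 : ℝ) := by rw [← ENNReal.rpow_mul]; norm_num
  calc S⁻¹ ^ 4 = ∏ _l : Fin 16, (S ^ (1 / 4 : ℝ))⁻¹ := by
        rw [Finset.prod_const, Finset.card_univ, Fintype.card_fin, ← ENNReal.inv_pow, ← ENNReal.inv_pow,
          ← ENNReal.rpow_natCast (S ^ (1 / 4 : ℝ)), ← ENNReal.rpow_mul, ← ENNReal.rpow_natCast S]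
        norm_num
    _ ≤ _ := Finset.prod_le_prod' fun l _ => h1 l

/-- Coordinates of a standard Gaussian along orthonormal vectors are independent standard Gaussians,
so the expectation of the product bound is a 16th power. -/
lemma lintegral_inv_sum_inner_sq_le {E : Type*} [NormedAddCommGroup E] [InnerProductSpace ℝ E]
    [FiniteDimensional ℝ E] [MeasurableSpace E] [BorelSpace E] {q : Fin 16 → E}
    (hq : Orthonormal ℝ q) :
    ∫⁻ s, (ENNReal.ofReal (∑ l, ⟪q l, s⟫ ^ 2))⁻¹ ^ 4 ∂(stdGaussian E) ≤ invMomentBound := by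
  have hG : HasGaussianLaw (fun (s : E) (l : Fin 16) => ⟪q l, s⟫) (stdGaussian E) :=
    (IsGaussian.hasGaussianLaw_id (μ := stdGaussian E)).map_fun
      (ContinuousLinearMap.pi fun l => innerSL ℝ (q l))
  have hcov : ∀ l l' : Fin 16, cov[fun s => ⟪q l, s⟫, fun s => ⟪q l', s⟫; stdGaussian E]
      = ⟪q l, q l'⟫ := by
    intro l l'
    rw [← covarianceBilin_apply_eq_cov IsGaussian.memLp_two_id, covarianceBilin_stdGaussian]
    rfl
  have hind : iIndepFun (fun (l : Fin 16) (s : E) => ⟪q l, s⟫) (stdGaussian E) :=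
    hG.iIndepFun_of_covariance_eq_zero fun l l' hll' => by
      rw [hcov]; exact hq.2 hll'
  have hlaw : ∀ l, (stdGaussian E).map (fun s => ⟪q l, s⟫) = gaussianReal 0 1 := by
    intro l
    have h1 : HasGaussianLaw (fun s : E => ⟪q l, s⟫) (stdGaussian E) :=
      (IsGaussian.hasGaussianLaw_id (μ := stdGaussian E)).map_fun (innerSL ℝ (q l))
    rw [h1.map_eq_gaussianReal]
    congr 1
    · exact integral_strongDual_stdGaussian (innerSL ℝ (q l))
    · have h2 := variance_dual_stdGaussian (innerSL ℝ (q l))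
      simp only [innerSL_apply_norm, hq.1 l] at h2
      have h3 : Var[fun s => ⟪q l, s⟫; stdGaussian E] = 1 := by simpa using h2
      rw [h3]; simp
  calc ∫⁻ s, (ENNReal.ofReal (∑ l, ⟪q l, s⟫ ^ 2))⁻¹ ^ 4 ∂(stdGaussian E)
      ≤ ∫⁻ s, ∏ l, invSqrt ⟪q l, s⟫ ∂(stdGaussian E) :=
        lintegral_mono fun s => inv_sum_sq_pow_le _
    _ = ∏ l, ∫⁻ s, invSqrt ⟪q l, s⟫ ∂(stdGaussian E) :=
        lintegral_prod_eq_prod_lintegral_of_indepFun Finset.univ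
          (fun l s => invSqrt ⟪q l, s⟫) (hind.comp (fun _ => invSqrt) fun _ => measurable_invSqrt)
          (fun l => measurable_invSqrt.comp (by fun_prop))
    _ = invMomentBound := by
        have h1 : ∀ l, ∫⁻ s, invSqrt ⟪q l, s⟫ ∂(stdGaussian E)
            = ∫⁻ x, invSqrt x ∂(gaussianReal 0 1) := by
          intro l
          rw [← hlaw l, lintegral_map measurable_invSqrt (by fun_prop)]
        simp [h1, invMomentBound]

lemma exists_orthonormal_orthogonal {E : Type*} [NormedAddCommGroup E] [InnerProductSpace ℝ E]
    [FiniteDimensional ℝ E] (H : Submodule ℝ E) {k : ℕ}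
    (hH : Module.finrank ℝ H + k ≤ Module.finrank ℝ E) :
    ∃ q : Fin k → E, Orthonormal ℝ q ∧ ∀ l, ∀ h ∈ H, ⟪q l, h⟫ = 0 := by
  have h1 := H.finrank_add_finrank_orthogonal
  have h2 : k ≤ Module.finrank ℝ Hᗮ := by omega
  refine ⟨fun l => (stdOrthonormalBasis ℝ Hᗮ (Fin.castLE h2 l) : E), ?_, fun l h hh => ?_⟩
  · have h3 := ((stdOrthonormalBasis ℝ Hᗮ).orthonormal.comp_linearIsometry Hᗮ.subtypeₗᵢ).comp
      (Fin.castLE h2) (Fin.castLE_injective h2)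
    exact h3
  · exact Submodule.inner_left_of_mem_orthogonal hh
      (stdOrthonormalBasis ℝ Hᗮ (Fin.castLE h2 l)).2

lemma sum_inner_sq_le_norm_sub_sq {E : Type*} [NormedAddCommGroup E] [InnerProductSpace ℝ E]
    {k : ℕ} {q : Fin k → E} (hq : Orthonormal ℝ q) {h : E} (hh : ∀ l, ⟪q l, h⟫ = 0) (u : E) :
    ∑ l, ⟪q l, u⟫ ^ 2 ≤ ‖u - h‖ ^ 2 := by
  have h1 := hq.sum_inner_products_le (s := Finset.univ) (u - h)
  refine le_trans (le_of_eq (Finset.sum_congr rfl fun l _ => ?_)) h1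
  rw [inner_sub_right, hh, sub_zero, Real.norm_eq_abs, sq_abs]

lemma map_mul_pi_gaussianReal {ι : Type*} [Fintype ι] (v : ℝ≥0) :
    (Measure.pi fun _ : ι => gaussianReal 0 1).map (fun u i => √v * u i)
      = Measure.pi fun _ : ι => gaussianReal 0 v := by
  rw [Measure.pi_map_pi (f := fun _ x => √(v : ℝ) * x)
    (fun _ => (measurable_const_mul _).aemeasurable)]
  congr 1
  funext i
  rw [gaussianReal_map_const_mul]
  congr 1
  · simp
  · ext; simp

/-- Sixteen orthonormal vectors orthogonal to H bound the squared distance from below by a sum of 16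
squares, whatever H is; the variance enters by scaling. -/
lemma lintegral_inv_dist_sq_le {ι : Type*} [Fintype ι] (H : Submodule ℝ (EuclideanSpace ℝ ι))
    (hH : Module.finrank ℝ H + 16 ≤ Fintype.card ι) {v : ℝ≥0} (hv : v ≠ 0) :
    ∫⁻ u, (⨅ h : H, ENNReal.ofReal (‖WithLp.toLp 2 u - (h : EuclideanSpace ℝ ι)‖ ^ 2))⁻¹ ^ 4
      ∂(Measure.pi fun _ : ι => gaussianReal 0 v) ≤ (v : ℝ≥0∞)⁻¹ ^ 4 * invMomentBound := by
  obtain ⟨q, hq, hqH⟩ := exists_orthonormal_orthogonal H (k := 16) (by simpa using hH)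
  have h1 : ∀ u : ι → ℝ,
      (⨅ h : H, ENNReal.ofReal (‖WithLp.toLp 2 u - (h : EuclideanSpace ℝ ι)‖ ^ 2))⁻¹ ^ 4
        ≤ (ENNReal.ofReal (∑ l, ⟪q l, WithLp.toLp 2 u⟫ ^ 2))⁻¹ ^ 4 := by
    intro u
    gcongr
    exact le_iInf fun h => ENNReal.ofReal_le_ofReal
      (sum_inner_sq_le_norm_sub_sq hq (fun l => hqH l h h.2) _)
  refine (lintegral_mono h1).trans ?_
  rw [← map_mul_pi_gaussianReal, lintegral_map (by fun_prop) (by fun_prop)]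
  have h2 : ∀ u : ι → ℝ,
      (ENNReal.ofReal (∑ l, ⟪q l, WithLp.toLp 2 fun i => √v * u i⟫ ^ 2))⁻¹ ^ 4
        = (v : ℝ≥0∞)⁻¹ ^ 4 * (ENNReal.ofReal (∑ l, ⟪q l, WithLp.toLp 2 u⟫ ^ 2))⁻¹ ^ 4 := by
    intro u
    have e1 : (WithLp.toLp 2 fun i => √v * u i : EuclideanSpace ℝ ι)
        = √(v : ℝ) • WithLp.toLp 2 u := by ext i; simp
    have e2 : ∑ l, ⟪q l, √(v : ℝ) • WithLp.toLp 2 u⟫ ^ 2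
        = v * ∑ l, ⟪q l, WithLp.toLp 2 u⟫ ^ 2 := by
      rw [Finset.mul_sum]
      refine Finset.sum_congr rfl fun l _ => ?_
      rw [real_inner_smul_right, mul_pow, Real.sq_sqrt (NNReal.coe_nonneg v)]
    rw [e1, e2, ENNReal.ofReal_mul (NNReal.coe_nonneg v), ENNReal.ofReal_coe_nnreal,
      ENNReal.mul_inv (Or.inl (by simpa using hv)) (Or.inl ENNReal.coe_ne_top), mul_pow]
  simp only [h2]
  rw [lintegral_const_mul _ (by fun_prop)]
  gcongr
  have h3 := lintegral_inv_sum_inner_sq_le hq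
  rwa [← map_pi_eq_stdGaussian, lintegral_map (by fun_prop) (by fun_prop)] at h3

/-- The squared distance of column `j` to the span of the other columns. -/
noncomputable def colDistSq {m n : ℕ} (A : Matrix (Fin m) (Fin n) ℝ) (j : Fin n) : ℝ≥0∞ :=
  ⨅ c : Fin n → ℝ, ENNReal.ofReal (∑ i, (A.mulVec (Function.update c j 1) i) ^ 2)

/-- The infimum is over an uncountable family, but an infimum of continuous functions is upper
semicontinuous. -/
lemma measurable_colDistSq {m n : ℕ} (j : Fin n) :
    Measurable fun x : Fin m × Fin n → ℝ => colDistSq (Matrix.of fun i k => x (i, k)) j := by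
  refine (upperSemicontinuous_iInf fun c => Continuous.upperSemicontinuous ?_).measurable
  refine ENNReal.continuous_ofReal.comp ?_
  simp only [Matrix.mulVec, dotProduct, Matrix.of_apply]
  fun_prop

/-- Integrating first over column j with the other entries frozen makes the span a fixed subspace,
and the resulting bound does not depend on the frozen entries. -/
lemma lintegral_inv_colDistSq_le {m n : ℕ} (hmn : n + 16 ≤ m) (j : Fin n) {v : ℝ≥0}
    (hv : v ≠ 0) :
    ∫⁻ x : Fin m × Fin n → ℝ, (colDistSq (Matrix.of fun i k => x (i, k)) j)⁻¹ ^ 4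
      ∂(Measure.pi fun _ => gaussianReal 0 v) ≤ (v : ℝ≥0∞)⁻¹ ^ 4 * invMomentBound := by
  classical
  set s : Finset (Fin m × Fin n) := Finset.univ.image fun i => (i, j) with hs
  have hinj : Function.Injective fun i : Fin m => (i, j) := fun i i' h => by simpa using h
  have hcard : Fintype.card s = m := by
    rw [Fintype.card_coe, hs, Finset.card_image_of_injective _ hinj]; simp
  have hmem : ∀ t : s, (t : Fin m × Fin n).2 = j := by
    rintro ⟨t, ht⟩
    obtain ⟨i, -, rfl⟩ := Finset.mem_image.1 ht
    rfl
  have key : ∫⁻ x : Fin m × Fin n → ℝ, (colDistSq (Matrix.of fun i k => x (i, k)) j)⁻¹ ^ 4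
      ∂(Measure.pi fun _ => gaussianReal 0 v)
      ≤ ∫⁻ _ : Fin m × Fin n → ℝ, (v : ℝ≥0∞)⁻¹ ^ 4 * invMomentBound
        ∂(Measure.pi fun _ => gaussianReal 0 v) := by
    refine lintegral_le_of_lmarginal_le s (((measurable_colDistSq j).inv).pow_const 4)
      measurable_const fun x => ?_
    simp only [lmarginal, lintegral_const, measure_univ, mul_one]
    -- The frozen value of column j is left in the family: it only enlarges the span, whose
    -- dimension is still at most n.
    set col : Fin n → EuclideanSpace ℝ s := fun k => WithLp.toLp 2 fun t => x (t.1.1, k) with hcol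
    set H := Submodule.span ℝ (Set.range col) with hH
    have hdim : Module.finrank ℝ H + 16 ≤ Fintype.card s := by
      have := finrank_range_le_card (R := ℝ) col
      rw [Set.finrank, ← hH, Fintype.card_fin] at this
      omega
    refine le_trans (lintegral_mono fun y => ?_) (lintegral_inv_dist_sq_le H hdim hv)
    gcongr
    refine le_iInf fun c => ?_
    have hh : -(∑ k ∈ Finset.univ.erase j, c k • col k) ∈ H :=
      H.neg_mem (H.sum_mem fun k _ => H.smul_mem _ (Submodule.subset_span ⟨k, rfl⟩))
    refine (iInf_le _ ⟨_, hh⟩).trans (ENNReal.ofReal_le_ofReal (le_of_eq ?_))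
    set X := Function.updateFinset x s y with hX
    set A : Matrix (Fin m) (Fin n) ℝ := Matrix.of fun i k => X (i, k) with hA
    have h1 : ∑ i, (A.mulVec (Function.update c j 1) i) ^ 2
        = ∑ t : s, (A.mulVec (Function.update c j 1) t.1.1) ^ 2 := by
      rw [Finset.sum_coe_sort s (fun t => (A.mulVec (Function.update c j 1) t.1) ^ 2), hs,
        Finset.sum_image fun i _ i' _ h => hinj h]
    rw [h1, EuclideanSpace.real_norm_sq_eq]
    refine Finset.sum_congr rfl fun t _ => ?_
    congr 1
    have h2 : X (t.1.1, j) = y t := by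
      have : (t.1.1, j) = t.1 := by rw [← hmem t]
      rw [this, hX, Function.updateFinset, dif_pos t.2]
    have h3 : ∀ k ∈ Finset.univ.erase j, X (t.1.1, k) = x (t.1.1, k) := by
      intro k hk
      rw [hX, Function.updateFinset, dif_neg]
      intro hmem'
      exact Finset.ne_of_mem_erase hk (hmem ⟨_, hmem'⟩)
    simp only [Matrix.mulVec, dotProduct, hA, Matrix.of_apply]
    rw [← Finset.add_sum_erase _ _ (Finset.mem_univ j), h2]
    simp only [Function.update_self, mul_one, WithLp.ofLp_sum, sub_neg_eq_add,
      Finset.sum_apply, PiLp.add_apply]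
    congr 1
    refine Finset.sum_congr rfl fun k hk => ?_
    rw [h3 k hk, Function.update_of_ne (Finset.ne_of_mem_erase hk)]
    simp [hcol, mul_comm]
  simpa using key

end InverseMoment

/-! ### Measurability of matrix operations and of the response. -/

section MatrixMeasurability

variable {X : Type*} [MeasurableSpace X]

lemma measurable_matrix_mul {l m n : Type*} [Fintype m] {M : X → Matrix l m ℝ} {N : X → Matrix m n ℝ}
    (hM : ∀ i j, Measurable fun x => M x i j) (hN : ∀ i j, Measurable fun x => N x i j)
    (i : l) (j : n) : Measurable fun x => (M x * N x) i j := by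
  simp only [Matrix.mul_apply]
  exact Finset.measurable_sum _ fun k _ => (hM i k).mul (hN k j)

lemma measurable_matrix_det {n : Type*} [Fintype n] [DecidableEq n] {M : X → Matrix n n ℝ}
    (hM : ∀ i j, Measurable fun x => M x i j) :
    Measurable fun x => (M x).det := by
  simp only [Matrix.det_apply]
  exact Finset.measurable_sum _ fun σ _ =>
    (Finset.measurable_prod _ fun i _ => hM (σ i) i).const_smul _

lemma measurable_matrix_inv {n : Type*} [Fintype n] [DecidableEq n] {M : X → Matrix n n ℝ}
    (hM : ∀ i j, Measurable fun x => M x i j)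
    (i j : n) : Measurable fun x => (M x)⁻¹ i j := by
  simp only [Matrix.inv_def, Matrix.smul_apply, Ring.inverse_eq_inv', Matrix.adjugate_apply,
    smul_eq_mul]
  refine (measurable_matrix_det hM).inv.mul (measurable_matrix_det fun i' j' => ?_)
  simp only [Matrix.updateRow_apply]
  split_ifs
  · exact measurable_const
  · exact hM i' j'

end MatrixMeasurability

section Measurability

variable {X : Type*} [MeasurableSpace X] {P m n : ℕ}

lemma measurable_leftInv {M : X → Matrix (Fin m) (Fin n) ℝ}
    (hM : ∀ i j, Measurable fun x => M x i j) (i : Fin n) (j : Fin m) :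
    Measurable fun x => leftInv (M x) i j :=
  measurable_matrix_mul
    (measurable_matrix_inv (measurable_matrix_mul (fun i j => hM j i) hM)) (fun i j => hM j i) i j

lemma measurable_response {M : X → Fin P → Matrix (Fin m) (Fin n) ℝ}
    (hM : ∀ μ i j, Measurable fun x => M x μ i j) (k : Fin (P + 1)) (ν : Fin P) (i : Fin n)
    (j : Fin m) : Measurable fun x => response (M x) k ν i j := by
  induction k using Fin.induction generalizing i j with
  | zero => simp
  | succ μ ih =>
    simp only [response_succ, Matrix.add_apply]
    refine (ih i j).add (measurable_matrix_mul (fun i j => ?_) (measurable_leftInv (hM μ)) i j)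
    exact measurable_const.sub (measurable_matrix_mul ih (hM μ) i j)

lemma measurable_residual {M : X → Fin P → Matrix (Fin m) (Fin n) ℝ}
    (hM : ∀ μ i j, Measurable fun x => M x μ i j) (ν μ : Fin P) (i j : Fin n) :
    Measurable fun x => residual (M x) ν μ i j :=
  measurable_const.sub (measurable_matrix_mul (measurable_response hM _ ν) (hM μ) i j)

lemma measurable_sqSum {M : X → Matrix (Fin m) (Fin n) ℝ}
    (hM : ∀ i j, Measurable fun x => M x i j) : Measurable fun x => sqSum (M x) := by
  unfold sqSum
  fun_prop

end Measurability

/-! ### The inverse Gram matrix in terms of column distances. -/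

section Gram

variable {m n : ℕ}

lemma dotProduct_gram_mulVec (A : Matrix (Fin m) (Fin n) ℝ) (z : Fin n → ℝ) :
    dotProduct z ((A.transpose * A).mulVec z) = ∑ i, (A.mulVec z i) ^ 2 := by
  rw [← Matrix.mulVec_mulVec, Matrix.dotProduct_mulVec, Matrix.vecMul_transpose, dotProduct]
  simp only [sq]

/-- A kernel vector of the Gram matrix, normalized to 1 at a nonzero coordinate j, puts column j in
the span of the others. -/
lemma isUnit_det_gram {A : Matrix (Fin m) (Fin n) ℝ} (h : ∀ j, colDistSq A j ≠ 0) :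
    IsUnit (A.transpose * A).det := by
  rw [isUnit_iff_ne_zero]
  intro h0
  obtain ⟨z, hz, hKz⟩ := Matrix.exists_mulVec_eq_zero_iff.2 h0
  have hS : ∑ i, (A.mulVec z i) ^ 2 = 0 := by
    rw [← dotProduct_gram_mulVec, hKz, dotProduct_zero]
  obtain ⟨j, hj⟩ := Function.ne_iff.1 hz
  refine h j (le_antisymm ((iInf_le _ ((z j)⁻¹ • z)).trans ?_) zero_le)
  have hu : Function.update ((z j)⁻¹ • z) j 1 = (z j)⁻¹ • z := by
    rw [Function.update_eq_self_iff]
    simp [inv_mul_cancel₀ hj]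
  rw [hu, Matrix.mulVec_smul]
  simp [mul_pow, ← Finset.mul_sum, hS]

/-- For z the jth column of the inverse Gram matrix, ‖Az‖² = z_j; so z/z_j competes in the infimum
with value 1/z_j. -/
lemma ofReal_inv_gram_le {A : Matrix (Fin m) (Fin n) ℝ} (hA : IsUnit (A.transpose * A).det)
    (j : Fin n) : ENNReal.ofReal ((A.transpose * A)⁻¹ j j) ≤ (colDistSq A j)⁻¹ := by
  set K := A.transpose * A with hK
  set z : Fin n → ℝ := K⁻¹.mulVec (Pi.single j 1) with hz
  have hzj : K⁻¹ j j = z j := by simp [hz]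
  have hKz : K.mulVec z = Pi.single j 1 := by
    rw [hz, Matrix.mulVec_mulVec, Matrix.mul_nonsing_inv _ hA, Matrix.one_mulVec]
  have hS : ∑ i, (A.mulVec z i) ^ 2 = z j := by
    rw [← dotProduct_gram_mulVec, hKz]
    simp
  rw [hzj]
  rcases le_or_gt (z j) 0 with h0 | h0
  · rw [ENNReal.ofReal_of_nonpos h0]; exact zero_le
  rw [ENNReal.le_inv_iff_le_inv, ← ENNReal.ofReal_inv_of_pos h0]
  refine (iInf_le _ ((z j)⁻¹ • z)).trans (ENNReal.ofReal_le_ofReal (le_of_eq ?_))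
  have hu : Function.update ((z j)⁻¹ • z) j 1 = (z j)⁻¹ • z := by
    rw [Function.update_eq_self_iff]
    simp [inv_mul_cancel₀ h0.ne']
  rw [hu, Matrix.mulVec_smul]
  simp only [Pi.smul_apply, smul_eq_mul, mul_pow, ← Finset.mul_sum, hS]
  field_simp

lemma sqSum_leftInv {A : Matrix (Fin m) (Fin n) ℝ} (hA : IsUnit (A.transpose * A).det) :
    sqSum (leftInv A) = ∑ j, (A.transpose * A)⁻¹ j j := by
  rw [sqSum_eq_trace, leftInv, Matrix.transpose_mul, Matrix.transpose_transpose,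
    Matrix.mul_assoc, ← Matrix.mul_assoc A.transpose, ← Matrix.mul_assoc,
    Matrix.nonsing_inv_mul _ hA, Matrix.one_mul, Matrix.trace_transpose]
  rfl

end Gram

/-! ### Fourth moments of ‖A‖² and ‖A⁺‖² for a Gaussian matrix. -/

section GaussianMatrix

open scoped NNReal ENNReal

variable {m n : ℕ}

lemma sum_pow_four_le {ι : Type*} [Fintype ι] {f : ι → ℝ} (hf : ∀ i, 0 ≤ f i) :
    (∑ i, f i) ^ 4 ≤ (Fintype.card ι : ℝ) ^ 3 * ∑ i, f i ^ 4 := by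
  rcases isEmpty_or_nonempty ι with h | h
  · simp
  have h1 := pow_sum_div_card_le_sum_pow (s := Finset.univ) (fun i _ => hf i) 3
  have h2 : (0 : ℝ) < (Fintype.card ι : ℝ) ^ 3 := by positivity
  rwa [Finset.card_univ, div_le_iff₀ h2, mul_comm] at h1

/-- A finite inverse moment forces the distance to be nonzero almost surely, so full column rank
comes without a separate argument. -/
lemma ae_colDistSq_ne_zero (hmn : n + 16 ≤ m) {v : ℝ≥0} (hv : v ≠ 0) :
    ∀ᵐ x ∂(Measure.pi fun _ : Fin m × Fin n => gaussianReal 0 v),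
      ∀ j, colDistSq (Matrix.of fun i k => x (i, k)) j ≠ 0 := by
  rw [ae_all_iff]
  intro j
  have h1 : ∫⁻ x : Fin m × Fin n → ℝ, (colDistSq (Matrix.of fun i k => x (i, k)) j)⁻¹ ^ 4
      ∂(Measure.pi fun _ => gaussianReal 0 v) ≠ ∞ :=
    ((lintegral_inv_colDistSq_le hmn j hv).trans_lt (ENNReal.mul_lt_top
      (ENNReal.pow_lt_top (by simpa [pos_iff_ne_zero] using hv)) invMomentBound_lt_top)).ne
  filter_upwards [ae_lt_top (((measurable_colDistSq j).inv).pow_const 4) h1] with x hx h0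
  simp [h0] at hx

lemma ae_isUnit_det_gram (hmn : n + 16 ≤ m) {v : ℝ≥0} (hv : v ≠ 0) :
    ∀ᵐ x ∂(Measure.pi fun _ : Fin m × Fin n => gaussianReal 0 v),
      IsUnit ((Matrix.of fun i k => x (i, k) : Matrix (Fin m) (Fin n) ℝ).transpose *
        Matrix.of fun i k => x (i, k)).det := by
  filter_upwards [ae_colDistSq_ne_zero hmn hv] with x hx using isUnit_det_gram hx

/-- ‖A⁺‖² is the trace of the inverse Gram matrix; the power-mean inequality costs n³, and the n
diagonal entries give the last factor n. -/
lemma lintegral_sqSum_leftInv_pow_le (hmn : n + 16 ≤ m) {v : ℝ≥0} (hv : v ≠ 0) :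
    ∫⁻ x, ENNReal.ofReal
        (sqSum (leftInv (Matrix.of fun i k => x (i, k) : Matrix (Fin m) (Fin n) ℝ)) ^ 4)
      ∂(Measure.pi fun _ : Fin m × Fin n => gaussianReal 0 v)
      ≤ (n : ℝ≥0∞) ^ 4 * ((v : ℝ≥0∞)⁻¹ ^ 4 * invMomentBound) := by
  calc _ ≤ ∫⁻ x, (n : ℝ≥0∞) ^ 3 *
        ∑ j, (colDistSq (Matrix.of fun i k => x (i, k) : Matrix (Fin m) (Fin n) ℝ) j)⁻¹ ^ 4
        ∂(Measure.pi fun _ : Fin m × Fin n => gaussianReal 0 v) := by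
        refine lintegral_mono_ae ?_
        filter_upwards [ae_isUnit_det_gram hmn hv] with x hx
        set A : Matrix (Fin m) (Fin n) ℝ := Matrix.of fun i k => x (i, k) with hA
        have hnn : ∀ j, 0 ≤ (A.transpose * A)⁻¹ j j := fun j =>
          ((Matrix.posSemidef_conjTranspose_mul_self A).inv).diag_nonneg
        rw [sqSum_leftInv hx]
        refine (ENNReal.ofReal_le_ofReal (sum_pow_four_le hnn)).trans ?_
        rw [Fintype.card_fin, ENNReal.ofReal_mul (by positivity),
          ENNReal.ofReal_pow (by positivity), ENNReal.ofReal_natCast,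
          ENNReal.ofReal_sum_of_nonneg fun j _ => pow_nonneg (hnn j) 4]
        gcongr with j
        rw [ENNReal.ofReal_pow (hnn j)]
        gcongr
        exact ofReal_inv_gram_le hx j
    _ = (n : ℝ≥0∞) ^ 3 * ∑ j, ∫⁻ x,
        (colDistSq (Matrix.of fun i k => x (i, k) : Matrix (Fin m) (Fin n) ℝ) j)⁻¹ ^ 4
        ∂(Measure.pi fun _ : Fin m × Fin n => gaussianReal 0 v) := by
        rw [lintegral_const_mul, lintegral_finsetSum]
        · exact fun j _ => ((measurable_colDistSq j).inv).pow_const 4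
        · exact Finset.measurable_sum _ fun j _ => ((measurable_colDistSq j).inv).pow_const 4
    _ ≤ (n : ℝ≥0∞) ^ 3 * ∑ _j : Fin n, (v : ℝ≥0∞)⁻¹ ^ 4 * invMomentBound := by
        gcongr with j
        exact lintegral_inv_colDistSq_le hmn j hv
    _ = _ := by simp; ring

/-- The eighth moment of the standard Gaussian law. -/
noncomputable def eighthMoment : ℝ≥0∞ := ∫⁻ x, ENNReal.ofReal (x ^ 8) ∂(gaussianReal 0 1)

lemma eighthMoment_lt_top : eighthMoment < ∞ := by
  have h := ((memLp_id_gaussianReal (μ := 0) (v := 1) 8).integrable_norm_pow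
    (by norm_num)).hasFiniteIntegral
  rw [hasFiniteIntegral_iff_ofReal (ae_of_all _ fun x => by positivity)] at h
  refine lt_of_eq_of_lt (lintegral_congr fun x => ?_) h
  simp [Even.pow_abs (show Even 8 by decide)]

lemma lintegral_pow_eight_gaussianReal (v : ℝ≥0) :
    ∫⁻ x, ENNReal.ofReal (x ^ 8) ∂(gaussianReal 0 v) = (v : ℝ≥0∞) ^ 4 * eighthMoment := by
  have h1 : gaussianReal 0 v = (gaussianReal 0 1).map (√(v : ℝ) * ·) := by
    rw [gaussianReal_map_const_mul]
    congr 1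
    · simp
    · ext; simp
  rw [h1, lintegral_map (by fun_prop) (by fun_prop), eighthMoment,
    ← lintegral_const_mul _ (by fun_prop)]
  refine lintegral_congr fun x => ?_
  have h2 : (√(v : ℝ) * x) ^ 8 = (v : ℝ) ^ 4 * x ^ 8 := by
    rw [mul_pow, show √(v : ℝ) ^ 8 = (√(v : ℝ) ^ 2) ^ 4 by ring,
      Real.sq_sqrt (NNReal.coe_nonneg v)]
  rw [h2, ENNReal.ofReal_mul (by positivity), ENNReal.ofReal_pow (by positivity),
    ENNReal.ofReal_coe_nnreal]

lemma lintegral_sqSum_pow_le (v : ℝ≥0) :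
    ∫⁻ x, ENNReal.ofReal (sqSum (Matrix.of fun i k => x (i, k) : Matrix (Fin m) (Fin n) ℝ) ^ 4)
      ∂(Measure.pi fun _ : Fin m × Fin n => gaussianReal 0 v)
      ≤ (m * n : ℝ≥0∞) ^ 4 * ((v : ℝ≥0∞) ^ 4 * eighthMoment) := by
  have h1 : ∀ x : Fin m × Fin n → ℝ,
      sqSum (Matrix.of fun i k => x (i, k) : Matrix (Fin m) (Fin n) ℝ) ^ 4
        ≤ (m * n : ℝ) ^ 3 * ∑ ij, x ij ^ 8 := by
    intro x
    have h2 := sum_pow_four_le (f := fun ij => x ij ^ 2) fun _ => sq_nonneg _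
    simp only [← pow_mul, Fintype.card_prod, Fintype.card_fin, Nat.cast_mul] at h2
    rwa [Fintype.sum_prod_type] at h2
  calc _ ≤ ∫⁻ x, (m * n : ℝ≥0∞) ^ 3 * ∑ ij, ENNReal.ofReal (x ij ^ 8)
        ∂(Measure.pi fun _ : Fin m × Fin n => gaussianReal 0 v) := by
        refine lintegral_mono fun x => (ENNReal.ofReal_le_ofReal (h1 x)).trans (le_of_eq ?_)
        rw [ENNReal.ofReal_mul (by positivity), ENNReal.ofReal_pow (by positivity),
          ENNReal.ofReal_mul (by positivity), ENNReal.ofReal_natCast, ENNReal.ofReal_natCast,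
          ENNReal.ofReal_sum_of_nonneg fun _ _ => by positivity]
    _ = (m * n : ℝ≥0∞) ^ 3 * ∑ ij, ∫⁻ x, ENNReal.ofReal (x ij ^ 8)
        ∂(Measure.pi fun _ : Fin m × Fin n => gaussianReal 0 v) := by
        rw [lintegral_const_mul _ (by fun_prop), lintegral_finsetSum _ (by fun_prop)]
    _ = (m * n : ℝ≥0∞) ^ 3 * ∑ _ij : Fin m × Fin n, (v : ℝ≥0∞) ^ 4 * eighthMoment := by
        congr 1
        refine Finset.sum_congr rfl fun ij _ => ?_
        rw [← lintegral_pow_eight_gaussianReal]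
        exact (measurePreserving_eval (fun _ : Fin m × Fin n => gaussianReal 0 v)
          ij).lintegral_comp (f := fun y => ENNReal.ofReal (y ^ 8)) (by fun_prop)
    _ = _ := by simp; ring

end GaussianMatrix

/-! ### The same moments for the correlated mixing matrices, one task at a time. -/

section Moments

open scoped NNReal ENNReal

variable {P m n : ℕ} {C : Matrix (Fin P) (Fin P) ℝ}

lemma measurePreserving_component (hC : IsCorrelationMatrix C) (ν : Fin P) :
    MeasurePreserving
      (fun (a : Fin m × Fin n → EuclideanSpace ℝ (Fin P)) (ij : Fin m × Fin n) => a ij ν)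
      (mixMeasure C m n) (Measure.pi fun _ => gaussianReal 0 (1 / (n : ℝ)).toNNReal) := by
  refine measurePreserving_pi (fun _ => multivariateGaussian 0 ((1 / (n : ℝ)) • C))
    (fun _ => gaussianReal 0 (1 / (n : ℝ)).toNNReal) (f := fun _ x => x ν) fun ij => ?_
  have h := measurePreserving_eval_multivariateGaussian (μ := 0)
    (posSemidef_scale hC.posSemidef n) (i := ν)
  simpa [hC.diag ν] using h

lemma measurable_mixMatrix_apply (μ : Fin P) (i : Fin m) (j : Fin n) :
    Measurable fun a : Fin m × Fin n → EuclideanSpace ℝ (Fin P) => mixMatrix a μ i j := by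
  simp only [mixMatrix_apply]
  fun_prop

lemma toNNReal_one_div_ne_zero (hn : 0 < n) : (1 / (n : ℝ)).toNNReal ≠ 0 := by
  rw [Ne, Real.toNNReal_eq_zero, not_le]
  positivity

lemma ae_isUnit_det_mixMatrix (hC : IsCorrelationMatrix C) (hmn : n + 16 ≤ m) (hn : 0 < n) :
    ∀ᵐ a ∂(mixMeasure C m n), ∀ μ,
      IsUnit ((mixMatrix a μ).transpose * mixMatrix a μ).det := by
  rw [ae_all_iff]
  exact fun μ => (measurePreserving_component hC μ).quasiMeasurePreserving.ae
    (ae_isUnit_det_gram hmn (toNNReal_one_div_ne_zero hn))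

lemma integrable_and_integral_le_of_lintegral_le {X : Type*} [MeasurableSpace X] {μ : Measure X}
    {f : X → ℝ} (hf : Measurable f) (h0 : ∀ x, 0 ≤ f x) {c : ℝ≥0∞} (hc : c < ∞)
    (h : ∫⁻ x, ENNReal.ofReal (f x) ∂μ ≤ c) : Integrable f μ ∧ ∫ x, f x ∂μ ≤ c.toReal := by
  refine ⟨⟨hf.aestronglyMeasurable, ?_⟩, ?_⟩
  · rw [hasFiniteIntegral_iff_ofReal (ae_of_all _ h0)]
    exact h.trans_lt hc
  · rw [integral_eq_lintegral_of_nonneg_ae (ae_of_all _ h0) hf.aestronglyMeasurable]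
    exact ENNReal.toReal_mono hc.ne h

lemma sqSum_leftInv_mixMatrix_moment (hC : IsCorrelationMatrix C) (hmn : n + 16 ≤ m) (hn : 0 < n)
    (ν : Fin P) :
    Integrable (fun a => sqSum (leftInv (mixMatrix a ν)) ^ 4) (mixMeasure C m n) ∧
      ∫ a, sqSum (leftInv (mixMatrix a ν)) ^ 4 ∂(mixMeasure C m n)
        ≤ invMomentBound.toReal * (m : ℝ) ^ 8 := by
  have hmeas : Measurable fun x : Fin m × Fin n → ℝ =>
      sqSum (leftInv (Matrix.of fun i k => x (i, k) : Matrix (Fin m) (Fin n) ℝ)) ^ 4 :=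
    (measurable_sqSum (measurable_leftInv fun i j => by
      simp only [Matrix.of_apply]; fun_prop)).pow_const 4
  have h1 := lintegral_sqSum_leftInv_pow_le hmn (toNNReal_one_div_ne_zero hn)
  rw [← (measurePreserving_component hC ν).lintegral_comp hmeas.ennreal_ofReal] at h1
  have hv : (((1 / (n : ℝ)).toNNReal : ℝ≥0) : ℝ≥0∞)⁻¹ = n := by
    change (ENNReal.ofReal (1 / (n : ℝ)))⁻¹ = n
    rw [one_div, ENNReal.ofReal_inv_of_pos (by positivity), inv_inv, ENNReal.ofReal_natCast]
  rw [hv] at h1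
  obtain ⟨h2, h3⟩ := integrable_and_integral_le_of_lintegral_le
    (hmeas.comp (measurePreserving_component hC ν).measurable)
    (fun a => pow_nonneg (sqSum_nonneg _) 4) (ENNReal.mul_lt_top (by simp)
      (ENNReal.mul_lt_top (by simp) invMomentBound_lt_top)) h1
  refine ⟨h2, h3.trans ?_⟩
  have hle : (n : ℝ) ≤ m := by exact_mod_cast by omega
  simp only [ENNReal.toReal_mul, ENNReal.toReal_pow, ENNReal.toReal_natCast]
  calc (n : ℝ) ^ 4 * ((n : ℝ) ^ 4 * invMomentBound.toReal)
      = invMomentBound.toReal * (n : ℝ) ^ 8 := by ring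
    _ ≤ _ := by gcongr

lemma sqSum_mixMatrix_moment (hC : IsCorrelationMatrix C) (hmn : n ≤ m) (hn : 0 < n)
    (μ : Fin P) :
    Integrable (fun a => sqSum (mixMatrix a μ) ^ 4) (mixMeasure C m n) ∧
      ∫ a, sqSum (mixMatrix a μ) ^ 4 ∂(mixMeasure C m n)
        ≤ eighthMoment.toReal * (m : ℝ) ^ 8 := by
  have hmeas : Measurable fun x : Fin m × Fin n → ℝ =>
      sqSum (Matrix.of fun i k => x (i, k) : Matrix (Fin m) (Fin n) ℝ) ^ 4 :=
    (measurable_sqSum fun i j => by simp only [Matrix.of_apply]; fun_prop).pow_const 4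
  have h1 := lintegral_sqSum_pow_le (m := m) (n := n) (1 / (n : ℝ)).toNNReal
  rw [← (measurePreserving_component hC μ).lintegral_comp hmeas.ennreal_ofReal] at h1
  obtain ⟨h2, h3⟩ := integrable_and_integral_le_of_lintegral_le
    (hmeas.comp (measurePreserving_component hC μ).measurable)
    (fun a => pow_nonneg (sqSum_nonneg _) 4) (ENNReal.mul_lt_top (by simp [ENNReal.mul_lt_top])
      (ENNReal.mul_lt_top (by simp) eighthMoment_lt_top)) h1
  refine ⟨h2, h3.trans ?_⟩
  have hle : (n : ℝ) ≤ m := by exact_mod_cast hmn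
  have hm0 : (0 : ℝ) < n := by exact_mod_cast hn
  simp only [ENNReal.toReal_mul, ENNReal.toReal_pow, ENNReal.toReal_natCast, ENNReal.coe_toReal,
    Real.coe_toNNReal _ (show (0 : ℝ) ≤ 1 / n by positivity)]
  calc ((m : ℝ) * n) ^ 4 * ((1 / (n : ℝ)) ^ 4 * eighthMoment.toReal)
      = eighthMoment.toReal * (m : ℝ) ^ 4 := by field_simp
    _ ≤ _ := by
      gcongr
      · exact_mod_cast (by omega : 1 ≤ m)
      · norm_num

end Moments

/-! ### The averaged error in expectation over the inputs. -/

section MeanErrorIntegral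

variable {P m n : ℕ} {Cin Cout : Matrix (Fin P) (Fin P) ℝ}

/-- The weight η makes the fourth moments negligible, and its cost 1/(2η) is later paid by the small
probability of the bad event. -/
lemma mul_le_of_pos {p q η : ℝ} (hη : 0 < η) :
    p * q ≤ η * (p ^ 4 + q ^ 4) / 4 + 1 / (2 * η) := by
  have h1 : ∀ x : ℝ, x ^ 2 ≤ η * x ^ 4 / 2 + 1 / (2 * η) := by
    intro x
    have h2 : η * x ^ 4 / 2 + 1 / (2 * η) - x ^ 2 = (η * x ^ 2 - 1) ^ 2 / (2 * η) := by
      field_simp; ring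
    have h3 : 0 ≤ (η * x ^ 2 - 1) ^ 2 / (2 * η) := by positivity
    linarith
  have := h1 p
  have := h1 q
  nlinarith [sq_nonneg (p - q)]

lemma memLp_residual (hC : IsCorrelationMatrix Cin) (hmn : n + 16 ≤ m) (hn : 0 < n)
    (ν μ : Fin P) (j k : Fin n) :
    MemLp (fun a => residual (mixMatrix a) ν μ j k) 2 (mixMeasure Cin m n) := by
  have hmeas := measurable_residual (fun μ i j => measurable_mixMatrix_apply (m := m) (n := n)
    (P := P) μ i j) ν μ j k
  rw [memLp_two_iff_integrable_sq hmeas.aestronglyMeasurable]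
  have hp := (sqSum_leftInv_mixMatrix_moment hC hmn hn ν).1
  have hq := (sqSum_mixMatrix_moment hC (by omega : n ≤ m) hn μ).1
  refine Integrable.mono'
    (g := fun a => 2 * (n + (P : ℝ) ^ 2 * (1 * (sqSum (leftInv (mixMatrix a ν)) ^ 4
      + sqSum (mixMatrix a μ) ^ 4) / 4 + 1 / (2 * 1)))) ?_ (hmeas.pow_const 2).aestronglyMeasurable
    ?_
  · exact ((integrable_const _).add (((((hp.add hq).const_mul 1).div_const 4).add
      (integrable_const _)).const_mul _)).const_mul 2
  · filter_upwards [ae_isUnit_det_mixMatrix hC hmn hn] with a ha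
    rw [Real.norm_of_nonneg (sq_nonneg _)]
    have h1 : residual (mixMatrix a) ν μ j k ^ 2 ≤ sqSum (residual (mixMatrix a) ν μ) := by
      unfold sqSum
      exact (Finset.single_le_sum (f := fun k => residual (mixMatrix a) ν μ j k ^ 2)
        (fun _ _ => sq_nonneg _) (Finset.mem_univ k)).trans
        (Finset.single_le_sum (f := fun j => ∑ k, residual (mixMatrix a) ν μ j k ^ 2)
        (fun _ _ => Finset.sum_nonneg fun _ _ => sq_nonneg _) (Finset.mem_univ j))
    refine h1.trans ((sqSum_residual_le ha ν μ).trans ?_)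
    gcongr
    exact mul_le_of_pos one_pos

lemma integrable_residual_mul (hC : IsCorrelationMatrix Cin) (hmn : n + 16 ≤ m) (hn : 0 < n)
    (ν ν' μ : Fin P) (j j' k : Fin n) :
    Integrable (fun a => residual (mixMatrix a) ν μ j k * residual (mixMatrix a) ν' μ j' k)
      (mixMeasure Cin m n) :=
  (memLp_residual hC hmn hn ν μ j k).integrable_mul (memLp_residual hC hmn hn ν' μ j' k)

lemma integrable_meanError (hC : IsCorrelationMatrix Cin) (Cout : Matrix (Fin P) (Fin P) ℝ)
    (hmn : n + 16 ≤ m) (hn : 0 < n) :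
    Integrable (fun a => meanError Cout (mixMatrix a)) (mixMeasure Cin m n) := by
  unfold meanError
  exact integrable_finsetSum _ fun μ _ => integrable_finsetSum _ fun ν _ =>
    integrable_finsetSum _ fun ν' _ => ((integrable_finsetSum _ fun j _ =>
      integrable_finsetSum _ fun k _ =>
        integrable_residual_mul hC hmn hn ν ν' μ j j k).const_mul _).const_mul _

lemma exists_abs_integral_meanError_sub_le (hCin : IsCorrelationMatrix Cin)
    (hCout : IsCorrelationMatrix Cout) {ε : ℝ} (hε : 0 < ε) :
    ∃ c > 0, ∃ K ≥ 0, ∀ m n : ℕ, n + 16 ≤ m → 0 < n → (n : ℝ) * Real.log 25 ≤ c * m →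
      |∫ a, meanError Cout (mixMatrix a) ∂(mixMeasure Cin m n) - limitError Cin Cout|
        ≤ ε + K * ((m : ℝ) ^ 8 * Real.exp (-(c * m)) + Real.exp (-(c * m))) := by
  obtain ⟨δ', hδ'0, hδ'⟩ := exists_meanError_close Cin Cout hCin.diag hCout.posSemidef hε
  obtain ⟨K, hK0, hK⟩ := exists_abs_meanError_le Cout (P := P)
  set δ := min δ' 8 with hδ
  have hδ0 : 0 < δ := lt_min hδ'0 (by norm_num)
  set L := limitError Cin Cout with hL
  -- Since 2048 = 4 · 512, the tail is exp(-4cm); one factor exp(cm) pays for 25^n, which leaves η³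
  -- with η = exp(-cm).
  set c := δ ^ 2 / 2048 with hc
  set M := invMomentBound.toReal + eighthMoment.toReal with hM
  have hM0 : 0 ≤ M := add_nonneg ENNReal.toReal_nonneg ENNReal.toReal_nonneg
  refine ⟨c, by positivity, K * P ^ 2 * M + (K + |L|) * (4 * P ^ 2) + K * P ^ 2 * (4 * P ^ 2),
    by positivity, fun m n hmn hn hlog => ?_⟩
  set ρ := mixMeasure Cin m n with hρ
  set η := Real.exp (-(c * m)) with hη
  have hη0 : 0 < η := Real.exp_pos _
  have hη1 : η ≤ 1 := Real.exp_le_one_iff.2 (by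
    have : 0 ≤ c * m := by positivity
    linarith)
  -- A measurable hull has the same measure, so measurability of the bad event need not be proved.
  set S := toMeasurable ρ (badSet Cin m n δ) with hS
  have hSm : MeasurableSet S := measurableSet_toMeasurable _ _
  have hb : ρ.real S ≤ 4 * P ^ 2 * (η * η * η) := by
    rw [hS, measureReal_def, measure_toMeasurable, ← measureReal_def]
    refine (measureReal_badSet_le hCin (by omega) hn hδ0 (min_le_right _ _)).trans ?_
    rw [mul_assoc]
    refine mul_le_mul_of_nonneg_left ?_ (by positivity)
    have h25 : (25 : ℝ) ^ n = Real.exp (n * Real.log 25) := by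
      rw [mul_comm, Real.exp_mul, Real.exp_log (by norm_num), Real.rpow_natCast]
    rw [h25, hη, ← Real.exp_add, ← Real.exp_add, ← Real.exp_add]
    refine Real.exp_le_exp.2 ?_
    have : (m : ℝ) * (δ ^ 2 / 512) = 4 * (c * m) := by rw [hc]; ring
    rw [this]; linarith
  set p : Fin P → (Fin m × Fin n → EuclideanSpace ℝ (Fin P)) → ℝ :=
    fun ν a => sqSum (leftInv (mixMatrix a ν)) with hp
  set q : Fin P → (Fin m × Fin n → EuclideanSpace ℝ (Fin P)) → ℝ :=
    fun μ a => sqSum (mixMatrix a μ) with hq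
  have hpi := fun ν => sqSum_leftInv_mixMatrix_moment hCin hmn hn ν
  have hqi := fun μ => sqSum_mixMatrix_moment hCin (by omega : n ≤ m) hn μ
  set D := K + |L| + K * P ^ 2 * (1 / (2 * η)) with hD
  -- Dominating function: ε on the good event, the crude bound with products split by η on S. The
  -- term 1/(2η) sits in D, and multiplied by the measure of S it leaves a factor of order η².
  set g : (Fin m × Fin n → EuclideanSpace ℝ (Fin P)) → ℝ := fun a =>
    ε + (K * ∑ ν, ∑ μ, η * (p ν a ^ 4 + q μ a ^ 4) / 4 + S.indicator (fun _ => D) a) with hg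
  have hpq : ∀ ν μ, Integrable (fun a => η * (p ν a ^ 4 + q μ a ^ 4) / 4) ρ := fun ν μ =>
    (((hpi ν).1.add (hqi μ).1).const_mul η).div_const 4
  have hsumi : Integrable (fun a => ∑ ν, ∑ μ, η * (p ν a ^ 4 + q μ a ^ 4) / 4) ρ :=
    integrable_finsetSum _ fun ν _ => integrable_finsetSum _ fun μ _ => hpq ν μ
  have hind : Integrable (S.indicator fun _ => D) ρ := (integrable_const D).indicator hSm
  have hgi : Integrable g ρ :=
    (integrable_const ε).add ((hsumi.const_mul K).add hind)
  have hdom : ∀ᵐ a ∂ρ, |meanError Cout (mixMatrix a) - L| ≤ g a := by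
    filter_upwards [ae_isUnit_det_mixMatrix hCin hmn hn] with a ha
    have hsum0 : 0 ≤ K * ∑ ν, ∑ μ, η * (p ν a ^ 4 + q μ a ^ 4) / 4 := by positivity
    by_cases haS : a ∈ S
    · have h1 := hK n m (mixMatrix a) hn ha
      have h2 : ∑ ν, ∑ μ, p ν a * q μ a
          ≤ ∑ ν, ∑ μ, η * (p ν a ^ 4 + q μ a ^ 4) / 4 + P ^ 2 * (1 / (2 * η)) := by
        calc ∑ ν, ∑ μ, p ν a * q μ a
            ≤ ∑ ν : Fin P, ∑ μ : Fin P,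
              (η * (p ν a ^ 4 + q μ a ^ 4) / 4 + 1 / (2 * η)) := by
              gcongr; exact mul_le_of_pos hη0
          _ = _ := by
              simp only [Finset.sum_add_distrib, Finset.sum_const, Finset.card_univ,
                Fintype.card_fin, nsmul_eq_mul]
              ring
      have h3 := abs_sub (meanError Cout (mixMatrix a)) L
      have h4 := mul_le_mul_of_nonneg_left h2 hK0
      simp only [hg, Set.indicator_of_mem haS, hD]
      simp only [hp, hq] at h1 h4 ⊢
      nlinarith
    · have hbad : a ∉ badSet Cin m n δ := fun h => haS (subset_toMeasurable _ _ h)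
      simp only [badSet, Set.mem_ofPred_eq, not_exists, not_lt] at hbad
      have h1 := hδ' n m _ (mixMatrix a) hn ha fun κ l => (hbad κ l).trans (min_le_left _ _)
      simp only [hg, Set.indicator_of_notMem haS]
      linarith
  have hmi := integrable_meanError hCin Cout hmn hn
  have h1 : |∫ a, meanError Cout (mixMatrix a) ∂ρ - L| ≤ ∫ a, g a ∂ρ := by
    have h2 : ∫ a, meanError Cout (mixMatrix a) ∂ρ - L
        = ∫ a, (meanError Cout (mixMatrix a) - L) ∂ρ := by
      rw [integral_sub hmi (integrable_const L), ← hρ]; simp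
    rw [h2]
    exact abs_integral_le_integral_abs.trans
      (integral_mono_ae (hmi.sub (integrable_const L)).abs hgi hdom)
  refine h1.trans ?_
  have hintegral : ∫ a, g a ∂ρ = ε + (K * ∑ ν, ∑ μ, η * (∫ a, p ν a ^ 4 ∂ρ + ∫ a, q μ a ^ 4 ∂ρ) / 4
      + ρ.real S * D) := by
    have i1 : ∫ a, g a ∂ρ = ∫ _, ε ∂ρ + ∫ a, (K * ∑ ν, ∑ μ, η * (p ν a ^ 4 + q μ a ^ 4) / 4
        + S.indicator (fun _ => D) a) ∂ρ :=
      integral_add (integrable_const ε) ((hsumi.const_mul K).add hind)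
    rw [i1, integral_add (hsumi.const_mul K) hind, integral_const_mul,
      integral_finsetSum _ fun ν _ => integrable_finsetSum _ fun μ _ => hpq ν μ,
      integral_indicator_const _ hSm]
    simp only [integral_const, probReal_univ, one_mul, smul_eq_mul]
    refine congrArg (fun t => ε + (K * t + ρ.real S * D)) (Finset.sum_congr rfl fun ν _ => ?_)
    rw [integral_finsetSum _ fun μ _ => hpq ν μ]
    refine Finset.sum_congr rfl fun μ _ => ?_
    rw [integral_div, integral_const_mul, integral_add (hpi ν).1 (hqi μ).1]
  rw [hintegral]
  have hA : ∑ ν, ∑ μ, η * (∫ a, p ν a ^ 4 ∂ρ + ∫ a, q μ a ^ 4 ∂ρ) / 4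
      ≤ P ^ 2 * M * (m ^ 8 * η) := by
    calc _ ≤ ∑ _ν : Fin P, ∑ _μ : Fin P, M * (m ^ 8 * η) := by
          gcongr with ν _ μ _
          have := (hpi ν).2
          have := (hqi μ).2
          have h5 : ∫ a, p ν a ^ 4 ∂ρ + ∫ a, q μ a ^ 4 ∂ρ ≤ M * m ^ 8 := by
            rw [hM, add_mul]; exact add_le_add (hpi ν).2 (hqi μ).2
          have h6 : 0 ≤ M * (m : ℝ) ^ 8 := by positivity
          have h7 : 0 ≤ η * (M * m ^ 8) := by positivity
          nlinarith
      _ = _ := by simp; ring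
  have hB : ρ.real S * D ≤ ((K + |L|) * (4 * P ^ 2) + K * P ^ 2 * (4 * P ^ 2)) * η := by
    have hD0 : 0 ≤ D := by positivity
    calc ρ.real S * D ≤ 4 * P ^ 2 * (η * η * η) * D := by gcongr
      _ = (4 * P ^ 2 * (K + |L|)) * (η * η) * η + K * P ^ 2 * (4 * P ^ 2) / 2 * η * η := by
          rw [hD]; field_simp
      _ ≤ (4 * P ^ 2 * (K + |L|)) * (1 * 1) * η + K * P ^ 2 * (4 * P ^ 2) * 1 * η := by
          gcongr
          have : 0 ≤ K * (P : ℝ) ^ 2 * (4 * P ^ 2) := by positivity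
          linarith
      _ = _ := by ring
  have hA' := mul_le_mul_of_nonneg_left hA hK0
  have e1 : 0 ≤ K * P ^ 2 * M * η := by positivity
  have e2 : 0 ≤ ((K + |L|) * (4 * P ^ 2) + K * P ^ 2 * (4 * P ^ 2)) * (m ^ 8 * η) := by positivity
  nlinarith

end MeanErrorIntegral

/-! ### Averaging over the target matrices. -/

section TargetAverage

variable {P m n l : ℕ} {C Cin Cout : Matrix (Fin P) (Fin P) ℝ}

lemma apply_eq_inner_single (x : EuclideanSpace ℝ (Fin P)) (ν : Fin P) :
    x ν = inner ℝ (EuclideanSpace.single ν (1 : ℝ)) x := by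
  simp [EuclideanSpace.inner_single_left]

lemma memLp_coord_mixMeasure (C : Matrix (Fin P) (Fin P) ℝ) (ij : Fin m × Fin n) (ν : Fin P) :
    MemLp (fun b : Fin m × Fin n → EuclideanSpace ℝ (Fin P) => b ij ν) 2 (mixMeasure C m n) := by
  simp only [apply_eq_inner_single]
  exact (hasGaussianLaw_inner_mixMeasure C _ ij).memLp_two

lemma integral_coord_mixMeasure (C : Matrix (Fin P) (Fin P) ℝ) (ij : Fin m × Fin n)
    (ν : Fin P) : ∫ b, b ij ν ∂(mixMeasure C m n) = 0 := by
  simp only [apply_eq_inner_single]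
  exact integral_inner_mixMeasure C _ ij

lemma integral_coord_mul_coord_mixMeasure (hC : C.PosSemidef) (ν ν' : Fin P) (i : Fin m)
    (j j' : Fin n) :
    ∫ b, b (i, j) ν * b (i, j') ν' ∂(mixMeasure C m n)
      = if j = j' then 1 / (n : ℝ) * C ν ν' else 0 := by
  have h1 := covariance_eq_sub (memLp_coord_mixMeasure C (i, j) ν)
    (memLp_coord_mixMeasure C (i, j') ν')
  rw [integral_coord_mixMeasure, zero_mul, sub_zero] at h1
  refine h1.symm.trans ?_
  split_ifs with h
  · subst h
    have h2 := (hasLaw_eval_mixMeasure C (i, j) (m := m)).covariance_fun_comp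
      (f := fun x => x ν) (g := fun x => x ν') (by fun_prop) (by fun_prop)
    rw [h2, covariance_eval_multivariateGaussian (posSemidef_scale hC n)]
    simp
  · refine IndepFun.covariance_eq_zero ?_ (memLp_coord_mixMeasure C (i, j) ν)
      (memLp_coord_mixMeasure C (i, j') ν')
    exact ((iIndepFun_eval_mixMeasure (m := m) C).indepFun (i := (i, j)) (j := (i, j'))
      (by simp [h])).comp (φ := fun x => x ν) (ψ := fun x => x ν') (by fun_prop) (by fun_prop)

/-- The final error, as a function of the entry vectors of the input and target matrices. -/
noncomputable def mixError (a : Fin m × Fin n → EuclideanSpace ℝ (Fin P))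
    (b : Fin l × Fin n → EuclideanSpace ℝ (Fin P)) : ℝ :=
  (1 / (l : ℝ)) * ∑ μ, ∑ i, ∑ k,
    (∑ ν, (mixMatrix b ν * residual (mixMatrix a) ν μ) i k) ^ 2

lemma mixError_eq_sum (a : Fin m × Fin n → EuclideanSpace ℝ (Fin P))
    (b : Fin l × Fin n → EuclideanSpace ℝ (Fin P)) :
    mixError a b = ∑ μ, ∑ i, ∑ k, ∑ x : Fin P × Fin n, ∑ y : Fin P × Fin n,
      (residual (mixMatrix a) x.1 μ x.2 k * residual (mixMatrix a) y.1 μ y.2 k)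
        * ((1 / (l : ℝ)) * (b (i, x.2) x.1 * b (i, y.2) y.1)) := by
  rw [mixError, Finset.mul_sum]
  refine Finset.sum_congr rfl fun μ _ => ?_
  rw [Finset.mul_sum]
  refine Finset.sum_congr rfl fun i _ => ?_
  rw [Finset.mul_sum]
  refine Finset.sum_congr rfl fun k _ => ?_
  simp only [Matrix.mul_apply, mixMatrix_apply]
  rw [← Fintype.sum_prod_type' (fun (ν : Fin P) (j : Fin n) =>
    b (i, j) ν * residual (mixMatrix a) ν μ j k), sq, Finset.sum_mul_sum, Finset.mul_sum]
  refine Finset.sum_congr rfl fun x _ => ?_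
  rw [Finset.mul_sum]
  exact Finset.sum_congr rfl fun y _ => by ring

lemma integrable_mixError_term (hCin : IsCorrelationMatrix Cin) (hmn : n + 16 ≤ m) (hn : 0 < n)
    (μ : Fin P) (i : Fin l) (k : Fin n) (x y : Fin P × Fin n) :
    Integrable (fun z : (Fin m × Fin n → EuclideanSpace ℝ (Fin P)) ×
        (Fin l × Fin n → EuclideanSpace ℝ (Fin P)) =>
      (residual (mixMatrix z.1) x.1 μ x.2 k * residual (mixMatrix z.1) y.1 μ y.2 k)
        * ((1 / (l : ℝ)) * (z.2 (i, x.2) x.1 * z.2 (i, y.2) y.1)))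
      ((mixMeasure Cin m n).prod (mixMeasure Cout l n)) :=
  (integrable_residual_mul hCin hmn hn x.1 y.1 μ x.2 y.2 k).mul_prod
    (((memLp_coord_mixMeasure Cout (i, x.2) x.1).integrable_mul
      (memLp_coord_mixMeasure Cout (i, y.2) y.1)).const_mul _)

lemma integrable_mixError (hCin : IsCorrelationMatrix Cin) (Cout : Matrix (Fin P) (Fin P) ℝ)
    (hmn : n + 16 ≤ m) (hn : 0 < n) (l : ℕ) :
    Integrable (fun z : (Fin m × Fin n → EuclideanSpace ℝ (Fin P)) ×
        (Fin l × Fin n → EuclideanSpace ℝ (Fin P)) => mixError z.1 z.2)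
      ((mixMeasure Cin m n).prod (mixMeasure Cout l n)) := by
  simp only [mixError_eq_sum]
  exact integrable_finsetSum _ fun μ _ => integrable_finsetSum _ fun i _ =>
    integrable_finsetSum _ fun k _ => integrable_finsetSum _ fun x _ =>
    integrable_finsetSum _ fun y _ => integrable_mixError_term hCin hmn hn μ i k x y

/-- By Fubini only second moments of the targets enter: entries of one row in different columns are
uncorrelated, and equal columns give Cout/n. The l rows contribute equally and cancel the factor
1/l. -/
lemma integral_mixError (hCin : IsCorrelationMatrix Cin) (hCout : Cout.PosSemidef)
    (hmn : n + 16 ≤ m) (hn : 0 < n) (hl : 0 < l) :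
    ∫ z : (Fin m × Fin n → EuclideanSpace ℝ (Fin P)) ×
        (Fin l × Fin n → EuclideanSpace ℝ (Fin P)), mixError z.1 z.2
      ∂((mixMeasure Cin m n).prod (mixMeasure Cout l n))
      = ∫ a, meanError Cout (mixMatrix a) ∂(mixMeasure Cin m n) := by
  have hT := fun μ i k x y => integrable_mixError_term (Cout := Cout) (l := l)
    hCin hmn hn μ i k x y
  have hR := fun ν ν' μ j j' k => integrable_residual_mul hCin hmn hn ν ν' μ j j' k
  set I : Fin P → Fin P × Fin n → Fin P × Fin n → Fin n → ℝ := fun μ x y k =>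
    ∫ a, residual (mixMatrix a) x.1 μ x.2 k * residual (mixMatrix a) y.1 μ y.2 k
      ∂(mixMeasure Cin m n) with hI
  have hleft : ∫ z : (Fin m × Fin n → EuclideanSpace ℝ (Fin P)) ×
        (Fin l × Fin n → EuclideanSpace ℝ (Fin P)), mixError z.1 z.2
      ∂((mixMeasure Cin m n).prod (mixMeasure Cout l n))
      = ∑ μ, ∑ _i : Fin l, ∑ k, ∑ x : Fin P × Fin n, ∑ y : Fin P × Fin n,
        I μ x y k * ((1 / (l : ℝ)) *
          if x.2 = y.2 then 1 / (n : ℝ) * Cout x.1 y.1 else 0) := by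
    simp only [mixError_eq_sum]
    rw [integral_finsetSum _ fun μ _ => integrable_finsetSum _ fun i _ =>
      integrable_finsetSum _ fun k _ => integrable_finsetSum _ fun x _ =>
      integrable_finsetSum _ fun y _ => hT μ i k x y]
    refine Finset.sum_congr rfl fun μ _ => ?_
    rw [integral_finsetSum _ fun i _ =>
      integrable_finsetSum _ fun k _ => integrable_finsetSum _ fun x _ =>
      integrable_finsetSum _ fun y _ => hT μ i k x y]
    refine Finset.sum_congr rfl fun i _ => ?_
    rw [integral_finsetSum _ fun k _ => integrable_finsetSum _ fun x _ =>
      integrable_finsetSum _ fun y _ => hT μ i k x y]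
    refine Finset.sum_congr rfl fun k _ => ?_
    rw [integral_finsetSum _ fun x _ =>
      integrable_finsetSum _ fun y _ => hT μ i k x y]
    refine Finset.sum_congr rfl fun x _ => ?_
    rw [integral_finsetSum _ fun y _ => hT μ i k x y]
    refine Finset.sum_congr rfl fun y _ => ?_
    rw [integral_prod_mul (fun a => residual (mixMatrix a) x.1 μ x.2 k *
        residual (mixMatrix a) y.1 μ y.2 k)
      (fun b : Fin l × Fin n → EuclideanSpace ℝ (Fin P) =>
        (1 / (l : ℝ)) * (b (i, x.2) x.1 * b (i, y.2) y.1)), integral_const_mul,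
      integral_coord_mul_coord_mixMeasure hCout]
  have hright : ∫ a, meanError Cout (mixMatrix a) ∂(mixMeasure Cin m n)
      = ∑ μ, ∑ ν, ∑ ν', Cout ν ν' * ((1 / (n : ℝ)) * ∑ j, ∑ k, I μ (ν, j) (ν', j) k) := by
    have hM : ∀ μ ν ν', Integrable (fun a => Cout ν ν' * ((1 / (n : ℝ)) *
        ∑ j, ∑ k, residual (mixMatrix a) ν μ j k * residual (mixMatrix a) ν' μ j k))
        (mixMeasure Cin m n) := fun μ ν ν' => ((integrable_finsetSum _ fun j _ =>
      integrable_finsetSum _ fun k _ => hR ν ν' μ j j k).const_mul _).const_mul _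
    unfold meanError
    rw [integral_finsetSum _ fun μ _ => integrable_finsetSum _ fun ν _ =>
      integrable_finsetSum _ fun ν' _ => hM μ ν ν']
    refine Finset.sum_congr rfl fun μ _ => ?_
    rw [integral_finsetSum _ fun ν _ => integrable_finsetSum _ fun ν' _ => hM μ ν ν']
    refine Finset.sum_congr rfl fun ν _ => ?_
    rw [integral_finsetSum _ fun ν' _ => hM μ ν ν']
    refine Finset.sum_congr rfl fun ν' _ => ?_
    rw [integral_const_mul, integral_const_mul, integral_finsetSum _ fun j _ =>
      integrable_finsetSum _ fun k _ => hR ν ν' μ j j k]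
    congr 2
    refine Finset.sum_congr rfl fun j _ => ?_
    rw [integral_finsetSum _ fun k _ => hR ν ν' μ j j k]
  rw [hleft, hright]
  refine Finset.sum_congr rfl fun μ _ => ?_
  have hl' : (l : ℝ) ≠ 0 := by positivity
  rw [Finset.sum_const, Finset.card_univ, Fintype.card_fin, nsmul_eq_mul, Finset.mul_sum]
  calc ∑ k, (l : ℝ) * ∑ x : Fin P × Fin n, ∑ y : Fin P × Fin n,
        I μ x y k * ((1 / (l : ℝ)) * if x.2 = y.2 then 1 / (n : ℝ) * Cout x.1 y.1 else 0)
      = ∑ k, ∑ ν, ∑ j, ∑ ν', Cout ν ν' * ((1 / (n : ℝ)) * I μ (ν, j) (ν', j) k) := by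
        refine Finset.sum_congr rfl fun k _ => ?_
        rw [Finset.mul_sum, Fintype.sum_prod_type]
        refine Finset.sum_congr rfl fun ν _ => Finset.sum_congr rfl fun j _ => ?_
        rw [Finset.mul_sum, Fintype.sum_prod_type]
        refine Finset.sum_congr rfl fun ν' _ => ?_
        rw [Finset.sum_eq_single j]
        · rw [if_pos rfl]; field_simp
        · intro j' _ hj'
          rw [if_neg (Ne.symm hj')]; simp
        · simp
    _ = ∑ ν, ∑ ν', ∑ j, ∑ k, Cout ν ν' * ((1 / (n : ℝ)) * I μ (ν, j) (ν', j) k) := by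
        rw [Finset.sum_comm]
        refine Finset.sum_congr rfl fun ν _ => ?_
        rw [Finset.sum_comm]
        symm
        rw [Finset.sum_comm]
        exact Finset.sum_congr rfl fun j _ => Finset.sum_comm
    _ = _ := by simp only [Finset.mul_sum]

end TargetAverage

/-! ### From an arbitrary realization of the model to the product measure. -/

section Transfer

variable {P Ns Nx Ny : ℕ} {Cin Cout : Matrix (Fin P) (Fin P) ℝ} {Ω : Type*} [MeasurableSpace Ω]
  {prob : Measure Ω} {A : Ω → Fin P → Matrix (Fin Nx) (Fin Ns) ℝ}
  {B : Ω → Fin P → Matrix (Fin Ny) (Fin Ns) ℝ}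

lemma totalError_eq_mixError {A : Fin P → Matrix (Fin Nx) (Fin Ns) ℝ}
    {B : Fin P → Matrix (Fin Ny) (Fin Ns) ℝ} {W : Fin (P + 1) → Matrix (Fin Ny) (Fin Nx) ℝ}
    (hW : IsTrainedSequence A B W) (hA : ∀ μ, IsUnit ((A μ).transpose * A μ).det) :
    totalError A B (W (Fin.last P))
      = mixError (fun ij => entryVec A ij.1 ij.2) (fun ij => entryVec B ij.1 ij.2) := by
  have hmA : mixMatrix (fun ij => entryVec A ij.1 ij.2) = A := rfl
  have hmB : mixMatrix (fun ij => entryVec B ij.1 ij.2) = B := rfl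
  rw [totalError, mixError, hmA, hmB]
  congr 1
  refine Finset.sum_congr rfl fun μ _ => ?_
  rw [taskError_eq_sum_sq, hW.eq_sum_response hA]
  refine Finset.sum_congr rfl fun i _ => Finset.sum_congr rfl fun k _ => ?_
  congr 1
  have h1 : B μ - (∑ ν, B ν * response A (Fin.last P) ν) * A μ
      = ∑ ν, B ν * residual A ν μ := by
    have h0 : ∑ ν, B ν * (if ν = μ then 1 else 0 : Matrix (Fin Ns) (Fin Ns) ℝ) = B μ := by
      rw [Finset.sum_eq_single μ] <;> simp +contextual
    simp only [residual, Matrix.mul_sub, Finset.sum_sub_distrib, Matrix.mul_assoc, Matrix.sum_mul,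
      h0]
  rw [h1, Matrix.sum_apply]

/-- Joint independence of the input and target vectors identifies their law with a product over a
sum type, which splits into two factors. -/
lemma IsMixingModel.hasLaw (h : IsMixingModel Cin Cout prob A B) :
    HasLaw (fun ω => ((fun ij : Fin Nx × Fin Ns => entryVec (A ω) ij.1 ij.2),
      (fun ij : Fin Ny × Fin Ns => entryVec (B ω) ij.1 ij.2)))
      ((mixMeasure Cin Nx Ns).prod (mixMeasure Cout Ny Ns)) prob := by
  set ρ : (Fin Nx × Fin Ns) ⊕ (Fin Ny × Fin Ns) → Measure (EuclideanSpace ℝ (Fin P)) :=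
    Sum.elim (fun _ => multivariateGaussian 0 ((1 / (Ns : ℝ)) • Cin))
      (fun _ => multivariateGaussian 0 ((1 / (Ns : ℝ)) • Cout)) with hρ
  have hprob : ∀ s, IsProbabilityMeasure (ρ s) := by
    rintro (s | s) <;> simp only [hρ, Sum.elim_inl, Sum.elim_inr] <;> infer_instance
  have h1 := iIndepFun.hasLaw_pi (μ := ρ) (by
    rintro (s | s)
    · exact h.law_in s.1 s.2
    · exact h.law_out s.1 s.2) h.indep
  exact (measurePreserving_sumPiEquivProdPi (X := fun _ => EuclideanSpace ℝ (Fin P))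
    ρ).hasLaw.comp h1

lemma IsMixingModel.totalError_ae_eq (h : IsMixingModel Cin Cout prob A B)
    (hCin : IsCorrelationMatrix Cin) (hN : Ns + 16 ≤ Nx) (hNs : 0 < Ns)
    {W : Ω → Fin (P + 1) → Matrix (Fin Ny) (Fin Nx) ℝ}
    (hW : ∀ᵐ ω ∂prob, IsTrainedSequence (A ω) (B ω) (W ω)) :
    (fun ω => totalError (A ω) (B ω) (W ω (Fin.last P))) =ᵐ[prob]
      fun ω => mixError (fun ij => entryVec (A ω) ij.1 ij.2)
        (fun ij => entryVec (B ω) ij.1 ij.2) := by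
  have h1 : ∀ᵐ z ∂((mixMeasure Cin Nx Ns).prod (mixMeasure Cout Ny Ns)),
      ∀ μ, IsUnit ((mixMatrix z.1 μ).transpose * mixMatrix z.1 μ).det :=
    Measure.quasiMeasurePreserving_fst.ae (ae_isUnit_det_mixMatrix hCin hN hNs)
  rw [← h.hasLaw.map_eq] at h1
  filter_upwards [hW, ae_of_ae_map h.hasLaw.aemeasurable h1] with ω hω hu
  exact totalError_eq_mixError hω hu

lemma IsMixingModel.integrable_totalError (h : IsMixingModel Cin Cout prob A B)
    (hCin : IsCorrelationMatrix Cin) (hN : Ns + 16 ≤ Nx) (hNs : 0 < Ns)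
    {W : Ω → Fin (P + 1) → Matrix (Fin Ny) (Fin Nx) ℝ}
    (hW : ∀ᵐ ω ∂prob, IsTrainedSequence (A ω) (B ω) (W ω)) :
    Integrable (fun ω => totalError (A ω) (B ω) (W ω (Fin.last P))) prob := by
  refine Integrable.congr ?_ (h.totalError_ae_eq hCin hN hNs hW).symm
  have h1 := integrable_mixError hCin Cout hN hNs Ny
  rw [← h.hasLaw.map_eq] at h1
  exact h1.comp_aemeasurable h.hasLaw.aemeasurable

lemma IsMixingModel.integral_totalError (h : IsMixingModel Cin Cout prob A B)
    (hCin : IsCorrelationMatrix Cin) (hCout : IsCorrelationMatrix Cout) (hN : Ns + 16 ≤ Nx)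
    (hNs : 0 < Ns) (hNy : 0 < Ny) {W : Ω → Fin (P + 1) → Matrix (Fin Ny) (Fin Nx) ℝ}
    (hW : ∀ᵐ ω ∂prob, IsTrainedSequence (A ω) (B ω) (W ω)) :
    ∫ ω, totalError (A ω) (B ω) (W ω (Fin.last P)) ∂prob
      = ∫ a, meanError Cout (mixMatrix a) ∂(mixMeasure Cin Nx Ns) := by
  rw [integral_congr_ae (h.totalError_ae_eq hCin hN hNs hW),
    ← integral_mixError hCin hCout.posSemidef hN hNs hNy]
  exact h.hasLaw.integral_comp (integrable_mixError hCin Cout hN hNs Ny).aestronglyMeasurable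

end Transfer

/-! ### Passage to the limit Ns / Nx → 0. -/

section Limit

variable {P : ℕ} {Cin Cout : Matrix (Fin P) (Fin P) ℝ}

/-- As Ns is at least 1, 1/Nx is at most Ns/Nx. -/
lemma tendsto_atTop_of_div_tendsto_zero {Ns Nx : ℕ → ℕ} (hNs : ∀ n, 0 < Ns n)
    (hNx : ∀ n, 0 < Nx n)
    (h : Tendsto (fun n => (Ns n : ℝ) / (Nx n : ℝ)) atTop (𝓝 0)) :
    Tendsto (fun n => (Nx n : ℝ)) atTop atTop := by
  have h1 : Tendsto (fun n => ((Nx n : ℝ))⁻¹) atTop (𝓝 0) := by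
    refine squeeze_zero (fun n => by positivity) (fun n => ?_) h
    rw [inv_eq_one_div]
    gcongr
    exact_mod_cast hNs n
  have h2 : Tendsto (fun n => ((Nx n : ℝ))⁻¹) atTop (𝓝[>] 0) :=
    tendsto_nhdsWithin_iff.2 ⟨h1, Eventually.of_forall fun n => by
      have := hNx n
      simp only [Set.mem_Ioi]; positivity⟩
  exact h2.inv_tendsto_nhdsGT_zero.congr fun n => by simp

lemma eventually_add_le_of_div_tendsto_zero {Ns Nx : ℕ → ℕ} (hNs : ∀ n, 0 < Ns n)
    (hNx : ∀ n, 0 < Nx n)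
    (h : Tendsto (fun n => (Ns n : ℝ) / (Nx n : ℝ)) atTop (𝓝 0)) (k : ℕ) :
    ∀ᶠ n in atTop, Ns n + k ≤ Nx n := by
  filter_upwards [h.eventually_le_const (show (0 : ℝ) < 1 / 2 by norm_num),
    (tendsto_atTop_of_div_tendsto_zero hNs hNx h).eventually_ge_atTop (2 * k : ℝ)] with n h1 h2
  have h3 : (0 : ℝ) < Nx n := by exact_mod_cast hNx n
  rw [div_le_iff₀ h3] at h1
  have : (Ns n : ℝ) + k ≤ Nx n := by linarith
  exact_mod_cast this

lemma tendsto_integral_meanError (hCin : IsCorrelationMatrix Cin)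
    (hCout : IsCorrelationMatrix Cout) {Ns Nx : ℕ → ℕ} (hNs : ∀ n, 0 < Ns n)
    (hNx : ∀ n, 0 < Nx n)
    (h : Tendsto (fun n => (Ns n : ℝ) / (Nx n : ℝ)) atTop (𝓝 0)) :
    Tendsto (fun n => ∫ a, meanError Cout (mixMatrix a) ∂(mixMeasure Cin (Nx n) (Ns n))) atTop
      (𝓝 (limitError Cin Cout)) := by
  rw [Metric.tendsto_nhds]
  intro ε hε
  obtain ⟨c, hc, K, hK, hb⟩ := exists_abs_integral_meanError_sub_le hCin hCout (half_pos hε)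
  have hinf := tendsto_atTop_of_div_tendsto_zero hNs hNx h
  have hdecay : Tendsto (fun x : ℝ => K * (x ^ 8 * Real.exp (-(c * x)) + Real.exp (-(c * x))))
      atTop (𝓝 0) := by
    have h1 : Tendsto (fun x : ℝ => x ^ 8 * Real.exp (-(c * x))) atTop (𝓝 0) := by
      have := tendsto_rpow_mul_exp_neg_mul_atTop_nhds_zero 8 c hc
      refine this.congr fun x => ?_
      norm_num [neg_mul]
    have h2 : Tendsto (fun x : ℝ => Real.exp (-(c * x))) atTop (𝓝 0) := by
      have := tendsto_rpow_mul_exp_neg_mul_atTop_nhds_zero 0 c hc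
      refine this.congr fun x => ?_
      simp [neg_mul]
    simpa using (h1.add h2).const_mul K
  have hlog : 0 < Real.log 25 := Real.log_pos (by norm_num)
  -- The three conditions give the inverse moments, the domination of the net size 25^Ns by the
  -- tail, and a remainder below ε/2.
  filter_upwards [eventually_add_le_of_div_tendsto_zero hNs hNx h 16,
    h.eventually_le_const (show (0 : ℝ) < c / Real.log 25 by positivity),
    (hdecay.comp hinf).eventually_lt_const (half_pos hε)] with n h1 h2 h3
  have hx : (0 : ℝ) < Nx n := by exact_mod_cast hNx n
  rw [div_le_div_iff₀ hx hlog] at h2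
  have h4 := hb (Nx n) (Ns n) h1 (hNs n) h2
  rw [Real.dist_eq]
  simp only [Function.comp_apply] at h3
  linarith

end Limit

end ContinualLearning

theorem theorem1 :
    -- training to convergence determines the weights, for all task matrices
    (∀ (P Ns Nx Ny : ℕ) (A : Fin P → Matrix (Fin Nx) (Fin Ns) ℝ)
        (B : Fin P → Matrix (Fin Ny) (Fin Ns) ℝ),
      ∃! W, ContinualLearning.IsTrainedSequence A B W) ∧
    -- the expected final error in the limit `Ns / Nx → 0`
    (∀ (P : ℕ) (Cin Cout : Matrix (Fin P) (Fin P) ℝ),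
      ContinualLearning.IsCorrelationMatrix Cin → ContinualLearning.IsCorrelationMatrix Cout →
      ∀ (Ns Nx Ny : ℕ → ℕ), (∀ n, 0 < Ns n) → (∀ n, 0 < Nx n) → (∀ n, 0 < Ny n) →
      Tendsto (fun n => (Ns n : ℝ) / (Nx n : ℝ)) atTop (𝓝 0) →
      ∀ (Ω : ℕ → Type*) [∀ n, MeasurableSpace (Ω n)] (prob : ∀ n, Measure (Ω n))
        [∀ n, IsProbabilityMeasure (prob n)]
        (A : ∀ n, Ω n → Fin P → Matrix (Fin (Nx n)) (Fin (Ns n)) ℝ)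
        (B : ∀ n, Ω n → Fin P → Matrix (Fin (Ny n)) (Fin (Ns n)) ℝ)
        (W : ∀ n, Ω n → Fin (P + 1) → Matrix (Fin (Ny n)) (Fin (Nx n)) ℝ),
      (∀ n, ContinualLearning.IsMixingModel Cin Cout (prob n) (A n) (B n)) →
      (∀ n, ∀ᵐ ω ∂(prob n), ContinualLearning.IsTrainedSequence (A n ω) (B n ω) (W n ω)) →
      (∀ᶠ n in atTop, Integrable
        (fun ω => ContinualLearning.totalError (A n ω) (B n ω) (W n ω (Fin.last P))) (prob n)) ∧
      Tendsto
        (fun n => ∫ ω, ContinualLearning.totalError (A n ω) (B n ω) (W n ω (Fin.last P)) ∂(prob n))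
        atTop (𝓝 (ContinualLearning.limitError Cin Cout))) ∧
    -- this limit is not invariant under a reordering of the tasks
    (∀ P : ℕ, 3 ≤ P → ∃ (Cin Cout : Matrix (Fin P) (Fin P) ℝ) (σ : Equiv.Perm (Fin P)),
      ContinualLearning.IsCorrelationMatrix Cin ∧ ContinualLearning.IsCorrelationMatrix Cout ∧
      ContinualLearning.limitError (Cin.submatrix σ σ) (Cout.submatrix σ σ) ≠
        ContinualLearning.limitError Cin Cout) := by
  refine ⟨fun P Ns Nx Ny A B => ContinualLearning.existsUnique_isTrainedSequence A B, ?_,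
    fun P hP => ContinualLearning.exists_limitError_submatrix_ne hP⟩
  intro P Cin Cout hCin hCout Ns Nx Ny hNs hNx hNy hlim Ω _ prob _ A B W hmodel hW
  have hev := ContinualLearning.eventually_add_le_of_div_tendsto_zero hNs hNx hlim 16
  refine ⟨?_, ?_⟩
  · filter_upwards [hev] with n hn
    exact (hmodel n).integrable_totalError hCin hn (hNs n) (hW n)
  · refine (ContinualLearning.tendsto_integral_meanError hCin hCout hNs hNx hlim).congr' ?_
    filter_upwards [hev] with n hn
    exact ((hmodel n).integral_totalError hCin hCout hn (hNs n) (hNy n) (hW n)).symm
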